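/- Let $(M,g)$ be a (Hausdorff, smooth) Riemannian manifold of dimension $n$ with Levi-Civita connection $\nabla$. For $\Psi\in\Omega^{k+1}(M)$ let $\delta_g(\Psi)\in\Omega^{k}(M,TM)$ be given pointwise by $\delta_g(\Psi)=\sum_i(\imath_{e_i}\Psi)\otimes(e^i)^\#$, where $(e_i)$ is any basis of $T_pM$ with dual basis $(e^i)$, and $(e^i)^\#$ is the vector with $g((e^i)^\#,w)=e^i(w)$ for all $w$. For $K\in\Omega^k(M,TM)$ let $\imath_K$ be the operator on $\Omega^*(M)$ determined pointwise by $\imath_{\kappa\otimes X}\alpha=\kappa\wedge\imath_X\alpha$, and let $\mathcal L_K\alpha=\imath_K(d\alpha)+(-1)^k d(\imath_K\alpha)$. For $K_l\in\Omega^{k_l}(M,TM)$, $l=1,2$, the Frölicher-Nijenhuis bracket $[K_1,K_2]^{FN}$ is the unique element of $\Omega^{k_1+k_2}(M,TM)$ with $$\mathcal L_{[K_1,K_2]^{FN}}=\mathcal L_{K_1}\circ\mathcal L_{K_2}-(-1)^{k_1k_2}\mathcal L_{K_2}\circ\mathcal L_{K_1}\quad\text{on }\Omega^*(M).$$ Let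 $\Psi_l\in\Omega^{k_l+1}(M)$ with $k_l\ge 0$ and $K_l:=\delta_g(\Psi_l)$, $l=1,2$. Then there is exactly one such element $[K_1,K_2]^{FN}$, and for every $p\in M$ and every basis $(e_i)$ of $T_pM$ with dual basis $(e^i)$, writing $e_i^*:=(e^i)^\#$ and summing over repeated indices, $$\begin{aligned}{}[K_1,K_2]^{FN}_p=\Big(&(\imath_{e_i}\Psi_1)\wedge(\imath_{e_j}\nabla_{e_i^*}\Psi_2)-(-1)^{k_1}(\imath_{e_j}\imath_{e_i}\Psi_1)\wedge e^k\wedge\imath_{e_i^*}\nabla_{e_k}\Psi_2\\&-(\imath_{e_j}\nabla_{e_i}\Psi_1)\wedge(\imath_{e_i^*}\Psi_2)-(-1)^{k_1}e^k\wedge\imath_{e_i}\nabla_{e_k}\Psi_1\wedge(\imath_{e_j}\imath_{e_i^*}\Psi_2)\Big)\otimes(e^j)^\#.\end{aligned}$$ In particular, if $k$ is odd, $\Psi\in\Omega^{k+1}(M)$ and $K=\delta_g(\Psi)$, then $$[K,K]^{FN}_p=2\Big((\imath_{e_i}\Psi)\wedge(\imath_{e_j}\nabla_{e_i^*}\Psi)+(\imath_{e_j}\imath_{e_i}\Psi)\wedge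 e^k\wedge\imath_{e_i^*}\nabla_{e_k}\Psi\Big)\otimes(e^j)^\#.$$ If $(e_i)$ is orthonormal, then $e_i^*=e_i$, and both formulas hold with $e_i$ in place of $e_i^*$. -/

import Mathlib

open Bundle Manifold
open scoped ContDiff

/-! ## Exterior algebra on a real vector space -/

namespace FN

section Algebra

variable {V : Type*} [AddCommGroup V] [Module ℝ V]

/-- Regard a `k`-form as an `m`-form: the identity when `k = m`, and `0` otherwise. -/
noncomputable def toDegree (m : ℕ) {k : ℕ} (η : V [⋀^Fin k]→ₗ[ℝ] ℝ) : V [⋀^Fin m]→ₗ[ℝ] ℝ :=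
  if h : k = m then η.domDomCongr (finCongr h) else 0

/-- The exterior product of vector-valued forms along a bilinear pairing `B`,
`(α ∧ β)(v₁, …) = ∑ sign σ • B (α (v_{σ 1}, …, v_{σ k})) (β (v_{σ (k+1)}, …, v_{σ (k+l)}))`,
the sum being over the `(k, l)`-shuffles `σ`. -/
noncomputable def wedgeWith {N₁ N₂ N₃ : Type*} [AddCommGroup N₁] [Module ℝ N₁]
    [AddCommGroup N₂] [Module ℝ N₂] [AddCommGroup N₃] [Module ℝ N₃]
    (B : N₁ →ₗ[ℝ] N₂ →ₗ[ℝ] N₃) {k l : ℕ}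
    (α : V [⋀^Fin k]→ₗ[ℝ] N₁) (β : V [⋀^Fin l]→ₗ[ℝ] N₂) : V [⋀^Fin (k + l)]→ₗ[ℝ] N₃ :=
  (TensorProduct.lift B).compAlternatingMap
    ((AlternatingMap.domCoprod α β).domDomCongr finSumFinEquiv)

/-- The wedge product of real-valued forms. -/
noncomputable def wedge {k l : ℕ} (α : V [⋀^Fin k]→ₗ[ℝ] ℝ) (β : V [⋀^Fin l]→ₗ[ℝ] ℝ) :
    V [⋀^Fin (k + l)]→ₗ[ℝ] ℝ :=
  wedgeWith (LinearMap.mul ℝ ℝ) α β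

/-- The interior product `ι_v η = η(v, ·, …, ·)`; it is `0` on forms of degree `0`. -/
def interiorProd (v : V) : {k : ℕ} → V [⋀^Fin k]→ₗ[ℝ] ℝ → V [⋀^Fin (k - 1)]→ₗ[ℝ] ℝ
  | 0, _ => 0
  | _ + 1, η => η.curryLeft v

/-- A covector, as a form of degree one. -/
def oneForm (φ : V →ₗ[ℝ] ℝ) : V [⋀^Fin 1]→ₗ[ℝ] ℝ :=
  AlternatingMap.ofSubsingleton ℝ V ℝ (0 : Fin 1) φ

/-- The vector-valued form `κ ⊗ x`. -/
def tensorVec {k : ℕ} (κ : V [⋀^Fin k]→ₗ[ℝ] ℝ) (x : V) : V [⋀^Fin k]→ₗ[ℝ] V :=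
  (LinearMap.toSpanSingleton ℝ V x).compAlternatingMap κ

/-- A `(k + 1)`-form `η` as the covector-valued `k`-form `(v₁, …, v_k) ↦ η(·, v₁, …, v_k)`. -/
def curryFirst {k : ℕ} (η : V [⋀^Fin (k + 1)]→ₗ[ℝ] ℝ) : V [⋀^Fin k]→ₗ[ℝ] (V →ₗ[ℝ] ℝ) where
  toFun v :=
    { toFun := fun x => η.curryLeft x v
      map_add' := fun x y => by simp
      map_smul' := fun c x => by simp }
  map_update_add' v i x y := by
    ext z
    exact (η.curryLeft z).map_update_add v i x y
  map_update_smul' v i c x := by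
    ext z
    exact (η.curryLeft z).map_update_smul v i c x
  map_eq_zero_of_eq' v i j h hij := by
    ext z
    exact (η.curryLeft z).map_eq_zero_of_eq v h hij

/-- The contraction `ι_K α` of a vector-valued form `K` with a form `α`:
`(ι_K α)(v₁, …) = ∑ sign σ • α(K(v_{σ 1}, …, v_{σ k}), v_{σ (k+1)}, …)` over shuffles, so that
`ι_{κ ⊗ x} α = κ ∧ ι_x α`; it is `0` when `α` has degree `0`. -/
noncomputable def contract {k : ℕ} (K : V [⋀^Fin k]→ₗ[ℝ] V) :
    {l : ℕ} → V [⋀^Fin l]→ₗ[ℝ] ℝ → V [⋀^Fin (k + (l - 1))]→ₗ[ℝ] ℝ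
  | 0, _ => 0
  | _ + 1, α => wedgeWith (LinearMap.id : (V →ₗ[ℝ] ℝ) →ₗ[ℝ] (V →ₗ[ℝ] ℝ)).flip K (curryFirst α)

theorem contract_tensorVec {k l : ℕ} (κ : V [⋀^Fin k]→ₗ[ℝ] ℝ) (x : V)
    (α : V [⋀^Fin (l + 1)]→ₗ[ℝ] ℝ) :
    contract (tensorVec κ x) α = wedge κ (interiorProd x α) := by
  ext v
  simp only [contract, wedge, wedgeWith, LinearMap.compAlternatingMap_apply,
    AlternatingMap.domDomCongr_apply, AlternatingMap.domCoprod_apply, sum_apply, map_sum]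
  refine Finset.sum_congr rfl fun σ _ => ?_
  induction σ using Quotient.inductionOn' with | _ σ
  simp only [AlternatingMap.domCoprod.summand_mk'']
  rcases Int.units_eq_one_or (Equiv.Perm.sign σ) with h | h <;> rw [h] <;>
    simp [tensorVec, curryFirst, interiorProd, Matrix.vecCons]

/-- The derivation action of an endomorphism on forms,
`(v₁, …, v_k) ↦ ∑ i, η(v₁, …, A v_i, …, v_k)`. -/
noncomputable def endAction (A : V →ₗ[ℝ] V) {k : ℕ} (η : V [⋀^Fin k]→ₗ[ℝ] ℝ) :
    V [⋀^Fin k]→ₗ[ℝ] ℝ :=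
  { (∑ i, η.toMultilinearMap.compLinearMap (Function.update (fun _ => LinearMap.id) i A) :
      MultilinearMap ℝ (fun _ : Fin k => V) ℝ) with
    map_eq_zero_of_eq' := by
      intro v a b hab hne
      have key : ∀ i, (fun j => (Function.update (fun _ => LinearMap.id) i A : Fin k → V →ₗ[ℝ] V) j
          (v j)) = Function.update v i (A (v i)) := by
        intro i
        ext1 j
        rcases eq_or_ne j i with rfl | h <;> simp [*]
      have hz : ∀ i, i ≠ a → i ≠ b → η (Function.update v i (A (v i))) = 0 := by
        intro i hia hib
        refine η.map_eq_zero_of_eq _ (i := a) (j := b) ?_ hne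
        simp [Function.update_of_ne hia.symm, Function.update_of_ne hib.symm, hab]
      have hs : Function.update v b (A (v b)) =
          Function.update v a (A (v a)) ∘ Equiv.swap a b := by
        ext1 j
        rcases eq_or_ne j a with rfl | ha
        · simp [Function.update_of_ne hne, Function.update_of_ne hne.symm, hab]
        · rcases eq_or_ne j b with rfl | hb
          · simp [hab]
          · simp [Equiv.swap_apply_of_ne_of_ne ha hb, Function.update_of_ne ha,
              Function.update_of_ne hb]
      simp only [MultilinearMap.toFun_eq_coe, sum_apply, MultilinearMap.compLinearMap_apply, key,
        AlternatingMap.coe_multilinearMap]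
      rw [← Finset.sum_subset (Finset.subset_univ {a, b}) (fun i _ hi => by
        simp only [Finset.mem_insert, Finset.mem_singleton, not_or] at hi
        exact hz i hi.1 hi.2), Finset.sum_pair hne, hs, η.map_swap _ hne, add_neg_cancel] }

theorem endAction_apply (A : V →ₗ[ℝ] V) {k : ℕ} (η : V [⋀^Fin k]→ₗ[ℝ] ℝ) (v : Fin k → V) :
    endAction A η v = ∑ i, η (Function.update v i (A (v i))) := by
  have key : ∀ i, (fun j => (Function.update (fun _ => LinearMap.id) i A : Fin k → V →ₗ[ℝ] V) j
      (v j)) = Function.update v i (A (v i)) := by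
    intro i
    ext1 j
    rcases eq_or_ne j i with rfl | h <;> simp [*]
  change (∑ i, η.toMultilinearMap.compLinearMap (Function.update (fun _ => LinearMap.id) i A) :
      MultilinearMap ℝ (fun _ : Fin k => V) ℝ) v = _
  simp only [sum_apply, MultilinearMap.compLinearMap_apply, key, AlternatingMap.coe_multilinearMap]

end Algebra

section Metric

variable {V : Type*} [NormedAddCommGroup V] [InnerProductSpace ℝ V] [FiniteDimensional ℝ V]

/-- The vector `φ^♯` metrically dual to a covector, i.e. `⟪φ^♯, w⟫ = φ w` for all `w`. -/
noncomputable def sharp : (V →ₗ[ℝ] ℝ) →ₗ[ℝ] V :=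
  ∑ i, (LinearMap.toSpanSingleton ℝ V (stdOrthonormalBasis ℝ V i)).comp
    (LinearMap.applyₗ (stdOrthonormalBasis ℝ V i))

theorem inner_sharp (φ : V →ₗ[ℝ] ℝ) (w : V) : inner ℝ (sharp φ) w = φ w := by
  conv_rhs => rw [← (stdOrthonormalBasis ℝ V).sum_repr' w]
  simp [sharp, sum_inner, inner_smul_left, mul_comm]

/-- The contraction of a form with the metric: `⟪δ(α)(v₁, …, v_k), w⟫ = α(w, v₁, …, v_k)`. -/
noncomputable def metricContraction {k : ℕ} (α : V [⋀^Fin (k + 1)]→ₗ[ℝ] ℝ) :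
    V [⋀^Fin k]→ₗ[ℝ] V :=
  sharp.compAlternatingMap (curryFirst α)

/-- `δ(α) = ∑ i, (ι_{e_i} α) ⊗ (e^i)^♯` for every basis. -/
theorem metricContraction_eq_sum {ι : Type*} [Fintype ι] (b : Module.Basis ι ℝ V) {k : ℕ}
    (α : V [⋀^Fin (k + 1)]→ₗ[ℝ] ℝ) :
    metricContraction α = ∑ i, tensorVec (interiorProd (b i) α) (sharp (b.coord i)) := by
  ext v
  have h : curryFirst α v = ∑ i, curryFirst α v (b i) • b.coord i := by
    refine b.ext fun j => ?_
    classical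
    simp
  have hs : ∀ (s : Finset ι) (f : ι → V [⋀^Fin k]→ₗ[ℝ] V), (∑ i ∈ s, f i) v = ∑ i ∈ s, f i v := by
    classical
    intro s f
    induction s using Finset.induction_on with
    | empty => simp
    | insert a s ha ih => simp [Finset.sum_insert ha, ih]
  rw [metricContraction, LinearMap.compAlternatingMap_apply, h, map_sum, hs]
  refine Finset.sum_congr rfl fun i _ => ?_
  rw [map_smul]
  rfl

end Metric

section Continuity

variable {n : ℕ} {F : Type*} [NormedAddCommGroup F] [NormedSpace ℝ F]

/-- Alternating maps on a Euclidean space are continuous. -/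
noncomputable def toCont {k : ℕ} (η : EuclideanSpace ℝ (Fin n) [⋀^Fin k]→ₗ[ℝ] F) :
    EuclideanSpace ℝ (Fin n) [⋀^Fin k]→L[ℝ] F :=
  { η with
    cont := by
      let b := (EuclideanSpace.basisFun (Fin n) ℝ).toBasis
      have h : ∀ v : Fin k → EuclideanSpace ℝ (Fin n),
          η v = ∑ r : Fin k → Fin n, (∏ i, b.repr (v i) (r i)) • η (fun i => b (r i)) := by
        intro v
        conv_lhs => rw [show v = fun i => ∑ j, b.repr (v i) j • b j from
          funext fun i => (b.sum_repr (v i)).symm]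
        have := η.toMultilinearMap.map_sum (fun i j => b.repr (v i) j • b j)
        rw [AlternatingMap.coe_multilinearMap] at this
        rw [this]
        exact Finset.sum_congr rfl fun r _ => η.toMultilinearMap.map_smul_univ _ _
      change Continuous fun v => η v
      rw [show (fun v => η v) = _ from funext h]
      simp only [b, OrthonormalBasis.coe_toBasis_repr_apply, EuclideanSpace.basisFun_repr]
      fun_prop }

end Continuity

/-! ## Differential forms on a manifold -/

section Forms

variable {n : ℕ} {M : Type*} [TopologicalSpace M] [ChartedSpace (EuclideanSpace ℝ (Fin n)) M]

variable (n M) in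
/-- Fields of `k`-covectors on `M`. -/
abbrev Form (k : ℕ) : Type _ := ∀ p : M, TangentSpace (𝓡 n) p [⋀^Fin k]→ₗ[ℝ] ℝ

variable (n M) in
/-- Fields of `TM`-valued `k`-covectors on `M`. -/
abbrev VForm (k : ℕ) : Type _ :=
  ∀ p : M, TangentSpace (𝓡 n) p [⋀^Fin k]→ₗ[ℝ] TangentSpace (𝓡 n) p

/-- The differential at `y` of the inverse of the chart around `p`. -/
noncomputable def chartSymmDeriv (p : M) (y : EuclideanSpace ℝ (Fin n)) :
    EuclideanSpace ℝ (Fin n) →ₗ[ℝ] TangentSpace (𝓡 n) ((extChartAt (𝓡 n) p).symm y) :=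
  (mfderiv (𝓡 n) (𝓡 n) (extChartAt (𝓡 n) p).symm y).toLinearMap

/-- The differential at `q` of the chart around `p`. -/
noncomputable def chartDeriv (p q : M) :
    TangentSpace (𝓡 n) q →ₗ[ℝ] EuclideanSpace ℝ (Fin n) :=
  (mfderiv (𝓡 n) (𝓡 n) (extChartAt (𝓡 n) p) q).toLinearMap

/-- The form `η` in the chart around `p`: its pullback under the inverse of the chart. -/
noncomputable def inChart {k : ℕ} (η : Form n M k) (p : M) (y : EuclideanSpace ℝ (Fin n)) :
    EuclideanSpace ℝ (Fin n) [⋀^Fin k]→L[ℝ] ℝ :=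
  toCont ((η ((extChartAt (𝓡 n) p).symm y)).compLinearMap (chartSymmDeriv p y))

/-- The `TM`-valued form `K` in the chart around `p`. -/
noncomputable def inChartV {k : ℕ} (K : VForm n M k) (p : M) (y : EuclideanSpace ℝ (Fin n)) :
    EuclideanSpace ℝ (Fin n) [⋀^Fin k]→L[ℝ] EuclideanSpace ℝ (Fin n) :=
  toCont ((chartDeriv p ((extChartAt (𝓡 n) p).symm y)).compAlternatingMap
    ((K ((extChartAt (𝓡 n) p).symm y)).compLinearMap (chartSymmDeriv p y)))

/-- `η ∈ Ω^k(M)`: the form is smooth in the charts. -/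
def SmoothForm {k : ℕ} (η : Form n M k) : Prop :=
  ∀ p : M, ContDiffOn ℝ ∞ (inChart η p) (extChartAt (𝓡 n) p).target

/-- `K ∈ Ω^k(M, TM)`: the `TM`-valued form is smooth in the charts. -/
def SmoothVForm {k : ℕ} (K : VForm n M k) : Prop :=
  ∀ p : M, ContDiffOn ℝ ∞ (inChartV K p) (extChartAt (𝓡 n) p).target

/-- The exterior derivative, computed at each point in the chart around that point. -/
noncomputable def extD {k : ℕ} (η : Form n M k) : Form n M (k + 1) := fun p =>
  (extDeriv (inChart η p) (extChartAt (𝓡 n) p p)).toAlternatingMap.compLinearMap (chartDeriv p p)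

/-! ## The Frölicher-Nijenhuis bracket -/

/-- The contraction `ι_K α` on the manifold. -/
noncomputable def iota {k l : ℕ} (K : VForm n M k) (α : Form n M l) : Form n M (k + (l - 1)) :=
  fun p => contract (K p) (α p)

/-- The Nijenhuis-Lie derivative `L_K α = ι_K (dα) + (-1)^k d(ι_K α)`. -/
noncomputable def nijLie {k l : ℕ} (K : VForm n M k) (α : Form n M l) : Form n M (k + l) :=
  fun p =>
  toDegree (k + l) (iota K (extD α) p) + (-1 : ℝ) ^ k • toDegree (k + l) (extD (iota K α) p)

/-- `K ∈ Ω^{k₁+k₂}(M, TM)` and `L_K = L_{K₁} ∘ L_{K₂} - (-1)^{k₁ k₂} L_{K₂} ∘ L_{K₁}` on `Ω^*(M)`. -/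
def IsFNBracket {k₁ k₂ : ℕ} (K₁ : VForm n M k₁) (K₂ : VForm n M k₂) (K : VForm n M (k₁ + k₂)) :
    Prop :=
  SmoothVForm K ∧ ∀ (l : ℕ) (α : Form n M l), SmoothForm α → ∀ p : M,
    nijLie K α p = toDegree (k₁ + k₂ + l) (nijLie K₁ (nijLie K₂ α) p)
      - (-1 : ℝ) ^ (k₁ * k₂) • toDegree (k₁ + k₂ + l) (nijLie K₂ (nijLie K₁ α) p)

open Classical in
/-- The Frölicher-Nijenhuis bracket: the element `[K₁, K₂]` of `Ω^{k₁+k₂}(M, TM)` with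
`L_{[K₁, K₂]} = [L_{K₁}, L_{K₂}]`. -/
noncomputable def fnBracket {k₁ k₂ : ℕ} (K₁ : VForm n M k₁) (K₂ : VForm n M k₂) :
    VForm n M (k₁ + k₂) :=
  if h : ∃ K, IsFNBracket K₁ K₂ K then h.choose else 0

/-! ## The Levi-Civita connection and its action on forms -/

variable [IsManifold (𝓡 n) ∞ M]

theorem extend_add_tangent {p q : M} (w w' : TangentSpace (𝓡 n) p)
    (hq : q ∈ (trivializationAt (EuclideanSpace ℝ (Fin n))
      (TangentSpace (𝓡 n) : M → Type _) p).baseSet) :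
    (FiberBundle.extend (EuclideanSpace ℝ (Fin n)) (w + w') q : TangentSpace (𝓡 n) q) =
      FiberBundle.extend (EuclideanSpace ℝ (Fin n)) w q
        + FiberBundle.extend (EuclideanSpace ℝ (Fin n)) w' q := by
  have hp := FiberBundle.mem_baseSet_trivializationAt' (F := EuclideanSpace ℝ (Fin n))
    (E := (TangentSpace (𝓡 n) : M → Type _)) p
  simp only [FiberBundle.extend]
  rw [((trivializationAt (EuclideanSpace ℝ (Fin n))
      (TangentSpace (𝓡 n) : M → Type _) p).linear ℝ hp).map_add w w',
    ← Trivialization.coe_symmₗ (R := ℝ) _ hq]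
  exact map_add _ _ _

theorem extend_smul_tangent {p q : M} (c : ℝ) (w : TangentSpace (𝓡 n) p)
    (hq : q ∈ (trivializationAt (EuclideanSpace ℝ (Fin n))
      (TangentSpace (𝓡 n) : M → Type _) p).baseSet) :
    (FiberBundle.extend (EuclideanSpace ℝ (Fin n)) (c • w) q : TangentSpace (𝓡 n) q) =
      c • FiberBundle.extend (EuclideanSpace ℝ (Fin n)) w q := by
  have hp := FiberBundle.mem_baseSet_trivializationAt' (F := EuclideanSpace ℝ (Fin n))
    (E := (TangentSpace (𝓡 n) : M → Type _)) p
  simp only [FiberBundle.extend]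
  rw [((trivializationAt (EuclideanSpace ℝ (Fin n))
      (TangentSpace (𝓡 n) : M → Type _) p).linear ℝ hp).map_smul c w,
    ← Trivialization.coe_symmₗ (R := ℝ) _ hq]
  exact map_smul _ _ _

/-- The connection coefficients `w ↦ ∇_v W`, where `W` is the field with constant components in
the chart around `p` that extends `w ∈ T_pM`. -/
noncomputable def connCoeff
    (cov : CovariantDerivative (𝓡 n) (EuclideanSpace ℝ (Fin n)) (TangentSpace (𝓡 n) : M → Type _))
    (p : M) (v : TangentSpace (𝓡 n) p) : TangentSpace (𝓡 n) p →ₗ[ℝ] TangentSpace (𝓡 n) p where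
  toFun w := cov (FiberBundle.extend (EuclideanSpace ℝ (Fin n)) w) p v
  map_add' w w' := by
    have hw := FiberBundle.mdifferentiableAt_extend (𝓡 n) (EuclideanSpace ℝ (Fin n)) w
    have hw' := FiberBundle.mdifferentiableAt_extend (𝓡 n) (EuclideanSpace ℝ (Fin n)) w'
    rw [(cov.isCovariantDerivativeOn (s := (trivializationAt (EuclideanSpace ℝ (Fin n))
        (TangentSpace (𝓡 n) : M → Type _) p).baseSet)).congr_of_eqOn
      (FiberBundle.mdifferentiableAt_extend (𝓡 n) (EuclideanSpace ℝ (Fin n)) (w + w'))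
      (mdifferentiableAt_add_section hw hw')
      ((trivializationAt (EuclideanSpace ℝ (Fin n))
        (TangentSpace (𝓡 n) : M → Type _) p).open_baseSet.mem_nhds
          (FiberBundle.mem_baseSet_trivializationAt' p))
      (fun q hq => extend_add_tangent w w' hq),
      cov.isCovariantDerivativeOnUniv.add hw hw']
    rfl
  map_smul' c w := by
    have hw := FiberBundle.mdifferentiableAt_extend (𝓡 n) (EuclideanSpace ℝ (Fin n)) w
    rw [(cov.isCovariantDerivativeOn (s := (trivializationAt (EuclideanSpace ℝ (Fin n))
        (TangentSpace (𝓡 n) : M → Type _) p).baseSet)).congr_of_eqOn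
      (FiberBundle.mdifferentiableAt_extend (𝓡 n) (EuclideanSpace ℝ (Fin n)) (c • w))
      (MDifferentiableAt.smul_const_section hw)
      ((trivializationAt (EuclideanSpace ℝ (Fin n))
        (TangentSpace (𝓡 n) : M → Type _) p).open_baseSet.mem_nhds
          (FiberBundle.mem_baseSet_trivializationAt' p))
      (fun q hq => extend_smul_tangent c w hq),
      cov.isCovariantDerivativeOnUniv.smul_const c hw]
    rfl

/-- The induced covariant derivative of forms,
`(∇_v Ψ)(w₁, …, w_k) = v(Ψ(W₁, …, W_k)) - ∑ i, Ψ(w₁, …, ∇_v W_i, …, w_k)`,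
where `W_i` is the field with constant components in the chart around `p` that extends `w_i`. -/
noncomputable def covDerivForm
    (cov : CovariantDerivative (𝓡 n) (EuclideanSpace ℝ (Fin n)) (TangentSpace (𝓡 n) : M → Type _))
    {k : ℕ} (Ψ : Form n M k) (p : M) (v : TangentSpace (𝓡 n) p) :
    TangentSpace (𝓡 n) p [⋀^Fin k]→ₗ[ℝ] ℝ :=
  (fderiv ℝ (inChart Ψ p) (extChartAt (𝓡 n) p p) (chartDeriv p p v)).toAlternatingMap.compLinearMap
      (chartDeriv p p)
    - endAction (connCoeff cov p v) (Ψ p)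

variable [RiemannianBundle (TangentSpace (𝓡 n) : M → Type _)]
  [IsContMDiffRiemannianBundle (𝓡 n) ∞ (EuclideanSpace ℝ (Fin n))
    (TangentSpace (𝓡 n) : M → Type _)]

instance tangentSpaceFiniteDimensional (p : M) : FiniteDimensional ℝ (TangentSpace (𝓡 n) p) :=
  inferInstanceAs (FiniteDimensional ℝ (EuclideanSpace ℝ (Fin n)))

instance riemannianBundleOne : IsContMDiffRiemannianBundle (𝓡 n) 1 (EuclideanSpace ℝ (Fin n))
    (TangentSpace (𝓡 n) : M → Type _) :=
  IsContMDiffRiemannianBundle.of_le (n := ∞) (by simp)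

/-- The Levi-Civita connection: metric and torsion-free. -/
def IsLeviCivita
    (cov : CovariantDerivative (𝓡 n) (EuclideanSpace ℝ (Fin n))
      (TangentSpace (𝓡 n) : M → Type _)) : Prop :=
  cov.IsMetricCompatible ∧ cov.torsion = 0

/-- `δ_g(Ψ) ∈ Ω^k(M, TM)` for `Ψ ∈ Ω^{k+1}(M)`. -/
noncomputable def delta {k : ℕ} (Ψ : Form n M (k + 1)) : VForm n M k := fun p =>
  metricContraction (Ψ p)

end Forms

end FN

open FN

/-! In coordinates write K = Σ κ^i ⊗ ∂_i. Then L_K α = Σ κ^i ∧ ∂_i α + (-1)^k Σ dκ^i ∧ ι_i α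
(`embC_flatLie`), since the remaining derivatives of α cancel between ι_K dα and d ι_K α. In L_{K₁}
L_{K₂} α the derivatives that fall on the coefficients of K₂ give Σ L_{K₁}(κ₂^j) ∧ ∂_j α + (-1)^{k₂}
Σ L_{K₁}(dκ₂^j) ∧ ι_j α (`lieExpr_lieExpr`). Everything else cancels in the graded commutator,
because second derivatives commute and interior products anticommute (`crossTerm_cancel`). As L_K
commutes with d up to sign, what is left is the Lie derivative along the form with components L_{K₁}
κ₂^j - (-1)^{k₁k₂} L_{K₂} κ₁^j (`embC_flatLie_flatBracket`).

On functions L_K f = df ∘ K (`flatLie_function`). On a Hausdorff manifold every covector is the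
differential of a global smooth function (`exists_extD_eq`), so the bracket is determined by the
commutator on functions. This gives uniqueness. It also gives existence: the commutator is defined
without charts, hence the brackets computed in different charts agree (`bracketAt_eq`).

For the formula, replace the partial derivatives at p by covariant ones. With symmetric connection
coefficients each half L_{K₁} κ₂ of the bracket changes only by Σ φ(Γ(e_i, e_a)) κ₁^i ∧ κ₂^a, and
these corrections cancel between the halves (`brHalf_of_isCovDeriv`, `brExpr_of_isCovDeriv`). A
metric connection commutes with raising an index, so ∇ δ_g(Ψ) = δ_g(∇Ψ) (`isCovDeriv_delta`). The
components of δ_g(Ψ) are interior products of Ψ, and reordering the factors yields the four terms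
(`brExpr_metricContraction`).

Identities between forms are proved in the direct sum of all degrees, which is a ring, so that
products need no degree casts; `emb` is injective on each degree and brings the result back. -/

namespace FN

/-! ### The exterior product: antiderivation rule, associativity, graded commutativity -/

section Shuffle

variable {V : Type*} [AddCommGroup V] [Module ℝ V]

/-- The exterior product of forms, placed in degree `m`. -/
noncomputable def wedgeTo (m : ℕ) {k l : ℕ} (α : V [⋀^Fin k]→ₗ[ℝ] ℝ) (β : V [⋀^Fin l]→ₗ[ℝ] ℝ) :
    V [⋀^Fin m]→ₗ[ℝ] ℝ :=
  toDegree m (wedge α β)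

theorem toDegree_self {k : ℕ} (η : V [⋀^Fin k]→ₗ[ℝ] ℝ) : toDegree k η = η := by
  ext v
  simp [toDegree]

theorem toDegree_of_ne {k m : ℕ} (h : k ≠ m) (η : V [⋀^Fin k]→ₗ[ℝ] ℝ) : toDegree m η = 0 := by
  simp [toDegree, h]

theorem toDegree_add {k m : ℕ} (η θ : V [⋀^Fin k]→ₗ[ℝ] ℝ) :
    toDegree m (η + θ) = toDegree m η + toDegree m θ := by
  unfold toDegree
  split_ifs
  · rfl
  · simp

theorem toDegree_smul {k m : ℕ} (c : ℝ) (η : V [⋀^Fin k]→ₗ[ℝ] ℝ) :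
    toDegree m (c • η) = c • toDegree m η := by
  unfold toDegree
  split_ifs
  · rfl
  · simp

theorem wedgeTo_self {k l : ℕ} (α : V [⋀^Fin k]→ₗ[ℝ] ℝ) (β : V [⋀^Fin l]→ₗ[ℝ] ℝ) :
    wedgeTo (k + l) α β = wedge α β :=
  toDegree_self _

section WedgeWith

variable {N₁ N₂ N₃ : Type*} [AddCommGroup N₁] [Module ℝ N₁] [AddCommGroup N₂] [Module ℝ N₂]
  [AddCommGroup N₃] [Module ℝ N₃] (B : N₁ →ₗ[ℝ] N₂ →ₗ[ℝ] N₃) {k l : ℕ}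

theorem wedgeWith_add_left (α α' : V [⋀^Fin k]→ₗ[ℝ] N₁) (β : V [⋀^Fin l]→ₗ[ℝ] N₂) :
    wedgeWith B (α + α') β = wedgeWith B α β + wedgeWith B α' β := by
  unfold wedgeWith
  rw [← AlternatingMap.domCoprod'_apply, TensorProduct.add_tmul, map_add]
  ext v
  simp

theorem wedgeWith_add_right (α : V [⋀^Fin k]→ₗ[ℝ] N₁) (β β' : V [⋀^Fin l]→ₗ[ℝ] N₂) :
    wedgeWith B α (β + β') = wedgeWith B α β + wedgeWith B α β' := by
  unfold wedgeWith
  rw [← AlternatingMap.domCoprod'_apply, TensorProduct.tmul_add, map_add]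
  ext v
  simp

theorem wedgeWith_smul_left (c : ℝ) (α : V [⋀^Fin k]→ₗ[ℝ] N₁) (β : V [⋀^Fin l]→ₗ[ℝ] N₂) :
    wedgeWith B (c • α) β = c • wedgeWith B α β := by
  unfold wedgeWith
  rw [← AlternatingMap.domCoprod'_apply, ← TensorProduct.smul_tmul', map_smul]
  ext v
  simp

theorem wedgeWith_smul_right (c : ℝ) (α : V [⋀^Fin k]→ₗ[ℝ] N₁) (β : V [⋀^Fin l]→ₗ[ℝ] N₂) :
    wedgeWith B α (c • β) = c • wedgeWith B α β := by
  unfold wedgeWith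
  rw [← AlternatingMap.domCoprod'_apply, TensorProduct.tmul_smul, map_smul]
  ext v
  simp

/-- Each shuffle class contains k! l! permutations, on which the summand is constant. Trading the
quotient for a sum over all permutations costs only a nonzero factor, which can be cancelled later.
-/
theorem factorial_smul_wedgeWith (α : V [⋀^Fin k]→ₗ[ℝ] N₁) (β : V [⋀^Fin l]→ₗ[ℝ] N₂)
    (v : Fin (k + l) → V) :
    ((k.factorial : ℝ) * (l.factorial : ℝ)) • wedgeWith B α β v =
      ∑ σ : Equiv.Perm (Fin (k + l)), ((Equiv.Perm.sign σ : ℤ) : ℝ) •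
        B (α fun i => v (σ (Fin.castAdd l i))) (β fun j => v (σ (Fin.natAdd k j))) := by
  have h := MultilinearMap.domCoprod_alternization_eq (R' := ℝ) α β
  have h2 := congrArg (fun f => TensorProduct.lift B (f (v ∘ finSumFinEquiv))) h
  simp only [MultilinearMap.alternatization_apply, Fintype.card_fin, map_sum,
    AlternatingMap.smul_apply] at h2
  have h3 : wedgeWith B α β v = TensorProduct.lift B ((α.domCoprod β) (v ∘ finSumFinEquiv)) := rfl
  rw [h3, ← Nat.cast_mul, Nat.cast_smul_eq_nsmul, ← map_nsmul, ← h2]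
  refine Fintype.sum_equiv (Equiv.permCongr finSumFinEquiv) _ _ fun σ => ?_
  rw [Equiv.Perm.sign_permCongr]
  rw [Units.smul_def, map_zsmul, ← Int.cast_smul_eq_zsmul ℝ]
  simp [Equiv.permCongr_apply, Function.comp_def]

end WedgeWith

theorem wedgeTo_add_left {k l m : ℕ} (α α' : V [⋀^Fin k]→ₗ[ℝ] ℝ) (β : V [⋀^Fin l]→ₗ[ℝ] ℝ) :
    wedgeTo m (α + α') β = wedgeTo m α β + wedgeTo m α' β := by
  rw [wedgeTo, wedge, wedgeWith_add_left, toDegree_add]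
  rfl

theorem wedgeTo_add_right {k l m : ℕ} (α : V [⋀^Fin k]→ₗ[ℝ] ℝ) (β β' : V [⋀^Fin l]→ₗ[ℝ] ℝ) :
    wedgeTo m α (β + β') = wedgeTo m α β + wedgeTo m α β' := by
  rw [wedgeTo, wedge, wedgeWith_add_right, toDegree_add]
  rfl

theorem wedgeTo_smul_left {k l m : ℕ} (c : ℝ) (α : V [⋀^Fin k]→ₗ[ℝ] ℝ)
    (β : V [⋀^Fin l]→ₗ[ℝ] ℝ) : wedgeTo m (c • α) β = c • wedgeTo m α β := by
  rw [wedgeTo, wedge, wedgeWith_smul_left, toDegree_smul]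
  rfl

theorem wedgeTo_smul_right {k l m : ℕ} (c : ℝ) (α : V [⋀^Fin k]→ₗ[ℝ] ℝ)
    (β : V [⋀^Fin l]→ₗ[ℝ] ℝ) : wedgeTo m α (c • β) = c • wedgeTo m α β := by
  rw [wedgeTo, wedge, wedgeWith_smul_right, toDegree_smul]
  rfl

theorem wedgeTo_zero_left {k l m : ℕ} (β : V [⋀^Fin l]→ₗ[ℝ] ℝ) :
    wedgeTo m (0 : V [⋀^Fin k]→ₗ[ℝ] ℝ) β = 0 := by
  simpa using wedgeTo_smul_left (m := m) (0 : ℝ) (0 : V [⋀^Fin k]→ₗ[ℝ] ℝ) β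

theorem wedgeTo_zero_right {k l m : ℕ} (α : V [⋀^Fin k]→ₗ[ℝ] ℝ) :
    wedgeTo m α (0 : V [⋀^Fin l]→ₗ[ℝ] ℝ) = 0 := by
  simpa using wedgeTo_smul_right (m := m) (0 : ℝ) α (0 : V [⋀^Fin l]→ₗ[ℝ] ℝ)

theorem factorial_mul_wedgeTo {k l m : ℕ} (h : k + l = m) (α : V [⋀^Fin k]→ₗ[ℝ] ℝ)
    (β : V [⋀^Fin l]→ₗ[ℝ] ℝ) (v : Fin m → V) :
    ((k.factorial : ℝ) * (l.factorial : ℝ)) * wedgeTo m α β v =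
      ∑ σ : Equiv.Perm (Fin m), ((Equiv.Perm.sign σ : ℤ) : ℝ) *
        (α (fun i => v (σ (Fin.cast h (Fin.castAdd l i)))) *
          β (fun j => v (σ (Fin.cast h (Fin.natAdd k j))))) := by
  subst h
  rw [wedgeTo_self]
  exact factorial_smul_wedgeWith (LinearMap.mul ℝ ℝ) α β v

/-- The permutations of `Fin (m + 1)`, by the preimage of `0` and the rest. -/
theorem sum_perm_succ {X : Type*} {m : ℕ} (x : X) (w : Fin m → X) (f : (Fin (m + 1) → X) → ℝ) :
    ∑ σ : Equiv.Perm (Fin (m + 1)), ((Equiv.Perm.sign σ : ℤ) : ℝ) *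
        f (fun i => (Fin.cons x w : Fin (m + 1) → X) (σ i)) =
      ∑ i : Fin (m + 1), (-1 : ℝ) ^ (i : ℕ) * ∑ τ : Equiv.Perm (Fin m),
        ((Equiv.Perm.sign τ : ℤ) : ℝ) * f (i.insertNth x (fun j => w (τ j))) := by
  -- Every σ is uniquely a permutation that fixes 0 and acts by τ on the rest, after the cycle of
  -- sign (-1)^i that takes i = σ⁻¹ 0 to 0. Injectivity suffices, by counting.
  have hb : Function.Bijective (fun q : Fin (m + 1) × Equiv.Perm (Fin m) =>
      Equiv.Perm.decomposeFin.symm (0, q.2) * q.1.cycleRange) := by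
    rw [Fintype.bijective_iff_injective_and_card]
    constructor
    · rintro ⟨i, τ⟩ ⟨i', τ'⟩ h
      simp only at h
      have h0 : i = i' := by
        have h1 := congrArg (fun σ : Equiv.Perm (Fin (m + 1)) => σ i) h
        simp only [Equiv.Perm.mul_apply, Fin.cycleRange_self,
          Equiv.Perm.decomposeFin_symm_apply_zero] at h1
        have h2 : Equiv.Perm.decomposeFin.symm ((0 : Fin (m + 1)), τ') 0 =
            Equiv.Perm.decomposeFin.symm (0, τ') (i'.cycleRange i) := by
          rw [← h1]; simp
        have h3 := (Equiv.injective _ h2).symm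
        rw [← Fin.cycleRange_self i'] at h3
        exact Equiv.injective _ h3
      subst h0
      have := Equiv.injective _ (mul_right_cancel h)
      simpa using this
    · simp [Fintype.card_perm, Nat.factorial_succ]
  rw [← Function.Bijective.sum_comp hb, Fintype.sum_prod_type]
  refine Finset.sum_congr rfl fun i _ => ?_
  rw [Finset.mul_sum]
  refine Finset.sum_congr rfl fun τ _ => ?_
  rw [← Fin.cons_comp_cycleRange, Equiv.Perm.sign_mul, Fin.sign_cycleRange]
  have : (fun a => (Fin.cons x w : Fin (m + 1) → X)
      ((Equiv.Perm.decomposeFin.symm (0, τ) * i.cycleRange) a)) =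
      (Fin.cons x (fun j => w (τ j)) : Fin (m + 1) → X) ∘ i.cycleRange := by
    funext a
    simp only [Equiv.Perm.mul_apply, Function.comp_apply]
    generalize i.cycleRange a = b
    refine Fin.cases ?_ (fun j => ?_) b
    · simp
    · simp
  rw [this]
  simp
  ring

theorem interiorProd_apply {k : ℕ} (x : V) (η : V [⋀^Fin (k + 1)]→ₗ[ℝ] ℝ) (v : Fin k → V) :
    interiorProd x η v = η (Fin.cons x v) := rfl

theorem interiorProd_zero_degree (x : V) (η : V [⋀^Fin 0]→ₗ[ℝ] ℝ) : interiorProd x η = 0 := rfl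

/-- This and the next three lemmas track an insertion into a list split in two blocks: the block
that contains the position sees an insertion, the other block is unchanged. -/
theorem insertNth_castAdd {X : Type*} {k l m : ℕ} (h : k + 1 + l = m + 1) (h' : k + l = m) (a : Fin (k + 1))
    (x : X) (u : Fin m → X) :
    (fun i => (Fin.insertNth (α := fun _ => X) (Fin.cast h (Fin.castAdd l a)) x u)
      (Fin.cast h (Fin.castAdd l i))) =
      Fin.insertNth (α := fun _ => X) a x (fun i => u (Fin.cast h' (Fin.castAdd l i))) := by
  rw [Fin.eq_insertNth_iff]
  constructor
  · simp
  · funext j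
    have : Fin.cast h (Fin.castAdd l (a.succAbove j)) =
        (Fin.cast h (Fin.castAdd l a)).succAbove (Fin.cast h' (Fin.castAdd l j)) := by
      ext
      simp only [Fin.succAbove, Fin.lt_def]
      simp
      split_ifs <;> rfl
    simp only [Fin.removeNth]
    rw [this, Fin.insertNth_apply_succAbove]

theorem insertNth_castAdd_natAdd {X : Type*} {k l m : ℕ} (h : k + 1 + l = m + 1) (h' : k + l = m)
    (a : Fin (k + 1)) (x : X) (u : Fin m → X) :
    (fun i => (Fin.insertNth (α := fun _ => X) (Fin.cast h (Fin.castAdd l a)) x u)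
      (Fin.cast h (Fin.natAdd (k + 1) i))) = fun i => u (Fin.cast h' (Fin.natAdd k i)) := by
  funext j
  have : Fin.cast h (Fin.natAdd (k + 1) j) =
      (Fin.cast h (Fin.castAdd l a)).succAbove (Fin.cast h' (Fin.natAdd k j)) := by
    ext
    simp only [Fin.succAbove, Fin.lt_def]
    simp
    split_ifs <;> simp <;> omega
  rw [this, Fin.insertNth_apply_succAbove]

theorem insertNth_natAdd {X : Type*} {k l m : ℕ} (h : k + (l + 1) = m + 1) (h' : k + l = m) (b : Fin (l + 1))
    (x : X) (u : Fin m → X) :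
    (fun i => (Fin.insertNth (α := fun _ => X) (Fin.cast h (Fin.natAdd k b)) x u)
      (Fin.cast h (Fin.natAdd k i))) =
      Fin.insertNth (α := fun _ => X) b x (fun i => u (Fin.cast h' (Fin.natAdd k i))) := by
  rw [Fin.eq_insertNth_iff]
  constructor
  · simp
  · funext j
    have : Fin.cast h (Fin.natAdd k (b.succAbove j)) =
        (Fin.cast h (Fin.natAdd k b)).succAbove (Fin.cast h' (Fin.natAdd k j)) := by
      ext
      simp only [Fin.succAbove, Fin.lt_def]
      simp
      split_ifs <;> simp <;> omega
    simp only [Fin.removeNth]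
    rw [this, Fin.insertNth_apply_succAbove]

theorem insertNth_natAdd_castAdd {X : Type*} {k l m : ℕ} (h : k + (l + 1) = m + 1) (h' : k + l = m)
    (b : Fin (l + 1)) (x : X) (u : Fin m → X) :
    (fun i => (Fin.insertNth (α := fun _ => X) (Fin.cast h (Fin.natAdd k b)) x u)
      (Fin.cast h (Fin.castAdd (l + 1) i))) = fun i => u (Fin.cast h' (Fin.castAdd l i)) := by
  funext j
  have : Fin.cast h (Fin.castAdd (l + 1) j) =
      (Fin.cast h (Fin.natAdd k b)).succAbove (Fin.cast h' (Fin.castAdd l j)) := by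
    ext
    simp only [Fin.succAbove, Fin.lt_def]
    simp
    split_ifs <;> simp <;> omega
  rw [this, Fin.insertNth_apply_succAbove]

theorem map_insertNth_real {k : ℕ} (η : V [⋀^Fin (k + 1)]→ₗ[ℝ] ℝ) (a : Fin (k + 1)) (x : V)
    (v : Fin k → V) : η (a.insertNth x v) = (-1 : ℝ) ^ (a : ℕ) * η.curryLeft x v := by
  rw [AlternatingMap.map_insertNth]
  simp

theorem neg_one_pow_mul_self (a : ℕ) : (-1 : ℝ) ^ a * (-1 : ℝ) ^ a = 1 := by
  rw [← mul_pow]; simp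

/-- The interior product is an antiderivation. -/
theorem interiorProd_wedgeTo {k l m : ℕ} (x : V) (α : V [⋀^Fin k]→ₗ[ℝ] ℝ)
    (β : V [⋀^Fin l]→ₗ[ℝ] ℝ) :
    interiorProd x (wedgeTo (m + 1) α β) =
      wedgeTo m (interiorProd x α) β + (-1 : ℝ) ^ k • wedgeTo m α (interiorProd x β) := by
  by_cases h : k + l = m + 1
  · refine AlternatingMap.ext fun (w : Fin m → V) => ?_
    have hne : ((k.factorial : ℝ) * (l.factorial : ℝ)) ≠ 0 := by positivity
    refine mul_left_cancel₀ hne ?_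
    rw [interiorProd_apply, factorial_mul_wedgeTo h]
    refine (sum_perm_succ x w (fun u => α (fun i => u (Fin.cast h (Fin.castAdd l i))) *
      β (fun j => u (Fin.cast h (Fin.natAdd k j))))).trans ?_
    -- The k + l positions for x split into those in the block of α and those in the block of β. By
    -- `key` all positions in one block contribute equally, and their number turns k! l! on the
    -- smaller product into the factor of the larger one.
    refine (Equiv.sum_comp (finSumFinEquiv.trans (finCongr h)) _).symm.trans ?_
    rw [Fintype.sum_sum_type, AlternatingMap.add_apply, AlternatingMap.smul_apply, mul_add]
    congr 1
    · rcases k with _ | k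
      · simp [interiorProd_zero_degree, wedgeTo_zero_left]
      · have h' : k + l = m := by omega
        change _ = _ * wedgeTo m (α.curryLeft x) β w
        have key : ∀ a : Fin (k + 1), (-1 : ℝ) ^ (((finSumFinEquiv.trans (finCongr h)) (Sum.inl a) : Fin (m + 1)) : ℕ) *
            ∑ τ : Equiv.Perm (Fin m), ((Equiv.Perm.sign τ : ℤ) : ℝ) *
            (α (fun i => Fin.insertNth (α := fun _ => V) ((finSumFinEquiv.trans (finCongr h)) (Sum.inl a)) x
              (fun j => w (τ j)) (Fin.cast h (Fin.castAdd l i))) *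
            β (fun j => Fin.insertNth (α := fun _ => V) ((finSumFinEquiv.trans (finCongr h)) (Sum.inl a)) x
              (fun j => w (τ j)) (Fin.cast h (Fin.natAdd (k + 1) j)))) =
            ((k.factorial : ℝ) * (l.factorial : ℝ)) * wedgeTo m (α.curryLeft x) β w := by
          intro a
          rw [factorial_mul_wedgeTo (k := k) h', Finset.mul_sum]
          refine Finset.sum_congr rfl fun τ _ => ?_
          have e : (finSumFinEquiv.trans (finCongr h)) (Sum.inl a) = Fin.cast h (Fin.castAdd l a) := rfl
          rw [e, insertNth_castAdd h h', insertNth_castAdd_natAdd h h', map_insertNth_real]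
          have := neg_one_pow_mul_self a
          simp only [Fin.val_cast, Fin.val_castAdd]
          linear_combination (((Equiv.Perm.sign τ : ℤ) : ℝ) * (α.curryLeft x fun i => w (τ (Fin.cast h' (Fin.castAdd l i)))) *
            (β fun i => w (τ (Fin.cast h' (Fin.natAdd k i))))) * this
        refine (Finset.sum_congr rfl fun a _ => key a).trans ?_
        simp [Nat.factorial_succ]
        ring
    · rcases l with _ | l
      · simp [interiorProd_zero_degree, wedgeTo_zero_right]
      · have h' : k + l = m := by omega
        change _ = _ * ((-1 : ℝ) ^ k • wedgeTo m α (β.curryLeft x) w)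
        have key : ∀ a : Fin (l + 1), (-1 : ℝ) ^ (((finSumFinEquiv.trans (finCongr h)) (Sum.inr a) : Fin (m + 1)) : ℕ) *
            ∑ τ : Equiv.Perm (Fin m), ((Equiv.Perm.sign τ : ℤ) : ℝ) *
            (α (fun i => Fin.insertNth (α := fun _ => V) ((finSumFinEquiv.trans (finCongr h)) (Sum.inr a)) x
              (fun j => w (τ j)) (Fin.cast h (Fin.castAdd (l + 1) i))) *
            β (fun j => Fin.insertNth (α := fun _ => V) ((finSumFinEquiv.trans (finCongr h)) (Sum.inr a)) x
              (fun j => w (τ j)) (Fin.cast h (Fin.natAdd k j)))) =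
            (-1) ^ k * (((k.factorial : ℝ) * (l.factorial : ℝ)) * wedgeTo m α (β.curryLeft x) w) := by
          intro a
          rw [factorial_mul_wedgeTo (l := l) h', Finset.mul_sum, Finset.mul_sum]
          refine Finset.sum_congr rfl fun τ _ => ?_
          have e : (finSumFinEquiv.trans (finCongr h)) (Sum.inr a) = Fin.cast h (Fin.natAdd k a) := rfl
          rw [e, insertNth_natAdd h h', insertNth_natAdd_castAdd h h', map_insertNth_real]
          have := neg_one_pow_mul_self a
          simp only [Fin.val_cast, Fin.val_natAdd, pow_add]
          linear_combination ((-1) ^ k * ((Equiv.Perm.sign τ : ℤ) : ℝ) * (α fun i => w (τ (Fin.cast h' (Fin.castAdd l i)))) *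
            (β.curryLeft x fun i => w (τ (Fin.cast h' (Fin.natAdd k i))))) * this
        refine (Finset.sum_congr rfl fun a _ => key a).trans ?_
        simp [Nat.factorial_succ]
        ring
  -- If the degrees do not add up, every term is zero: either by the default value of `toDegree`, or
  -- because the interior product of a 0-form is 0.
  · have h0 : wedgeTo (m + 1) α β = 0 := toDegree_of_ne h _
    have h1 : wedgeTo m (interiorProd x α) β = 0 := by
      rcases k with _ | k
      · rw [interiorProd_zero_degree, wedgeTo_zero_left]
      · exact toDegree_of_ne (by omega) _
    have h2 : wedgeTo m α (interiorProd x β) = 0 := by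
      rcases l with _ | l
      · rw [interiorProd_zero_degree, wedgeTo_zero_right]
      · exact toDegree_of_ne (by omega) _
    rw [h0, h1, h2, smul_zero, add_zero]
    rfl

/-- With the antiderivation rule this allows induction on the total degree, so that algebraic laws
of the product need no further permutations. -/
theorem ext_interiorProd {m : ℕ} {η θ : V [⋀^Fin (m + 1)]→ₗ[ℝ] ℝ}
    (h : ∀ x, interiorProd x η = interiorProd x θ) : η = θ := by
  ext v
  have := congrArg (fun f => f (Fin.tail v)) (h (v 0))
  simpa only [interiorProd_apply, Fin.cons_self_tail] using this

theorem wedgeTo_zero_degree (α β : V [⋀^Fin 0]→ₗ[ℝ] ℝ) (v w : Fin 0 → V) :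
    wedgeTo 0 α β v = α w * β w := by
  have h := factorial_mul_wedgeTo (m := 0) rfl α β v
  have h1 : ∀ u : Fin 0 → V, u = w := fun u => Subsingleton.elim _ _
  simp only [h1 (fun _ => v _), Nat.factorial] at h
  simpa using h

/-- The exterior product is associative. -/
theorem wedgeTo_assoc {m k l r p q : ℕ} (hp : p = k + l) (hq : q = l + r) (hm : k + l + r = m)
    (α : V [⋀^Fin k]→ₗ[ℝ] ℝ) (β : V [⋀^Fin l]→ₗ[ℝ] ℝ) (γ : V [⋀^Fin r]→ₗ[ℝ] ℝ) :
    wedgeTo m (wedgeTo p α β) γ = wedgeTo m α (wedgeTo q β γ) := by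
  induction m generalizing k l r p q with
  | zero =>
    obtain ⟨⟨rfl, rfl⟩, rfl⟩ : (k = 0 ∧ l = 0) ∧ r = 0 := by omega
    subst hp hq
    ext v
    simp only [Nat.add_zero, wedgeTo_zero_degree _ _ _ v, mul_assoc]
  | succ m ih =>
    refine ext_interiorProd fun x => ?_
    -- By the antiderivation rule both bracketings contract to three terms, with x in α, β or γ, and
    -- these match by induction. A factor of degree 0 has no such term, so truncated degrees do no
    -- harm.
    have h1 : wedgeTo m (interiorProd x (wedgeTo p α β)) γ =
        wedgeTo m (interiorProd x α) (wedgeTo q β γ) +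
          (-1 : ℝ) ^ k • wedgeTo m α (wedgeTo (q - 1) (interiorProd x β) γ) := by
      rcases p with _ | p
      · obtain ⟨rfl, rfl⟩ : k = 0 ∧ l = 0 := by omega
        simp [interiorProd_zero_degree, wedgeTo_zero_left, wedgeTo_zero_right]
      · rw [interiorProd_wedgeTo]
        change wedgeTo m (wedgeTo p _ _ + _ • wedgeTo p _ _) γ = _
        rw [wedgeTo_add_left, wedgeTo_smul_left]
        congr 1
        · rcases k with _ | k
          · simp only [interiorProd_zero_degree, wedgeTo_zero_left]
          · exact ih (by omega) hq (by omega) _ _ _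
        · congr 1
          rcases l with _ | l
          · simp only [interiorProd_zero_degree, wedgeTo_zero_left, wedgeTo_zero_right]
          · exact ih (by omega) (by omega) (by omega) _ _ _
    have h2 : wedgeTo m α (interiorProd x (wedgeTo q β γ)) =
        wedgeTo m α (wedgeTo (q - 1) (interiorProd x β) γ) +
          (-1 : ℝ) ^ l • wedgeTo m (wedgeTo p α β) (interiorProd x γ) := by
      rcases q with _ | q
      · obtain ⟨rfl, rfl⟩ : l = 0 ∧ r = 0 := by omega
        simp [interiorProd_zero_degree, wedgeTo_zero_left, wedgeTo_zero_right]
      · rw [interiorProd_wedgeTo]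
        change wedgeTo m α (wedgeTo q _ _ + _ • wedgeTo q _ _) = _
        rw [wedgeTo_add_right, wedgeTo_smul_right]
        congr 2
        rcases r with _ | r
        · simp only [interiorProd_zero_degree, wedgeTo_zero_right]
        · exact (ih hp (by omega) (by omega) _ _ _).symm
    rw [interiorProd_wedgeTo, interiorProd_wedgeTo, h1, h2, hp, smul_add, smul_smul, ← pow_add,
      add_assoc]

/-- The exterior product is graded commutative. -/
theorem wedgeTo_comm {m k l : ℕ} (hm : k + l = m) (α : V [⋀^Fin k]→ₗ[ℝ] ℝ)
    (β : V [⋀^Fin l]→ₗ[ℝ] ℝ) : wedgeTo m α β = (-1 : ℝ) ^ (k * l) • wedgeTo m β α := by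
  induction m generalizing k l with
  | zero =>
    obtain ⟨rfl, rfl⟩ : k = 0 ∧ l = 0 := by omega
    ext v
    simp [wedgeTo_zero_degree _ _ _ v, mul_comm]
  | succ m ih =>
    refine ext_interiorProd fun x => ?_
    have h0 : interiorProd x ((-1 : ℝ) ^ (k * l) • wedgeTo (m + 1) β α) =
        (-1 : ℝ) ^ (k * l) • interiorProd x (wedgeTo (m + 1) β α) := rfl
    rw [h0, interiorProd_wedgeTo, interiorProd_wedgeTo, smul_add, smul_smul]
    -- The contraction into α is the first term on the left and the second on the right, so the
    -- summands are matched crosswise.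
    refine (add_comm _ _).trans ?_
    congr 1
    · rcases l with _ | l
      · simp only [interiorProd_zero_degree, wedgeTo_zero_left, wedgeTo_zero_right, smul_zero]
      · rw [ih (by omega) α, smul_smul, ← pow_add]
        congr 2
        simp; ring
    · rcases k with _ | k
      · simp only [interiorProd_zero_degree, wedgeTo_zero_left, wedgeTo_zero_right, smul_zero]
      · rw [ih (by omega) (interiorProd x α)]
        congr 1
        rw [← pow_add, Nat.add_mul, add_assoc, pow_add, one_mul, pow_add _ l, neg_one_pow_mul_self]
        simp

end Shuffle

/-! ### The graded algebra of forms, contractions and alternatization -/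

section ExteriorRing

open DirectSum

variable (V : Type*) [AddCommGroup V] [Module ℝ V]

/-- The `k`-forms on `V`. -/
abbrev Alt (k : ℕ) : Type _ := V [⋀^Fin k]→ₗ[ℝ] ℝ

/-- The graded algebra of forms on `V`. -/
abbrev Ext : Type _ := ⨁ k, Alt V k

variable {V}

theorem gradedMonoid_mk_eq {k m : ℕ} (h : k = m) {η : Alt V k} {θ : Alt V m}
    (hη : toDegree m η = θ) : (GradedMonoid.mk k η : GradedMonoid (Alt V)) = GradedMonoid.mk m θ := by
  subst h
  rw [← hη, toDegree_self]

noncomputable instance : GradedMonoid.GMul (Alt V) where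
  mul α β := wedge α β

instance : GradedMonoid.GOne (Alt V) where
  one := AlternatingMap.constOfIsEmpty ℝ V (Fin 0) 1

theorem gOne_apply (v : Fin 0 → V) : (GradedMonoid.GOne.one : Alt V 0) v = 1 := rfl

theorem wedgeTo_one_left {k : ℕ} (α : Alt V k) :
    wedgeTo k (GradedMonoid.GOne.one : Alt V 0) α = α := by
  induction k with
  | zero => ext v; rw [wedgeTo_zero_degree _ _ v v, gOne_apply, one_mul]
  | succ k ih =>
    refine ext_interiorProd fun x => ?_
    rw [interiorProd_wedgeTo, interiorProd_zero_degree, wedgeTo_zero_left, zero_add, pow_zero,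
      one_smul]
    exact ih _

theorem wedgeTo_one_right {k : ℕ} (α : Alt V k) :
    wedgeTo k α (GradedMonoid.GOne.one : Alt V 0) = α := by
  rw [wedgeTo_comm (by omega), wedgeTo_one_left]
  simp

noncomputable instance : DirectSum.GRing (Alt V) where
  one_mul := by
    rintro ⟨k, α⟩
    exact gradedMonoid_mk_eq (by simp) (wedgeTo_one_left α)
  mul_one := by
    rintro ⟨k, α⟩
    exact gradedMonoid_mk_eq (by simp) (wedgeTo_one_right α)
  mul_assoc := by
    rintro ⟨k, α⟩ ⟨l, β⟩ ⟨r, γ⟩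
    refine gradedMonoid_mk_eq (add_assoc k l r) ?_
    have h := wedgeTo_assoc (p := k + l) (q := l + r) (m := k + (l + r)) rfl rfl
      (by omega) α β γ
    simp only [wedgeTo_self] at h
    exact h
  mul_zero α := by
    exact (wedgeTo_self _ _).symm.trans (wedgeTo_zero_right α)
  zero_mul β := by
    exact (wedgeTo_self _ _).symm.trans (wedgeTo_zero_left β)
  mul_add α β β' := wedgeWith_add_right _ α β β'
  add_mul α α' β := wedgeWith_add_left _ α α' β
  natCast n := n • GradedMonoid.GOne.one
  natCast_zero := zero_smul _ _
  natCast_succ n := succ_nsmul _ _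
  intCast n := n • GradedMonoid.GOne.one
  intCast_ofNat n := natCast_zsmul _ _
  intCast_negSucc_ofNat n := negSucc_zsmul _ _

noncomputable instance : Ring (Ext V) := DirectSum.ring (Alt V)

/-- A `k`-form as an element of the graded algebra. -/
noncomputable def emb {k : ℕ} : Alt V k →ₗ[ℝ] Ext V := DirectSum.lof ℝ ℕ (Alt V) k

theorem emb_injective {k : ℕ} : Function.Injective (emb : Alt V k → Ext V) :=
  DirectSum.of_injective (β := Alt V) k

theorem emb_mul {k l : ℕ} (α : Alt V k) (β : Alt V l) : emb α * emb β = emb (wedge α β) :=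
  DirectSum.of_mul_of α β

theorem emb_toDegree {k m : ℕ} (h : k = m) (η : Alt V k) : emb (toDegree m η) = emb η := by
  subst h
  rw [toDegree_self]

theorem emb_wedgeTo {k l m : ℕ} (h : k + l = m) (α : Alt V k) (β : Alt V l) :
    emb (wedgeTo m α β) = emb α * emb β := by
  rw [emb_mul, wedgeTo, emb_toDegree h]

theorem emb_comm {k l : ℕ} (α : Alt V k) (β : Alt V l) :
    emb α * emb β = (-1 : ℝ) ^ (k * l) • (emb β * emb α) := by
  rw [← emb_wedgeTo rfl, ← emb_wedgeTo (Nat.add_comm l k), ← map_smul, ← wedgeTo_comm rfl]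

theorem emb_smul_mul {k l : ℕ} (c : ℝ) (α : Alt V k) (β : Alt V l) :
    (c • emb α) * emb β = c • (emb α * emb β) := by
  rw [← map_smul, ← emb_wedgeTo rfl, ← emb_wedgeTo rfl, wedgeTo_smul_left, map_smul]

/-- The ring structure comes from `DirectSum.GRing`, which carries no scalars. Compatibility with
real scalars is checked on homogeneous elements, here and in the next instance. -/
instance : IsScalarTower ℝ (Ext V) (Ext V) := by
  refine ⟨fun c x y => ?_⟩
  simp only [smul_eq_mul]
  induction x using DirectSum.induction_on with
  | zero => simp
  | add x x' hx hx' => rw [smul_add, add_mul, hx, hx', add_mul, smul_add]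
  | of k α =>
    induction y using DirectSum.induction_on with
    | zero => simp
    | add y y' hy hy' => rw [mul_add, hy, hy', mul_add, smul_add]
    | of l β => exact emb_smul_mul c α β

instance : SMulCommClass ℝ (Ext V) (Ext V) := by
  refine ⟨fun c x y => ?_⟩
  simp only [smul_eq_mul]
  induction x using DirectSum.induction_on with
  | zero => simp
  | add x x' hx hx' => rw [add_mul, smul_add, hx, hx', add_mul]
  | of k α =>
    induction y using DirectSum.induction_on with
    | zero => simp
    | add y y' hy hy' => rw [mul_add, smul_add, smul_add, hy, hy', mul_add]
    | of l β =>
      change c • (emb α * emb β) = emb α * (c • emb β)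
      rw [← map_smul, ← emb_wedgeTo rfl, ← emb_wedgeTo rfl, wedgeTo_smul_right, map_smul]

/-- The interior product with `x`, as a linear map. -/
noncomputable def interiorProdₗ (x : V) : (k : ℕ) → Alt V k →ₗ[ℝ] Alt V (k - 1)
  | 0 => 0
  | _ + 1 => AlternatingMap.curryLeftLinearMap.flip x

theorem interiorProdₗ_apply (x : V) {k : ℕ} (α : Alt V k) :
    interiorProdₗ x k α = interiorProd x α := by
  cases k <;> rfl

/-- The interior product on the graded algebra. -/
noncomputable def contractExt (x : V) : Ext V →ₗ[ℝ] Ext V :=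
  DirectSum.toModule ℝ ℕ _ fun k => emb ∘ₗ interiorProdₗ x k

theorem contractExt_emb (x : V) {k : ℕ} (α : Alt V k) :
    contractExt x (emb α) = emb (interiorProd x α) := by
  rw [contractExt, emb, DirectSum.toModule_lof, LinearMap.comp_apply, interiorProdₗ_apply]

@[elab_as_elim]
theorem ext_induction {P : Ext V → Prop} (z : Ext V) (h0 : P 0)
    (he : ∀ k (α : Alt V k), P (emb α)) (ha : ∀ y z, P y → P z → P (y + z)) : P z :=
  DirectSum.induction_on z h0 (fun k α => he k α) ha

/-- Only the left factor must be homogeneous, since the sign depends on its degree alone. -/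
theorem contractExt_emb_mul (x : V) {k : ℕ} (α : Alt V k) (y : Ext V) :
    contractExt x (emb α * y) =
      contractExt x (emb α) * y + (-1 : ℝ) ^ k • (emb α * contractExt x y) := by
  induction y using ext_induction with
  | h0 => simp
  | ha y z hy hz => rw [mul_add, map_add, hy, hz, mul_add, map_add, mul_add, smul_add]; abel
  | he l β =>
    rw [contractExt_emb, contractExt_emb, emb_mul, contractExt_emb]
    obtain ⟨m, hm⟩ : ∃ m, k + l = m := ⟨_, rfl⟩
    have hw : emb (interiorProd x (wedge α β)) = emb (interiorProd x (wedgeTo m α β)) := by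
      subst hm; rw [wedgeTo_self]
    rcases m with _ | m
    · obtain ⟨rfl, rfl⟩ : k = 0 ∧ l = 0 := by omega
      simp only [interiorProd_zero_degree, map_zero, zero_mul, mul_zero, smul_zero, add_zero]
    · rw [hw, interiorProd_wedgeTo, map_add, map_smul]
      congr 1
      · rcases k with _ | k
        · simp only [interiorProd_zero_degree, wedgeTo_zero_left, map_zero, zero_mul]
        · exact emb_wedgeTo (by simp; omega) _ _
      · congr 1
        rcases l with _ | l
        · simp only [interiorProd_zero_degree, wedgeTo_zero_right, map_zero, mul_zero]
        · exact emb_wedgeTo (by simp; omega) _ _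

theorem interiorProd_add_vec (x y : V) {k : ℕ} (α : Alt V k) :
    interiorProd (x + y) α = interiorProd x α + interiorProd y α := by
  rcases k with _ | k
  · simp [interiorProd_zero_degree]
  · exact map_add α.curryLeft x y

theorem interiorProd_smul_vec (c : ℝ) (x : V) {k : ℕ} (α : Alt V k) :
    interiorProd (c • x) α = c • interiorProd x α := by
  rcases k with _ | k
  · simp [interiorProd_zero_degree]
  · exact map_smul α.curryLeft c x

theorem contractExt_add_vec (x y : V) (z : Ext V) :
    contractExt (x + y) z = contractExt x z + contractExt y z := by
  induction z using ext_induction with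
  | h0 => simp
  | ha z z' h h' => rw [map_add, h, h', map_add, map_add]; abel
  | he k α => rw [contractExt_emb, contractExt_emb, contractExt_emb, interiorProd_add_vec, map_add]

theorem contractExt_smul_vec (c : ℝ) (x : V) (z : Ext V) :
    contractExt (c • x) z = c • contractExt x z := by
  induction z using ext_induction with
  | h0 => simp
  | ha z z' h h' => rw [map_add, h, h', map_add, smul_add]
  | he k α => rw [contractExt_emb, contractExt_emb, interiorProd_smul_vec, map_smul]

theorem interiorProd_interiorProd_self (x : V) {k : ℕ} (α : Alt V k) :
    interiorProd x (interiorProd x α) = 0 := by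
  rcases k with _ | _ | k
  · rfl
  · rfl
  · ext v
    exact α.map_eq_zero_of_eq _ (i := 0) (j := 1) rfl (by simp)

theorem contractExt_contractExt_self (x : V) (z : Ext V) : contractExt x (contractExt x z) = 0 := by
  induction z using ext_induction with
  | h0 => simp
  | ha z z' h h' => rw [map_add, map_add, h, h', add_zero]
  | he k α => rw [contractExt_emb, contractExt_emb, interiorProd_interiorProd_self, map_zero]

/-- Polarization of ι_x ι_x = 0. -/
theorem contractExt_contractExt (x y : V) (z : Ext V) :
    contractExt x (contractExt y z) = -contractExt y (contractExt x z) := by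
  have h := contractExt_contractExt_self (x + y) z
  rw [contractExt_add_vec, contractExt_add_vec x y z, map_add, map_add,
    contractExt_contractExt_self, contractExt_contractExt_self, zero_add, add_zero] at h
  exact eq_neg_of_add_eq_zero_left h

theorem ext_of_contractExt {k : ℕ} {α β : Alt V (k + 1)}
    (h : ∀ x, contractExt x (emb α) = contractExt x (emb β)) : α = β :=
  ext_interiorProd fun x => emb_injective (by rw [← contractExt_emb, h, contractExt_emb])

theorem contractExt_oneForm_mul (x : V) (φ : V →ₗ[ℝ] ℝ) (y : Ext V) :
    contractExt x (emb (oneForm φ) * y) = φ x • y - emb (oneForm φ) * contractExt x y := by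
  have h1 : (interiorProd x (oneForm φ) : Alt V 0) = φ x • (GradedMonoid.GOne.one : Alt V 0) := by
    ext v
    simp only [interiorProd, AlternatingMap.smul_apply, gOne_apply]
    simp [oneForm]
  rw [contractExt_emb_mul, contractExt_emb, h1, map_smul]
  have h2 : emb (GradedMonoid.GOne.one : Alt V 0) = 1 := rfl
  rw [h2, smul_mul_assoc, one_mul, pow_one, neg_one_smul, sub_eq_add_neg]

/-- In Σ (-1)^i A(v_i)(…), with x put in front, the term i = 0 is A(x). In the others x stays the
first argument of A(v_i) and the index is shifted by one, which gives the minus sign. -/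
theorem interiorProd_alternatizeUncurryFin (x : V) {k : ℕ} (A : V →ₗ[ℝ] Alt V (k + 1))
    (B : V →ₗ[ℝ] Alt V k) (hB : ∀ y, B y = interiorProd x (A y)) :
    (interiorProd x (AlternatingMap.alternatizeUncurryFin A) : Alt V (k + 1)) =
      A x - AlternatingMap.alternatizeUncurryFin B := by
  refine AlternatingMap.ext fun (v : Fin (k + 1) → V) => ?_
  rw [AlternatingMap.sub_apply, AlternatingMap.alternatizeUncurryFin_apply]
  have h := AlternatingMap.alternatizeUncurryFin_apply A (Fin.cons x v)
  rw [Fin.sum_univ_succ] at h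
  refine h.trans ?_
  rw [sub_eq_add_neg, ← Finset.sum_neg_distrib]
  refine congrArg₂ _ (by simp) (Finset.sum_congr rfl fun i _ => ?_)
  rw [hB]
  simp only [Fin.cons_succ, Fin.val_succ, pow_succ, mul_neg, mul_one, neg_smul, neg_inj]
  congr 1
  refine congrArg (A (v i)) ?_
  funext j
  refine Fin.cases ?_ (fun j => ?_) j
  · simp [Fin.removeNth]
  · simp [Fin.removeNth]

theorem emb_apply_eq_sum {ι : Type*} [Fintype ι] (b : Module.Basis ι ℝ V) {k : ℕ}
    (A : V →ₗ[ℝ] Alt V k) (x : V) : ∑ i, b.coord i x • emb (A (b i)) = emb (A x) := by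
  conv_rhs => rw [← b.sum_repr x]
  simp only [map_sum, map_smul, Module.Basis.coord_apply]

/-- Alternatization as a sum of exterior products with the dual basis. -/
theorem emb_alternatizeUncurryFin {ι : Type*} [Fintype ι] (b : Module.Basis ι ℝ V) {k : ℕ}
    (A : V →ₗ[ℝ] Alt V k) :
    emb (AlternatingMap.alternatizeUncurryFin A) =
      ∑ i, emb (oneForm (b.coord i)) * emb (A (b i)) := by
  have hdeg : ∀ i, emb (oneForm (b.coord i)) * emb (A (b i)) =
      emb (wedgeTo (k + 1) (oneForm (b.coord i)) (A (b i))) := fun i =>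
    (emb_wedgeTo (by omega) _ _).symm
  induction k with
  | zero =>
    simp only [hdeg, ← map_sum]
    congr 1
    refine ext_of_contractExt fun x => ?_
    rw [map_sum, map_sum]
    simp only [← hdeg, contractExt_oneForm_mul, Finset.sum_sub_distrib, emb_apply_eq_sum]
    rw [contractExt_emb]
    simp only [contractExt_emb, interiorProd_zero_degree, map_zero, mul_zero,
      Finset.sum_const_zero, sub_zero]
    congr 1
    refine AlternatingMap.ext fun (v : Fin 0 → V) => ?_
    refine (AlternatingMap.alternatizeUncurryFin_apply A (Fin.cons x v)).trans ?_
    simp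
  | succ k ih =>
    simp only [hdeg, ← map_sum]
    congr 1
    refine ext_of_contractExt fun x => ?_
    rw [map_sum, map_sum]
    simp only [← hdeg, contractExt_oneForm_mul, Finset.sum_sub_distrib, emb_apply_eq_sum]
    -- Contraction with x turns both sides into A(x) minus the same expression for ι_x ∘ A, which
    -- has lower degree; the induction hypothesis applies.
    have h := interiorProd_alternatizeUncurryFin x A (interiorProdₗ x (k + 1) ∘ₗ A)
      fun y => interiorProdₗ_apply x (A y)
    rw [contractExt_emb]
    refine (congrArg emb h).trans ?_
    rw [map_sub]
    congr 1
    refine (ih (interiorProdₗ x (k + 1) ∘ₗ A) fun i => (emb_wedgeTo (by omega) _ _).symm).trans ?_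
    refine Finset.sum_congr rfl fun i _ => ?_
    rw [contractExt_emb, LinearMap.comp_apply, interiorProdₗ_apply]

theorem curryFirst_add {k : ℕ} (α β : Alt V (k + 1)) :
    curryFirst (α + β) = curryFirst α + curryFirst β := rfl

theorem curryFirst_smul {k : ℕ} (c : ℝ) (α : Alt V (k + 1)) :
    curryFirst (c • α) = c • curryFirst α := rfl

theorem contract_add_left {k l : ℕ} (K K' : V [⋀^Fin k]→ₗ[ℝ] V) (α : Alt V l) :
    contract (K + K') α = contract K α + contract K' α := by
  cases l
  · exact (add_zero _).symm
  · exact wedgeWith_add_left _ _ _ _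

theorem contract_smul_left {k l : ℕ} (c : ℝ) (K : V [⋀^Fin k]→ₗ[ℝ] V) (α : Alt V l) :
    contract (c • K) α = c • contract K α := by
  cases l
  · exact (smul_zero _).symm
  · exact wedgeWith_smul_left _ _ _ _

theorem contract_add_right {k l : ℕ} (K : V [⋀^Fin k]→ₗ[ℝ] V) (α β : Alt V l) :
    contract K (α + β) = contract K α + contract K β := by
  cases l
  · exact (add_zero _).symm
  · exact (congrArg _ (curryFirst_add α β)).trans (wedgeWith_add_right _ _ _ _)

theorem contract_smul_right {k l : ℕ} (c : ℝ) (K : V [⋀^Fin k]→ₗ[ℝ] V) (α : Alt V l) :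
    contract K (c • α) = c • contract K α := by
  cases l
  · exact (smul_zero _).symm
  · exact (congrArg _ (curryFirst_smul c α)).trans (wedgeWith_smul_right _ _ _ _)

/-- The contraction as a bilinear map. -/
noncomputable def contractₗ (k l : ℕ) :
    (V [⋀^Fin k]→ₗ[ℝ] V) →ₗ[ℝ] Alt V l →ₗ[ℝ] Alt V (k + (l - 1)) :=
  LinearMap.mk₂ ℝ (fun K α => contract K α) (fun K K' α => contract_add_left K K' α)
    (fun c K α => contract_smul_left c K α) (fun K α β => contract_add_right K α β)
    (fun c K α => contract_smul_right c K α)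

/-- The exterior product in degree `m` as a bilinear map. -/
noncomputable def wedgeToₗ (m k l : ℕ) : Alt V k →ₗ[ℝ] Alt V l →ₗ[ℝ] Alt V m :=
  LinearMap.mk₂ ℝ (wedgeTo m) wedgeTo_add_left wedgeTo_smul_left wedgeTo_add_right
    wedgeTo_smul_right

/-- The component of a vector-valued form along a covector. -/
abbrev comp (φ : V →ₗ[ℝ] ℝ) {k : ℕ} (K : V [⋀^Fin k]→ₗ[ℝ] V) : Alt V k :=
  φ.compAlternatingMap K

theorem alternatingMap_sum_apply {ι N : Type*} [AddCommGroup N] [Module ℝ N] {k : ℕ}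
    (s : Finset ι) (f : ι → V [⋀^Fin k]→ₗ[ℝ] N) (v : Fin k → V) :
    (∑ i ∈ s, f i) v = ∑ i ∈ s, f i v := by
  classical
  induction s using Finset.induction_on with
  | empty => simp
  | insert a s ha ih => simp [Finset.sum_insert ha, ih]

theorem sum_tensorVec_comp {ι : Type*} [Fintype ι] (b : Module.Basis ι ℝ V) {k : ℕ}
    (K : V [⋀^Fin k]→ₗ[ℝ] V) : ∑ i, tensorVec (comp (b.coord i) K) (b i) = K := by
  ext v
  simp [tensorVec, alternatingMap_sum_apply, b.sum_repr (K v)]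

theorem comp_sum_tensorVec {ι : Type*} [Fintype ι] [DecidableEq ι] (b : Module.Basis ι ℝ V) {k : ℕ}
    (κ : ι → Alt V k) (i : ι) : comp (b.coord i) (∑ j, tensorVec (κ j) (b j)) = κ i := by
  ext v
  simp [tensorVec, alternatingMap_sum_apply, Finsupp.single_apply]

/-- By bilinearity it suffices to treat κ ⊗ x, where the shuffle sum is κ ∧ ι_x α. This is the form
in which contractions are used from here on. -/
theorem emb_contract {ι : Type*} [Fintype ι] (b : Module.Basis ι ℝ V) {k l : ℕ}
    (K : V [⋀^Fin k]→ₗ[ℝ] V) (α : Alt V l) :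
    emb (contract K α) = ∑ i, emb (comp (b.coord i) K) * contractExt (b i) (emb α) := by
  rcases l with _ | l
  · simp only [contractExt_emb, interiorProd_zero_degree, map_zero, mul_zero,
      Finset.sum_const_zero]
    exact map_zero emb
  · conv_lhs => rw [← sum_tensorVec_comp b K]
    change emb (contractₗ k (l + 1) _ α) = _
    rw [map_sum, LinearMap.sum_apply, map_sum]
    refine Finset.sum_congr rfl fun i _ => ?_
    change emb (contract _ _) = _
    rw [contract_tensorVec, ← emb_mul, contractExt_emb]

end ExteriorRing

/-! ### The algebra of the graded commutator -/

section CommutatorAlgebra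

variable {V : Type*} [AddCommGroup V] [Module ℝ V] {ι : Type*}

/-- The Nijenhuis-Lie derivative in a basis: `∑ κ^a ∧ ∂_a α + (-1)^k ∑ dκ^a ∧ ι_a α`. -/
noncomputable def lieExpr [Fintype ι] (b : ι → V) (k : ℕ) (κ dκ : ι → Ext V) (a : Ext V) (da : ι → Ext V) :
    Ext V :=
  ∑ i, κ i * da i + (-1 : ℝ) ^ k • ∑ i, dκ i * contractExt (b i) a

/-- The part of the composition of two Nijenhuis-Lie derivatives that cancels in the graded
commutator. -/
noncomputable def crossTerm (b : ι → V) (k l : ℕ) (κ dκ μ dμ : ι → Ext V) (a : Ext V)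
    (da : ι → Ext V) (dda : ι → ι → Ext V) (i j : ι) : Ext V :=
  κ i * μ j * dda i j + (-1 : ℝ) ^ l • (κ i * dμ j * contractExt (b j) (da i))
    + ((-1 : ℝ) ^ k * (-1 : ℝ) ^ l) • (dκ i * μ j * contractExt (b i) (da j))
    - (-1 : ℝ) ^ k • (dκ i * dμ j * contractExt (b i) (contractExt (b j) a))

/-- The second argument of the outer expression is the i-th partial derivative of the inner one,
with `pμ i j` for ∂_i μ_j and `pdμ i j` for ∂_i dμ_j. The Leibniz rules for ∂_i and ι_i separate
what acts on the coefficients from what acts on a; the latter is `crossTerm`. -/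
theorem lieExpr_lieExpr [Fintype ι] (b : ι → V) {k l : ℕ} (κ dκ : ι → Ext V) (μ : ι → Alt V l)
    (dμ : ι → Alt V (l + 1)) (pμ pdμ : ι → ι → Ext V) (a : Ext V)
    (da : ι → Ext V) (dda : ι → ι → Ext V) :
    lieExpr b k κ dκ (lieExpr b l (fun j => emb (μ j)) (fun j => emb (dμ j)) a da)
        (fun i => ∑ j, (pμ i j * da j + emb (μ j) * dda i j) + (-1 : ℝ) ^ l •
          ∑ j, (pdμ i j * contractExt (b j) a + emb (dμ j) * contractExt (b j) (da i))) =
      ∑ j, lieExpr b k κ dκ (emb (μ j)) (fun i => pμ i j) * da j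
        + (-1 : ℝ) ^ l •
          ∑ j, lieExpr b k κ dκ (emb (dμ j)) (fun i => pdμ i j) * contractExt (b j) a
        + ∑ i, ∑ j, crossTerm b k l κ dκ (fun j => emb (μ j)) (fun j => emb (dμ j)) a da dda i j := by
  have e1 : ∑ j, lieExpr b k κ dκ (emb (μ j)) (fun i => pμ i j) * da j =
      ∑ i, ∑ j, (κ i * pμ i j * da j +
        (-1 : ℝ) ^ k • (dκ i * contractExt (b i) (emb (μ j)) * da j)) := by
    rw [Finset.sum_comm]
    simp only [lieExpr, add_mul, smul_mul_assoc, Finset.sum_mul, Finset.smul_sum,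
      Finset.sum_add_distrib]
  have e2 : ∑ j, lieExpr b k κ dκ (emb (dμ j)) (fun i => pdμ i j) * contractExt (b j) a =
      ∑ i, ∑ j, (κ i * pdμ i j * contractExt (b j) a + (-1 : ℝ) ^ k •
        (dκ i * contractExt (b i) (emb (dμ j)) * contractExt (b j) a)) := by
    rw [Finset.sum_comm]
    simp only [lieExpr, add_mul, smul_mul_assoc, Finset.sum_mul, Finset.smul_sum,
      Finset.sum_add_distrib]
  rw [e1, e2]
  simp only [lieExpr, Finset.smul_sum, ← Finset.sum_add_distrib, map_sum, Finset.mul_sum, map_add,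
    map_smul, contractExt_emb_mul]
  refine Finset.sum_congr rfl fun i _ => ?_
  refine Finset.sum_congr rfl fun j _ => ?_
  simp only [crossTerm, mul_add, mul_smul_comm, smul_add, mul_assoc, pow_succ, neg_smul, mul_neg,
    mul_one, smul_neg, smul_smul, neg_one_pow_mul_self]
  simp only [mul_comm ((-1 : ℝ) ^ l) ((-1 : ℝ) ^ k)]
  abel


/-- Moving the factors of K₁ past those of K₂ produces the signs. The first summand matches itself
by symmetry of second derivatives, the last by ι_i ι_j = -ι_j ι_i, and the two mixed summands change
places. -/
theorem crossTerm_cancel (b : ι → V) {k l : ℕ} (κ : ι → Alt V k) (dκ : ι → Alt V (k + 1))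
    (μ : ι → Alt V l) (dμ : ι → Alt V (l + 1)) (a : Ext V) (da : ι → Ext V) (dda : ι → ι → Ext V)
    (hdda : ∀ i j, dda i j = dda j i) (i j : ι) :
    crossTerm b k l (fun i => emb (κ i)) (fun i => emb (dκ i)) (fun i => emb (μ i))
        (fun i => emb (dμ i)) a da dda i j =
      (-1 : ℝ) ^ (k * l) • crossTerm b l k (fun i => emb (μ i)) (fun i => emb (dμ i))
        (fun i => emb (κ i)) (fun i => emb (dκ i)) a da dda j i := by
  unfold crossTerm
  rw [emb_comm (κ i) (μ j), emb_comm (κ i) (dμ j), emb_comm (dκ i) (μ j), emb_comm (dκ i) (dμ j),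
    hdda j i, contractExt_contractExt (b i) (b j)]
  have h1 : (-1 : ℝ) ^ (k * (l + 1)) = (-1) ^ (k * l) * (-1) ^ k := by rw [← pow_add]; ring_nf
  have h2 : (-1 : ℝ) ^ ((k + 1) * l) = (-1) ^ (k * l) * (-1) ^ l := by rw [← pow_add]; ring_nf
  have h3 : (-1 : ℝ) ^ ((k + 1) * (l + 1)) = -((-1) ^ (k * l) * (-1) ^ k * (-1) ^ l) := by
    rw [← pow_add, ← pow_add]; ring_nf
  rw [h1, h2, h3]
  -- Only the parities of k, l and kl enter.
  rcases neg_one_pow_eq_or ℝ k with hk | hk <;> rcases neg_one_pow_eq_or ℝ l with hl | hl <;>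
    rcases neg_one_pow_eq_or ℝ (k * l) with hkl | hkl <;> rw [hk, hl, hkl] <;>
    simp only [one_smul, neg_smul, mul_one, mul_neg, neg_mul, neg_neg, sub_eq_add_neg,
      neg_add] <;> abel

end CommutatorAlgebra

/-! ### Calculus of forms on the model space -/

section Flat

variable {n : ℕ}

/-- The model space. -/
abbrev Eu (n : ℕ) : Type := EuclideanSpace ℝ (Fin n)

/-- Continuous `k`-forms on the model space. -/
abbrev CAlt (n k : ℕ) : Type := Eu n [⋀^Fin k]→L[ℝ] ℝ

/-- Continuous vector-valued `k`-forms on the model space. -/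
abbrev CVAlt (n k : ℕ) : Type := Eu n [⋀^Fin k]→L[ℝ] Eu n

variable {F : Type*} [NormedAddCommGroup F] [NormedSpace ℝ F]

/-- Alternating maps on the model space are the same as continuous ones. -/
noncomputable def toContEquiv (n : ℕ) (F : Type*) [NormedAddCommGroup F] [NormedSpace ℝ F] (k : ℕ) :
    (Eu n [⋀^Fin k]→ₗ[ℝ] F) ≃ₗ[ℝ] (Eu n [⋀^Fin k]→L[ℝ] F) where
  toFun := toCont
  invFun η := η.toAlternatingMap
  map_add' _ _ := rfl
  map_smul' _ _ := rfl
  left_inv _ := rfl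
  right_inv _ := rfl

instance {k : ℕ} {V N : Type*} [AddCommGroup V] [Module ℝ V] [AddCommGroup N] [Module ℝ N]
    [Module.Finite ℝ V] [Module.Finite ℝ N] : Module.Finite ℝ (V [⋀^Fin k]→ₗ[ℝ] N) :=
  Module.Finite.of_injective (AlternatingMap.toMultilinearMapLM (R := ℝ) (S := ℝ))
    AlternatingMap.coe_multilinearMap_injective

instance {k : ℕ} [FiniteDimensional ℝ F] : FiniteDimensional ℝ (Eu n [⋀^Fin k]→L[ℝ] F) :=
  Module.Finite.equiv (toContEquiv n F k)

/-- A bilinear map of alternating maps, as a continuous bilinear map. -/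
noncomputable def contBilin {F₁ F₂ F₃ : Type*} [NormedAddCommGroup F₁] [NormedSpace ℝ F₁]
    [NormedAddCommGroup F₂] [NormedSpace ℝ F₂] [NormedAddCommGroup F₃] [NormedSpace ℝ F₃]
    [FiniteDimensional ℝ F₁] [FiniteDimensional ℝ F₂] {k l m : ℕ}
    (f : (Eu n [⋀^Fin k]→ₗ[ℝ] F₁) →ₗ[ℝ] (Eu n [⋀^Fin l]→ₗ[ℝ] F₂) →ₗ[ℝ] (Eu n [⋀^Fin m]→ₗ[ℝ] F₃)) :
    (Eu n [⋀^Fin k]→L[ℝ] F₁) →L[ℝ] (Eu n [⋀^Fin l]→L[ℝ] F₂) →L[ℝ] (Eu n [⋀^Fin m]→L[ℝ] F₃) :=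
  LinearMap.toContinuousBilinearMap
    ((f.compl₁₂ (toContEquiv n F₁ k).symm.toLinearMap
      (toContEquiv n F₂ l).symm.toLinearMap).compr₂ (toContEquiv n F₃ m).toLinearMap)

/-- A linear map of alternating maps, as a continuous linear map. -/
noncomputable def contLin {F₁ F₂ : Type*} [NormedAddCommGroup F₁] [NormedSpace ℝ F₁]
    [NormedAddCommGroup F₂] [NormedSpace ℝ F₂] [FiniteDimensional ℝ F₁] {k m : ℕ}
    (f : (Eu n [⋀^Fin k]→ₗ[ℝ] F₁) →ₗ[ℝ] (Eu n [⋀^Fin m]→ₗ[ℝ] F₂)) :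
    (Eu n [⋀^Fin k]→L[ℝ] F₁) →L[ℝ] (Eu n [⋀^Fin m]→L[ℝ] F₂) :=
  LinearMap.toContinuousLinearMap ((toContEquiv n F₂ m).toLinearMap ∘ₗ f ∘ₗ
    (toContEquiv n F₁ k).symm.toLinearMap)

variable {G : Type*} [NormedAddCommGroup G] [NormedSpace ℝ G]

theorem fderiv_bilin {X Y Z : Type*} [NormedAddCommGroup X] [NormedSpace ℝ X]
    [NormedAddCommGroup Y] [NormedSpace ℝ Y] [NormedAddCommGroup Z] [NormedSpace ℝ Z]
    (B : X →L[ℝ] Y →L[ℝ] Z) {f : G → X} {g : G → Y} {y : G} (hf : DifferentiableAt ℝ f y)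
    (hg : DifferentiableAt ℝ g y) (v : G) :
    fderiv ℝ (fun z => B (f z) (g z)) y v = B (fderiv ℝ f y v) (g y) + B (f y) (fderiv ℝ g y v) := by
  rw [(B.hasFDerivAt_of_bilinear hf.hasFDerivAt hg.hasFDerivAt).fderiv]
  simp [add_comm]

theorem fderiv_lin {X Y : Type*} [NormedAddCommGroup X] [NormedSpace ℝ X]
    [NormedAddCommGroup Y] [NormedSpace ℝ Y] (L : X →L[ℝ] Y) {f : G → X} {y : G}
    (hf : DifferentiableAt ℝ f y) (v : G) :
    fderiv ℝ (fun z => L (f z)) y v = L (fderiv ℝ f y v) :=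
  congrArg (fun f => f v) (L.hasFDerivAt.comp y hf.hasFDerivAt).fderiv

/-- The wedge product in degree `m` as a continuous bilinear map. -/
noncomputable def wedgeC (n m k l : ℕ) : CAlt n k →L[ℝ] CAlt n l →L[ℝ] CAlt n m :=
  contBilin (wedgeToₗ m k l)

/-- The interior product as a continuous linear map. -/
noncomputable def interiorC (x : Eu n) (k : ℕ) : CAlt n k →L[ℝ] CAlt n (k - 1) :=
  contLin (interiorProdₗ x k)

/-- `toDegree` as a linear map. -/
noncomputable def toDegreeₗ {V : Type*} [AddCommGroup V] [Module ℝ V] (m k : ℕ) :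
    Alt V k →ₗ[ℝ] Alt V m where
  toFun := toDegree m
  map_add' := toDegree_add
  map_smul' := toDegree_smul

/-- `toDegree` as a continuous linear map. -/
noncomputable def toDegreeC (n m k : ℕ) : CAlt n k →L[ℝ] CAlt n m := contLin (toDegreeₗ m k)

/-- The contraction with a vector-valued form as a continuous bilinear map. -/
noncomputable def contractC (n k l : ℕ) : CVAlt n k →L[ℝ] CAlt n l →L[ℝ] CAlt n (k + (l - 1)) :=
  contBilin (contractₗ k l)

/-- The composition with a covector as a linear map. -/
noncomputable def compₗ {V : Type*} [AddCommGroup V] [Module ℝ V] (φ : V →ₗ[ℝ] ℝ) (k : ℕ) :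
    (V [⋀^Fin k]→ₗ[ℝ] V) →ₗ[ℝ] Alt V k where
  toFun := comp φ
  map_add' K K' := by ext v; simp
  map_smul' c K := by ext v; simp

/-- The composition with a covector as a continuous linear map. -/
noncomputable def compC (φ : Eu n →ₗ[ℝ] ℝ) (k : ℕ) : CVAlt n k →L[ℝ] CAlt n k :=
  contLin (compₗ φ k)

/-- A continuous form as an element of the graded algebra. -/
noncomputable def embC {k : ℕ} : CAlt n k →ₗ[ℝ] Ext (Eu n) :=
  emb ∘ₗ (toContEquiv n ℝ k).symm.toLinearMap

theorem embC_injective {k : ℕ} : Function.Injective (embC : CAlt n k → Ext (Eu n)) :=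
  emb_injective.comp (toContEquiv n ℝ k).symm.injective

theorem embC_toCont {k : ℕ} (η : Alt (Eu n) k) : embC (toCont η) = emb η := rfl

theorem embC_eq {k : ℕ} (η : CAlt n k) : embC η = emb η.toAlternatingMap := rfl

theorem embC_wedgeC {k l m : ℕ} (h : k + l = m) (α : CAlt n k) (β : CAlt n l) :
    embC (wedgeC n m k l α β) = embC α * embC β := emb_wedgeTo h _ _

theorem embC_interiorC (x : Eu n) {k : ℕ} (α : CAlt n k) :
    embC (interiorC x k α) = contractExt x (embC α) := by
  rw [embC_eq α, contractExt_emb, ← interiorProdₗ_apply]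
  rfl

theorem embC_contractC {ι : Type*} [Fintype ι] (b : Module.Basis ι ℝ (Eu n)) {k l : ℕ}
    (K : CVAlt n k) (α : CAlt n l) :
    embC (contractC n k l K α) =
      ∑ i, embC (compC (b.coord i) k K) * contractExt (b i) (embC α) :=
  emb_contract b _ _

theorem embC_toDegreeC {k m : ℕ} (h : k = m) (α : CAlt n k) :
    embC (toDegreeC n m k α) = embC α := emb_toDegree h _

theorem embC_extDeriv {ι : Type*} [Fintype ι] (b : Module.Basis ι ℝ (Eu n)) {k : ℕ}
    (α : Eu n → CAlt n k) (y : Eu n) :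
    embC (extDeriv α y) = ∑ i, emb (oneForm (b.coord i)) * embC (fderiv ℝ α y (b i)) := by
  refine Eq.trans (congrArg emb ?_) (emb_alternatizeUncurryFin b ((toContEquiv n ℝ k).symm.toLinearMap ∘ₗ (fderiv ℝ α y).toLinearMap))
  ext v
  rw [AlternatingMap.alternatizeUncurryFin_apply]
  exact ContinuousAlternatingMap.alternatizeUncurryFin_apply _ _

/-- The Nijenhuis-Lie derivative on the model space. -/
noncomputable def flatLie {k l : ℕ} (K : Eu n → CVAlt n k) (α : Eu n → CAlt n l) :
    Eu n → CAlt n (k + l) := fun y =>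
  toDegreeC n (k + l) (k + (l + 1 - 1)) (contractC n k (l + 1) (K y) (extDeriv α y)) + (-1 : ℝ) ^ k •
    toDegreeC n (k + l) (k + (l - 1) + 1) (extDeriv (fun z => contractC n k l (K z) (α z)) y)

/-- Contract dα = Σ e^i ∧ ∂_i α by the antiderivation rule. The first term is the directional
derivative; the sum is the part that cancels in the Nijenhuis-Lie derivative. -/
theorem contractExt_extDeriv {ι : Type*} [Fintype ι] (b : Module.Basis ι ℝ (Eu n)) {k : ℕ}
    (α : Eu n → CAlt n k) (y : Eu n) (x : Eu n) :
    contractExt x (embC (extDeriv α y)) = embC (fderiv ℝ α y x) -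
      ∑ i, emb (oneForm (b.coord i)) * contractExt x (embC (fderiv ℝ α y (b i))) := by
  rw [embC_extDeriv b, map_sum]
  simp only [contractExt_oneForm_mul, Finset.sum_sub_distrib]
  congr 1
  exact emb_apply_eq_sum b
    ((toContEquiv n ℝ k).symm.toLinearMap ∘ₗ (fderiv ℝ α y).toLinearMap) x

/-- For a 0-form, truncated subtraction places ι_K α in degree k and its differential in degree k +
1, not k + l. The mismatch is harmless because the form is zero. -/
theorem extDeriv_contractC_zero_degree {k : ℕ} (K : Eu n → CVAlt n k) (α : Eu n → CAlt n 0)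
    (y : Eu n) : extDeriv (fun z => contractC n k 0 (K z) (α z)) y = 0 := by
  have h : (fun z => contractC n k 0 (K z) (α z)) = fun _ => 0 := rfl
  rw [h, extDeriv, fderiv_fun_const]
  ext v
  simp [ContinuousAlternatingMap.alternatizeUncurryFin_apply]

theorem embC_flatLie_eq {k l : ℕ} (K : Eu n → CVAlt n k) (α : Eu n → CAlt n l) (y : Eu n) :
    embC (flatLie K α y) = embC (contractC n k (l + 1) (K y) (extDeriv α y)) + (-1 : ℝ) ^ k •
      embC (extDeriv (fun z => contractC n k l (K z) (α z)) y) := by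
  rw [flatLie, map_add, map_smul, embC_toDegreeC (by omega)]
  congr 2
  rcases l with _ | l
  · rw [extDeriv_contractC_zero_degree]
    simp
  · exact embC_toDegreeC (by omega) _

/-- The Nijenhuis-Lie derivative in components. -/
theorem embC_flatLie {ι : Type*} [Fintype ι] (b : Module.Basis ι ℝ (Eu n)) {k l : ℕ}
    {K : Eu n → CVAlt n k} {α : Eu n → CAlt n l} {y : Eu n} (hK : DifferentiableAt ℝ K y)
    (hα : DifferentiableAt ℝ α y) :
    embC (flatLie K α y) = lieExpr b k (fun i => embC (compC (b.coord i) k (K y)))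
      (fun i => embC (extDeriv (fun z => compC (b.coord i) k (K z)) y)) (embC (α y))
      (fun i => embC (fderiv ℝ α y (b i))) := by
  have hc : ∀ i v, fderiv ℝ (fun z => compC (b.coord i) k (K z)) y v =
      compC (b.coord i) k (fderiv ℝ K y v) := fun i v => fderiv_lin _ hK v
  -- S collects the derivatives of α in the directions e_j, wedged with e^j. It enters ι_K dα with
  -- the sign -(-1)^k, from moving e^j past κ^i, and enters d ι_K α with sign +; the factor (-1)^k
  -- in L_K makes the two cancel.
  set S := ∑ i, ∑ j, emb (oneForm (b.coord j)) * (embC (compC (b.coord i) k (K y)) *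
    contractExt (b i) (embC (fderiv ℝ α y (b j)))) with hS
  have h1 : embC (contractC n k (l + 1) (K y) (extDeriv α y)) =
      ∑ i, embC (compC (b.coord i) k (K y)) * embC (fderiv ℝ α y (b i)) - (-1 : ℝ) ^ k • S := by
    rw [embC_contractC b, hS, Finset.smul_sum, ← Finset.sum_sub_distrib]
    refine Finset.sum_congr rfl fun i _ => ?_
    rw [contractExt_extDeriv b, mul_sub, Finset.mul_sum, Finset.smul_sum]
    congr 1
    refine Finset.sum_congr rfl fun j _ => ?_
    rw [← mul_assoc, ← mul_assoc, embC_eq, emb_comm, mul_one, smul_mul_assoc]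
  have h2 : embC (extDeriv (fun z => contractC n k l (K z) (α z)) y) =
      ∑ i, embC (extDeriv (fun z => compC (b.coord i) k (K z)) y) * contractExt (b i) (embC (α y))
        + S := by
    rw [embC_extDeriv b, hS, Finset.sum_comm (γ := ι) (f := fun i j => _ * (_ * _))]
    simp only [embC_extDeriv b, Finset.sum_mul]
    rw [Finset.sum_comm (γ := ι) (f := fun i j => _ * _ * _), ← Finset.sum_add_distrib]
    refine Finset.sum_congr rfl fun j _ => ?_
    rw [fderiv_bilin (contractC n k l) hK hα, map_add, mul_add, embC_contractC b, embC_contractC b,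
      Finset.mul_sum, Finset.mul_sum]
    simp only [hc, mul_assoc]
  rw [embC_flatLie_eq, h1, h2, lieExpr, smul_add]
  abel

end Flat

/-! ### The bracket on the model space -/

section FlatBracket

variable {n : ℕ} {U : Set (Eu n)}

theorem contDiffOn_lin {X Y G : Type*} [NormedAddCommGroup X] [NormedSpace ℝ X]
    [NormedAddCommGroup Y] [NormedSpace ℝ Y] [NormedAddCommGroup G] [NormedSpace ℝ G]
    (L : X →L[ℝ] Y) {s : Set G} {f : G → X} (hf : ContDiffOn ℝ ∞ f s) :
    ContDiffOn ℝ ∞ (fun z => L (f z)) s :=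
  L.contDiff.comp_contDiffOn hf

theorem contDiffOn_bilin {X Y Z G : Type*} [NormedAddCommGroup X] [NormedSpace ℝ X]
    [NormedAddCommGroup Y] [NormedSpace ℝ Y] [NormedAddCommGroup Z] [NormedSpace ℝ Z]
    [NormedAddCommGroup G] [NormedSpace ℝ G] (B : X →L[ℝ] Y →L[ℝ] Z) {s : Set G} {f : G → X}
    {g : G → Y} (hf : ContDiffOn ℝ ∞ f s) (hg : ContDiffOn ℝ ∞ g s) :
    ContDiffOn ℝ ∞ (fun z => B (f z) (g z)) s :=
  (contDiffOn_lin B hf).clm_apply hg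

theorem contDiffOn_fderiv_apply {X G : Type*} [NormedAddCommGroup X] [NormedSpace ℝ X]
    [NormedAddCommGroup G] [NormedSpace ℝ G] {s : Set G} (hs : IsOpen s) {f : G → X}
    (hf : ContDiffOn ℝ ∞ f s) (v : G) : ContDiffOn ℝ ∞ (fun z => fderiv ℝ f z v) s :=
  (hf.fderiv_of_isOpen hs (by simp)).clm_apply contDiffOn_const

theorem contDiffOn_extDeriv (hU : IsOpen U) {k : ℕ} {α : Eu n → CAlt n k}
    (hα : ContDiffOn ℝ ∞ α U) : ContDiffOn ℝ ∞ (extDeriv α) U :=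
  contDiffOn_lin (ContinuousAlternatingMap.alternatizeUncurryFinCLM ℝ (Eu n) ℝ)
    (hα.fderiv_of_isOpen hU (by simp))

theorem contDiffOn_flatLie (hU : IsOpen U) {k l : ℕ} {K : Eu n → CVAlt n k} {α : Eu n → CAlt n l}
    (hK : ContDiffOn ℝ ∞ K U) (hα : ContDiffOn ℝ ∞ α U) : ContDiffOn ℝ ∞ (flatLie K α) U := by
  unfold flatLie
  exact (contDiffOn_lin _ (contDiffOn_bilin _ hK (contDiffOn_extDeriv hU hα))).add
    ((contDiffOn_lin _ (contDiffOn_extDeriv hU (contDiffOn_bilin _ hK hα))).const_smul _)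

theorem differentiableAt_of_contDiffOn {X G : Type*} [NormedAddCommGroup X] [NormedSpace ℝ X]
    [NormedAddCommGroup G] [NormedSpace ℝ G] {s : Set G} (hs : IsOpen s) {f : G → X}
    (hf : ContDiffOn ℝ ∞ f s) {y : G} (hy : y ∈ s) : DifferentiableAt ℝ f y :=
  (hf.contDiffAt (hs.mem_nhds hy)).differentiableAt (by simp)

/-- The Nijenhuis-Lie derivative in components, at the level of forms. -/
theorem flatLie_eq_sum {ι : Type*} [Fintype ι] (b : Module.Basis ι ℝ (Eu n)) {k l : ℕ}
    {K : Eu n → CVAlt n k} {α : Eu n → CAlt n l} {y : Eu n} (hK : DifferentiableAt ℝ K y)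
    (hα : DifferentiableAt ℝ α y) :
    flatLie K α y = ∑ j, wedgeC n (k + l) k l (compC (b.coord j) k (K y)) (fderiv ℝ α y (b j)) +
      (-1 : ℝ) ^ k • ∑ j, wedgeC n (k + l) (k + 1) (l - 1)
        (extDeriv (fun z => compC (b.coord j) k (K z)) y) (interiorC (b j) l (α y)) := by
  apply embC_injective
  rw [embC_flatLie b hK hα, lieExpr, map_add, map_smul, map_sum, map_sum]
  congr 1
  · exact Finset.sum_congr rfl fun j _ => (embC_wedgeC rfl _ _).symm
  · congr 1
    refine Finset.sum_congr rfl fun j _ => ?_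
    rw [← embC_interiorC]
    rcases l with _ | l
    · have h0 : interiorC (b j) 0 (α y) = 0 := rfl
      rw [h0, map_zero, mul_zero, map_zero, map_zero]
    · exact (embC_wedgeC (by omega) _ _).symm

/-- The Leibniz rule on the component formula, which holds in a neighbourhood and may therefore be
differentiated. The result has the shape that `lieExpr_lieExpr` expects. -/
theorem embC_fderiv_flatLie {ι : Type*} [Fintype ι] (b : Module.Basis ι ℝ (Eu n))
    (hU : IsOpen U) {k l : ℕ} {K : Eu n → CVAlt n k} {α : Eu n → CAlt n l}
    (hK : ContDiffOn ℝ ∞ K U) (hα : ContDiffOn ℝ ∞ α U) {y : Eu n} (hy : y ∈ U) (v : Eu n) :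
    embC (fderiv ℝ (flatLie K α) y v) =
      ∑ j, (embC (fderiv ℝ (fun z => compC (b.coord j) k (K z)) y v) * embC (fderiv ℝ α y (b j)) +
        embC (compC (b.coord j) k (K y)) * embC (fderiv ℝ (fun z => fderiv ℝ α z (b j)) y v)) +
      (-1 : ℝ) ^ k •
        ∑ j, (embC (fderiv ℝ (extDeriv (fun z => compC (b.coord j) k (K z))) y v) *
            contractExt (b j) (embC (α y)) +
          embC (extDeriv (fun z => compC (b.coord j) k (K z)) y) *
            contractExt (b j) (embC (fderiv ℝ α y v))) := by
  have hev : flatLie K α =ᶠ[nhds y] fun y =>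
      ∑ j, wedgeC n (k + l) k l (compC (b.coord j) k (K y)) (fderiv ℝ α y (b j)) +
      (-1 : ℝ) ^ k • ∑ j, wedgeC n (k + l) (k + 1) (l - 1)
        (extDeriv (fun z => compC (b.coord j) k (K z)) y) (interiorC (b j) l (α y)) := by
    filter_upwards [hU.mem_nhds hy] with z hz
    exact flatLie_eq_sum b (differentiableAt_of_contDiffOn hU hK hz)
      (differentiableAt_of_contDiffOn hU hα hz)
  have hκ : ∀ j, ContDiffOn ℝ ∞ (fun z => compC (b.coord j) k (K z)) U := fun j =>
    contDiffOn_lin _ hK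
  have d1 : ∀ j, DifferentiableAt ℝ (fun z => compC (b.coord j) k (K z)) y := fun j =>
    differentiableAt_of_contDiffOn hU (hκ j) hy
  have d2 : ∀ j, DifferentiableAt ℝ (extDeriv (fun z => compC (b.coord j) k (K z))) y := fun j =>
    differentiableAt_of_contDiffOn hU (contDiffOn_extDeriv hU (hκ j)) hy
  have d3 : ∀ j, DifferentiableAt ℝ (fun z => fderiv ℝ α z (b j)) y := fun j =>
    differentiableAt_of_contDiffOn hU (contDiffOn_fderiv_apply hU hα (b j)) hy
  have d4 : ∀ j, DifferentiableAt ℝ (fun z => interiorC (b j) l (α z)) y := fun j =>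
    differentiableAt_of_contDiffOn hU (contDiffOn_lin _ hα) hy
  have d5 := differentiableAt_of_contDiffOn hU hα hy
  have d6 : ∀ j, DifferentiableAt ℝ (fun z =>
      wedgeC n (k + l) k l (compC (b.coord j) k (K z)) (fderiv ℝ α z (b j))) y := fun j =>
    ((wedgeC n (k + l) k l).hasFDerivAt_of_bilinear (d1 j).hasFDerivAt
      (d3 j).hasFDerivAt).differentiableAt
  have d7 : ∀ j, DifferentiableAt ℝ (fun z => wedgeC n (k + l) (k + 1) (l - 1)
        (extDeriv (fun z => compC (b.coord j) k (K z)) z) (interiorC (b j) l (α z))) y := fun j =>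
    ((wedgeC n (k + l) (k + 1) (l - 1)).hasFDerivAt_of_bilinear (d2 j).hasFDerivAt
      (d4 j).hasFDerivAt).differentiableAt
  have hsum : fderiv ℝ (flatLie K α) y v =
      ∑ j, fderiv ℝ (fun z =>
        wedgeC n (k + l) k l (compC (b.coord j) k (K z)) (fderiv ℝ α z (b j))) y v +
      (-1 : ℝ) ^ k • ∑ j, fderiv ℝ (fun z => wedgeC n (k + l) (k + 1) (l - 1)
        (extDeriv (fun z => compC (b.coord j) k (K z)) z) (interiorC (b j) l (α z))) y v := by
    rw [hev.fderiv_eq]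
    have h := (HasFDerivAt.fun_sum (u := Finset.univ) fun j _ => (d6 j).hasFDerivAt).add
      ((HasFDerivAt.fun_sum (u := Finset.univ) fun j _ => (d7 j).hasFDerivAt).const_smul
        ((-1 : ℝ) ^ k))
    refine (congrArg (fun f => f v) h.fderiv).trans ?_
    simp
  rw [hsum, map_add, map_smul, map_sum, map_sum]
  congr 1
  · refine Finset.sum_congr rfl fun j _ => ?_
    rw [fderiv_bilin _ (d1 j) (d3 j), map_add, embC_wedgeC rfl, embC_wedgeC rfl]
  · congr 1
    refine Finset.sum_congr rfl fun j _ => ?_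
    rw [fderiv_bilin _ (d2 j) (d4 j), fderiv_lin _ d5, ← embC_interiorC, ← embC_interiorC, map_add]
    rcases l with _ | l
    · have h0 : ∀ β, interiorC (b j) 0 β = 0 := fun _ => rfl
      simp only [h0, map_zero, mul_zero]
    · rw [embC_wedgeC (by omega), embC_wedgeC (by omega)]

theorem extDeriv_congr_sub {k : ℕ} {α β : Eu n → CAlt n k} {y : Eu n} (c : ℝ)
    (hα : DifferentiableAt ℝ α y) (hβ : DifferentiableAt ℝ β y) :
    extDeriv (fun z => α z + c • β z) y = extDeriv α y + c • extDeriv β y := by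
  exact (extDeriv_fun_add hα (hβ.const_smul c)).trans
    (congrArg (fun η => extDeriv α y + η) (extDeriv_smul c β))

theorem embC_extDeriv_toDegreeC {k m : ℕ} (h : k = m) {α : Eu n → CAlt n k} {y : Eu n} :
    embC (extDeriv (fun z => toDegreeC n m k (α z)) y) = embC (extDeriv α y) := by
  subst h
  have : (fun z => toDegreeC n k k (α z)) = α := by
    funext z
    apply embC_injective
    rw [embC_toDegreeC rfl]
  rw [this]

/-- The Nijenhuis-Lie derivative commutes with the exterior derivative up to sign. -/
theorem embC_extDeriv_flatLie (hU : IsOpen U) {k l : ℕ} {K : Eu n → CVAlt n k}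
    {α : Eu n → CAlt n l} (hK : ContDiffOn ℝ ∞ K U) (hα : ContDiffOn ℝ ∞ α U) {y : Eu n}
    (hy : y ∈ U) :
    embC (extDeriv (flatLie K α) y) = (-1 : ℝ) ^ k • embC (flatLie K (extDeriv α) y) := by
  have hdd : ∀ {r : ℕ} {β : Eu n → CAlt n r}, ContDiffOn ℝ ∞ β U → extDeriv (extDeriv β) y = 0 :=
    fun hβ => extDeriv_extDeriv_apply (r := ∞) (hβ.contDiffAt (hU.mem_nhds hy))
      (by rw [minSmoothness_of_isRCLikeNormedField]; exact ENat.LEInfty.out)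
  have hc := contDiffOn_bilin (contractC n k l) hK hα
  have hc' := contDiffOn_bilin (contractC n k (l + 1)) hK (contDiffOn_extDeriv hU hα)
  have h0 : ∀ {r m : ℕ} {β : Eu n → CAlt n r}, ContDiffOn ℝ ∞ β U →
      DifferentiableAt ℝ (fun z => toDegreeC n m (r + 1) (extDeriv β z)) y := fun hβ =>
    differentiableAt_of_contDiffOn hU (contDiffOn_lin _ (contDiffOn_extDeriv hU hβ)) hy
  -- Since d² = 0, L_K dα is (-1)^k d ι_K dα, while d L_K α is d ι_K dα; the two signs (-1)^k
  -- multiply to 1.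
  rw [embC_flatLie_eq, hdd hα, map_zero, map_zero, zero_add, smul_smul, neg_one_pow_mul_self,
    one_smul]
  unfold flatLie
  rw [extDeriv_congr_sub _ (differentiableAt_of_contDiffOn hU (contDiffOn_lin _ hc') hy) (h0 hc),
    map_add, map_smul, embC_extDeriv_toDegreeC (by omega)]
  have hz : embC (extDeriv (fun z => toDegreeC n (k + l) (k + (l - 1) + 1)
      (extDeriv (fun z => contractC n k l (K z) (α z)) z)) y) = 0 := by
    rcases l with _ | l
    · simp only [extDeriv_contractC_zero_degree, map_zero]
      rw [extDeriv, fderiv_fun_const]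
      have : ContinuousAlternatingMap.alternatizeUncurryFin
        (0 : Eu n →L[ℝ] CAlt n (k + 0)) = 0 := by
        ext v
        simp [ContinuousAlternatingMap.alternatizeUncurryFin_apply]
      exact (congrArg embC this).trans (map_zero _)
    · rw [embC_extDeriv_toDegreeC (by omega), hdd hc, map_zero]
  rw [hz, smul_zero, add_zero]

/-- The composition of two Nijenhuis-Lie derivatives. -/
theorem embC_flatLie_flatLie {ι : Type*} [Fintype ι] (b : Module.Basis ι ℝ (Eu n))
    (hU : IsOpen U) {k₁ k₂ l : ℕ} {K₁ : Eu n → CVAlt n k₁} {K₂ : Eu n → CVAlt n k₂}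
    {α : Eu n → CAlt n l} (hK₁ : ContDiffOn ℝ ∞ K₁ U) (hK₂ : ContDiffOn ℝ ∞ K₂ U)
    (hα : ContDiffOn ℝ ∞ α U) {y : Eu n} (hy : y ∈ U) :
    embC (flatLie K₁ (flatLie K₂ α) y) =
      ∑ j, embC (flatLie K₁ (fun z => compC (b.coord j) k₂ (K₂ z)) y) * embC (fderiv ℝ α y (b j))
        + (-1 : ℝ) ^ k₂ •
          ∑ j, embC (flatLie K₁ (extDeriv (fun z => compC (b.coord j) k₂ (K₂ z))) y) *
            contractExt (b j) (embC (α y))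
        + ∑ i, ∑ j, crossTerm b k₁ k₂ (fun i => embC (compC (b.coord i) k₁ (K₁ y)))
          (fun i => embC (extDeriv (fun z => compC (b.coord i) k₁ (K₁ z)) y))
          (fun i => embC (compC (b.coord i) k₂ (K₂ y)))
          (fun i => embC (extDeriv (fun z => compC (b.coord i) k₂ (K₂ z)) y)) (embC (α y))
          (fun i => embC (fderiv ℝ α y (b i)))
          (fun i j => embC (fderiv ℝ (fun z => fderiv ℝ α z (b j)) y (b i))) i j := by
  have d1 := differentiableAt_of_contDiffOn hU hK₁ hy
  have d2 := differentiableAt_of_contDiffOn hU hK₂ hy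
  have dα := differentiableAt_of_contDiffOn hU hα hy
  have hκ : ∀ j, ContDiffOn ℝ ∞ (fun z => compC (b.coord j) k₂ (K₂ z)) U := fun j =>
    contDiffOn_lin _ hK₂
  rw [embC_flatLie b d1 (differentiableAt_of_contDiffOn hU (contDiffOn_flatLie hU hK₂ hα) hy)]
  simp only [embC_fderiv_flatLie b hU hK₂ hα hy, embC_flatLie b d2 dα]
  refine (lieExpr_lieExpr b _ _ (fun j => (compC (b.coord j) k₂ (K₂ y)).toAlternatingMap)
    (fun j => (extDeriv (fun z => compC (b.coord j) k₂ (K₂ z)) y).toAlternatingMap) _ _ _ _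
    _).trans ?_
  congr 2
  · refine Finset.sum_congr rfl fun j _ => ?_
    rw [embC_flatLie b d1 (differentiableAt_of_contDiffOn hU (hκ j) hy)]
    rfl
  · congr 1
    refine Finset.sum_congr rfl fun j _ => ?_
    rw [embC_flatLie b d1 (differentiableAt_of_contDiffOn hU (contDiffOn_extDeriv hU (hκ j)) hy)]
    rfl

/-- The standard basis of the model space. -/
noncomputable def stdB (n : ℕ) : Module.Basis (Fin n) ℝ (Eu n) :=
  (EuclideanSpace.basisFun (Fin n) ℝ).toBasis

/-- The component along `φ` of the Frölicher-Nijenhuis bracket on the model space. -/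
noncomputable def flatBracketComp {k₁ k₂ : ℕ} (K₁ : Eu n → CVAlt n k₁) (K₂ : Eu n → CVAlt n k₂)
    (φ : Eu n →ₗ[ℝ] ℝ) : Eu n → CAlt n (k₁ + k₂) := fun y =>
  flatLie K₁ (fun z => compC φ k₂ (K₂ z)) y + (-(-1 : ℝ) ^ (k₁ * k₂)) •
    toDegreeC n (k₁ + k₂) (k₂ + k₁) (flatLie K₂ (fun z => compC φ k₁ (K₁ z)) y)

/-- The Frölicher-Nijenhuis bracket on the model space. -/
noncomputable def flatBracket {k₁ k₂ : ℕ} (K₁ : Eu n → CVAlt n k₁) (K₂ : Eu n → CVAlt n k₂) :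
    Eu n → CVAlt n (k₁ + k₂) := fun y =>
  toCont (∑ j, tensorVec (flatBracketComp K₁ K₂ ((stdB n).coord j) y).toAlternatingMap (stdB n j))

theorem compC_flatBracket_coord {k₁ k₂ : ℕ} (K₁ : Eu n → CVAlt n k₁) (K₂ : Eu n → CVAlt n k₂)
    (j : Fin n) (y : Eu n) :
    compC ((stdB n).coord j) (k₁ + k₂) (flatBracket K₁ K₂ y) =
      flatBracketComp K₁ K₂ ((stdB n).coord j) y :=
  congrArg toCont (comp_sum_tensorVec (stdB n)
    (fun j => (flatBracketComp K₁ K₂ ((stdB n).coord j) y).toAlternatingMap) j)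

theorem compC_eq_sum {k : ℕ} (φ : Eu n →ₗ[ℝ] ℝ) (K : CVAlt n k) :
    compC φ k K = ∑ j, φ (stdB n j) • compC ((stdB n).coord j) k K := by
  refine ContinuousAlternatingMap.ext fun v => ?_
  have h : ∀ (s : Finset (Fin n)), (∑ j ∈ s, φ (stdB n j) • compC ((stdB n).coord j) k K) v =
      ∑ j ∈ s, φ (stdB n j) * (stdB n).coord j (K v) := by
    intro s
    induction s using Finset.induction_on with
    | empty => simp
    | insert a s ha ih => rw [Finset.sum_insert ha, Finset.sum_insert ha, ← ih]; rfl
  rw [h]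
  change φ (K v) = _
  conv_lhs => rw [← (stdB n).sum_repr (K v), map_sum]
  refine Finset.sum_congr rfl fun j _ => ?_
  rw [map_smul, smul_eq_mul, mul_comm]
  rfl

theorem lieExpr_sum {V : Type*} [AddCommGroup V] [Module ℝ V] {ι κ : Type*} [Fintype ι]
    [Fintype κ] (b : ι → V) (k : ℕ) (K dK : ι → Ext V) (c : κ → ℝ) (a : κ → Ext V)
    (da : κ → ι → Ext V) :
    lieExpr b k K dK (∑ j, c j • a j) (fun i => ∑ j, c j • da j i) =
      ∑ j, c j • lieExpr b k K dK (a j) (da j) := by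
  simp only [lieExpr, smul_add, Finset.sum_add_distrib, Finset.smul_sum, map_sum, map_smul,
    Finset.mul_sum, mul_smul_comm]
  rw [Finset.sum_comm, Finset.sum_comm (γ := ι)]
  congr 1
  exact Finset.sum_congr rfl fun j _ => Finset.sum_congr rfl fun i _ => smul_comm _ _ _

/-- L_K is linear over constants. The bracket is assembled from coordinate components, and this
extends the component formula to every covector, hence to components in any basis. -/
theorem flatLie_compC {k₁ k₂ : ℕ} {K₁ : Eu n → CVAlt n k₁} {K₂ : Eu n → CVAlt n k₂} {y : Eu n}
    (hK₁ : DifferentiableAt ℝ K₁ y) (hK₂ : DifferentiableAt ℝ K₂ y) (φ : Eu n →ₗ[ℝ] ℝ) :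
    flatLie K₁ (fun z => compC φ k₂ (K₂ z)) y =
      ∑ j, φ (stdB n j) • flatLie K₁ (fun z => compC ((stdB n).coord j) k₂ (K₂ z)) y := by
  have hd : ∀ ψ : Eu n →ₗ[ℝ] ℝ, DifferentiableAt ℝ (fun z => compC ψ k₂ (K₂ z)) y := fun ψ =>
    ((compC ψ k₂).hasFDerivAt.comp y hK₂.hasFDerivAt).differentiableAt
  apply embC_injective
  rw [map_sum]
  simp only [map_smul, embC_flatLie (stdB n) hK₁ (hd _)]
  rw [← lieExpr_sum]
  have h : ∀ K, embC (compC φ k₂ K) =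
      ∑ j, φ (stdB n j) • embC (compC ((stdB n).coord j) k₂ K) := fun K => by
    rw [compC_eq_sum φ K, map_sum]
    simp only [map_smul]
  simp only [fderiv_lin _ hK₂, ← h]

/-- The component of the bracket along any covector. -/
theorem compC_flatBracket {k₁ k₂ : ℕ} {K₁ : Eu n → CVAlt n k₁} {K₂ : Eu n → CVAlt n k₂} {y : Eu n}
    (hK₁ : DifferentiableAt ℝ K₁ y) (hK₂ : DifferentiableAt ℝ K₂ y) (φ : Eu n →ₗ[ℝ] ℝ) :
    compC φ (k₁ + k₂) (flatBracket K₁ K₂ y) = flatBracketComp K₁ K₂ φ y := by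
  rw [compC_eq_sum]
  simp only [compC_flatBracket_coord]
  simp only [flatBracketComp]
  rw [flatLie_compC hK₁ hK₂ φ, flatLie_compC hK₂ hK₁ φ]
  simp only [smul_add, Finset.sum_add_distrib, map_sum, map_smul, Finset.smul_sum]
  congr 1
  exact Finset.sum_congr rfl fun j _ => smul_comm _ _ _

theorem contDiffOn_flatBracketComp (hU : IsOpen U) {k₁ k₂ : ℕ} {K₁ : Eu n → CVAlt n k₁}
    {K₂ : Eu n → CVAlt n k₂} (hK₁ : ContDiffOn ℝ ∞ K₁ U) (hK₂ : ContDiffOn ℝ ∞ K₂ U)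
    (φ : Eu n →ₗ[ℝ] ℝ) : ContDiffOn ℝ ∞ (flatBracketComp K₁ K₂ φ) U :=
  (contDiffOn_flatLie hU hK₁ (contDiffOn_lin _ hK₂)).add
    ((contDiffOn_lin _ (contDiffOn_flatLie hU hK₂ (contDiffOn_lin _ hK₁))).const_smul _)

/-- `κ ↦ κ ⊗ x` as a linear map. -/
noncomputable def tensorVecₗ {V : Type*} [AddCommGroup V] [Module ℝ V] (x : V) (k : ℕ) :
    Alt V k →ₗ[ℝ] (V [⋀^Fin k]→ₗ[ℝ] V) where
  toFun κ := tensorVec κ x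
  map_add' κ κ' := by ext v; simp [tensorVec]
  map_smul' c κ := by ext v; simp [tensorVec]

theorem contDiffOn_flatBracket (hU : IsOpen U) {k₁ k₂ : ℕ} {K₁ : Eu n → CVAlt n k₁}
    {K₂ : Eu n → CVAlt n k₂} (hK₁ : ContDiffOn ℝ ∞ K₁ U) (hK₂ : ContDiffOn ℝ ∞ K₂ U) :
    ContDiffOn ℝ ∞ (flatBracket K₁ K₂) U := by
  have h : flatBracket K₁ K₂ = fun y => ∑ j, contLin (tensorVecₗ (stdB n j) (k₁ + k₂))
      (flatBracketComp K₁ K₂ ((stdB n).coord j) y) := by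
    funext y
    exact map_sum (toContEquiv n (Eu n) (k₁ + k₂)) _ _
  rw [h]
  exact ContDiffOn.sum fun j _ => contDiffOn_lin _ (contDiffOn_flatBracketComp hU hK₁ hK₂ _)

/-- On the model space, `L_{[K₁, K₂]} = [L_{K₁}, L_{K₂}]`. -/
theorem embC_flatLie_flatBracket (hU : IsOpen U) {k₁ k₂ l : ℕ} {K₁ : Eu n → CVAlt n k₁}
    {K₂ : Eu n → CVAlt n k₂} {α : Eu n → CAlt n l} (hK₁ : ContDiffOn ℝ ∞ K₁ U)
    (hK₂ : ContDiffOn ℝ ∞ K₂ U) (hα : ContDiffOn ℝ ∞ α U) {y : Eu n} (hy : y ∈ U) :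
    embC (flatLie (flatBracket K₁ K₂) α y) = embC (flatLie K₁ (flatLie K₂ α) y) -
      (-1 : ℝ) ^ (k₁ * k₂) • embC (flatLie K₂ (flatLie K₁ α) y) := by
  set b := stdB n
  have c1 : ∀ j, ContDiffOn ℝ ∞ (fun z => compC (b.coord j) k₁ (K₁ z)) U := fun j =>
    contDiffOn_lin _ hK₁
  have c2 : ∀ j, ContDiffOn ℝ ∞ (fun z => compC (b.coord j) k₂ (K₂ z)) U := fun j =>
    contDiffOn_lin _ hK₂
  have e1 : ∀ j, embC (flatBracketComp K₁ K₂ (b.coord j) y) =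
      embC (flatLie K₁ (fun z => compC (b.coord j) k₂ (K₂ z)) y) - (-1 : ℝ) ^ (k₁ * k₂) •
        embC (flatLie K₂ (fun z => compC (b.coord j) k₁ (K₁ z)) y) := fun j => by
    rw [flatBracketComp, map_add, map_smul, embC_toDegreeC (by omega), neg_smul, sub_eq_add_neg]
  -- The differential of a component of the bracket: d moves inside each Lie derivative at the cost
  -- of (-1)^{k₁} or (-1)^{k₂}. This matches the second sum in `embC_flatLie_flatLie`.
  have e2 : ∀ j, embC (extDeriv (flatBracketComp K₁ K₂ (b.coord j)) y) = (-1 : ℝ) ^ k₁ •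
      embC (flatLie K₁ (extDeriv fun z => compC (b.coord j) k₂ (K₂ z)) y) -
      (-1 : ℝ) ^ (k₁ * k₂) • (-1 : ℝ) ^ k₂ •
        embC (flatLie K₂ (extDeriv fun z => compC (b.coord j) k₁ (K₁ z)) y) := fun j => by
    unfold flatBracketComp
    rw [extDeriv_congr_sub, map_add, map_smul, embC_extDeriv_toDegreeC (by omega),
      embC_extDeriv_flatLie hU hK₁ (c2 j) hy, embC_extDeriv_flatLie hU hK₂ (c1 j) hy, neg_smul,
      sub_eq_add_neg]
    · exact differentiableAt_of_contDiffOn hU (contDiffOn_flatLie hU hK₁ (c2 j)) hy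
    · exact differentiableAt_of_contDiffOn hU
        (contDiffOn_lin _ (contDiffOn_flatLie hU hK₂ (c1 j))) hy
  have hB : ∀ j, (fun z => compC (b.coord j) (k₁ + k₂) (flatBracket K₁ K₂ z)) =
      flatBracketComp K₁ K₂ (b.coord j) := fun j => funext fun z => compC_flatBracket_coord K₁ K₂ j z
  have hB' : ∀ j, compC (b.coord j) (k₁ + k₂) (flatBracket K₁ K₂ y) =
      flatBracketComp K₁ K₂ (b.coord j) y := fun j => compC_flatBracket_coord K₁ K₂ j y
  have hs : ∀ v w, fderiv ℝ (fun z => fderiv ℝ α z v) y w = fderiv ℝ (fderiv ℝ α) y w v := by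
    intro v w
    have hd : DifferentiableAt ℝ (fderiv ℝ α) y :=
      differentiableAt_of_contDiffOn hU (hα.fderiv_of_isOpen hU (by simp)) hy
    rw [fderiv_clm_apply hd (differentiableAt_const v)]
    simp
  have hsymm : ∀ i j, fderiv ℝ (fun z => fderiv ℝ α z (b j)) y (b i) =
      fderiv ℝ (fun z => fderiv ℝ α z (b i)) y (b j) := by
    intro i j
    rw [hs, hs]
    exact ((hα.contDiffAt (hU.mem_nhds hy)).isSymmSndFDerivAt
      (by rw [minSmoothness_of_isRCLikeNormedField]; exact ENat.LEInfty.out)) _ _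
  rw [embC_flatLie b (differentiableAt_of_contDiffOn hU (contDiffOn_flatBracket hU hK₁ hK₂) hy)
    (differentiableAt_of_contDiffOn hU hα hy), lieExpr, embC_flatLie_flatLie b hU hK₁ hK₂ hα hy,
    embC_flatLie_flatLie b hU hK₂ hK₁ hα hy]
  simp only [hB, hB', e1, e2]
  have hcross : ∀ i j, _ = _ := fun i j => crossTerm_cancel b
    (fun i => (compC (b.coord i) k₁ (K₁ y)).toAlternatingMap)
    (fun i => (extDeriv (fun z => compC (b.coord i) k₁ (K₁ z)) y).toAlternatingMap)
    (fun i => (compC (b.coord i) k₂ (K₂ y)).toAlternatingMap)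
    (fun i => (extDeriv (fun z => compC (b.coord i) k₂ (K₂ z)) y).toAlternatingMap) (embC (α y))
    (fun i => embC (fderiv ℝ α y (b i)))
    (fun i j => embC (fderiv ℝ (fun z => fderiv ℝ α z (b j)) y (b i)))
    (fun i j => congrArg embC (hsymm i j)) i j
  -- Summed over i and j, the interchange of the two indices is invisible, so the cross terms of the
  -- two composites agree up to exactly the sign of the commutator.
  have hcross' := (Finset.sum_congr rfl fun i (_ : i ∈ Finset.univ) =>
    Finset.sum_congr rfl fun j (_ : j ∈ Finset.univ) => hcross i j).trans Finset.sum_comm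
  simp only [← Finset.smul_sum, ← embC_eq] at hcross'
  refine Eq.trans ?_ (congrArg₂ (fun x y => _ + _ + x - y) hcross'.symm rfl)
  simp only [sub_mul, Finset.sum_sub_distrib, smul_mul_assoc, ← Finset.smul_sum, pow_add]
  rcases neg_one_pow_eq_or ℝ k₁ with h1 | h1 <;> rcases neg_one_pow_eq_or ℝ k₂ with h2 | h2 <;>
    rw [h1, h2] <;>
    simp only [one_smul, neg_smul, mul_one, mul_neg, neg_neg, smul_add, smul_neg, sub_eq_add_neg,
      neg_add] <;> abel

end FlatBracket

/-! ### Forms in charts and change of chart -/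

section Charts

variable {n : ℕ} {M : Type*} [TopologicalSpace M] [ChartedSpace (EuclideanSpace ℝ (Fin n)) M]

/-- The inverse of the differential at `q` of the chart around `p`. -/
noncomputable def chartInv (p q : M) : EuclideanSpace ℝ (Fin n) →ₗ[ℝ] TangentSpace (𝓡 n) q :=
  (mfderiv (𝓡 n) (𝓡 n) (extChartAt (𝓡 n) p) q).inverse.toLinearMap

theorem inChart_congr {k : ℕ} {η : Form n M k} {β : EuclideanSpace ℝ (Fin n) → CAlt n k} {p : M}
    (h : ∀ x ∈ (extChartAt (𝓡 n) p).source, inChart η p (extChartAt (𝓡 n) p x) =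
      β (extChartAt (𝓡 n) p x)) : Set.EqOn (inChart η p) β (extChartAt (𝓡 n) p).target := by
  intro y hy
  have := h _ ((extChartAt (𝓡 n) p).map_target hy)
  rwa [(extChartAt (𝓡 n) p).right_inv hy] at this

/-- The transition map between two charts. -/
noncomputable def transition (p q : M) : EuclideanSpace ℝ (Fin n) → EuclideanSpace ℝ (Fin n) :=
  fun y => extChartAt (𝓡 n) q ((extChartAt (𝓡 n) p).symm y)

theorem transition_eventually {p q x : M} (hp : x ∈ (extChartAt (𝓡 n) p).source)
    (hq : x ∈ (extChartAt (𝓡 n) q).source) :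
    ∀ᶠ y in nhds (extChartAt (𝓡 n) p x), y ∈ (extChartAt (𝓡 n) p).target ∧
      (extChartAt (𝓡 n) p).symm y ∈ (extChartAt (𝓡 n) q).source := by
  have h1 := (isOpen_extChartAt_target p).eventually_mem ((extChartAt (𝓡 n) p).map_source hp)
  have h2 : ∀ᶠ y in nhds (extChartAt (𝓡 n) p x),
      (extChartAt (𝓡 n) p).symm y ∈ (extChartAt (𝓡 n) q).source :=
    (continuousAt_extChartAt_symm' hp).eventually_mem ((isOpen_extChartAt_source q).mem_nhds
      (by rwa [(extChartAt (𝓡 n) p).left_inv hp]))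
  exact h1.and h2

variable [IsManifold (𝓡 n) ∞ M]

theorem isManifold_one : IsManifold (𝓡 n) 1 M := IsManifold.of_le (n := ∞) (by simp)

attribute [local instance] isManifold_one

theorem chartInv_chartDeriv {p q : M} (hq : q ∈ (extChartAt (𝓡 n) p).source)
    (v : TangentSpace (𝓡 n) q) : chartInv p q (chartDeriv p q v) = v :=
  (isInvertible_mfderiv_extChartAt hq).inverse_apply_self v

theorem chartDeriv_chartInv {p q : M} (hq : q ∈ (extChartAt (𝓡 n) p).source)
    (v : EuclideanSpace ℝ (Fin n)) : chartDeriv p q (chartInv p q v) = v :=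
  (isInvertible_mfderiv_extChartAt hq).self_apply_inverse v

/-- The differential of the inverse chart is the inverse of the differential of the chart. The right
side is indexed by a point of M, which is the convenient form. -/
theorem chartSymmDeriv_eq {p : M} {y : EuclideanSpace ℝ (Fin n)}
    (hy : y ∈ (extChartAt (𝓡 n) p).target) :
    chartSymmDeriv p y = chartInv p ((extChartAt (𝓡 n) p).symm y) := by
  ext1 v
  have hs := (extChartAt (𝓡 n) p).map_target hy
  have h := mfderivWithin_extChartAt_symm_comp_mfderiv_extChartAt (I := 𝓡 n) hy
  have h2 := congrArg (fun f => f (chartInv p ((extChartAt (𝓡 n) p).symm y) v)) h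
  have h3 := chartDeriv_chartInv hs v
  simp only [ModelWithCorners.range_eq_univ, mfderivWithin_univ] at h2
  change mfderiv _ _ _ _ (chartDeriv p _ _) = chartInv p _ v at h2
  rw [h3] at h2
  exact h2

/-- Stated at a point q rather than at a coordinate y, so that no identification of the tangent
spaces at q and at the image of its coordinates is needed. -/
theorem inChart_apply {k : ℕ} (η : Form n M k) {p q : M}
    (hq : q ∈ (extChartAt (𝓡 n) p).source) :
    inChart η p (extChartAt (𝓡 n) p q) = toCont ((η q).compLinearMap (chartInv p q)) := by
  obtain ⟨y, hy, rfl⟩ : ∃ y ∈ (extChartAt (𝓡 n) p).target, (extChartAt (𝓡 n) p).symm y = q :=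
    ⟨_, (extChartAt (𝓡 n) p).map_source hq, (extChartAt (𝓡 n) p).left_inv hq⟩
  rw [(extChartAt (𝓡 n) p).right_inv hy, inChart, chartSymmDeriv_eq hy]

theorem inChartV_apply {k : ℕ} (K : VForm n M k) {p q : M}
    (hq : q ∈ (extChartAt (𝓡 n) p).source) :
    inChartV K p (extChartAt (𝓡 n) p q) =
      toCont ((chartDeriv p q).compAlternatingMap ((K q).compLinearMap (chartInv p q))) := by
  obtain ⟨y, hy, rfl⟩ : ∃ y ∈ (extChartAt (𝓡 n) p).target, (extChartAt (𝓡 n) p).symm y = q :=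
    ⟨_, (extChartAt (𝓡 n) p).map_source hq, (extChartAt (𝓡 n) p).left_inv hq⟩
  rw [(extChartAt (𝓡 n) p).right_inv hy, inChartV, chartSymmDeriv_eq hy]

theorem eq_inChart {k : ℕ} (η : Form n M k) {p q : M}
    (hq : q ∈ (extChartAt (𝓡 n) p).source) : η q =
      (inChart η p (extChartAt (𝓡 n) p q)).toAlternatingMap.compLinearMap (chartDeriv p q) := by
  rw [inChart_apply η hq]
  ext v
  change _ = η q fun i => chartInv p q (chartDeriv p q (v i))
  simp only [chartInv_chartDeriv hq]

theorem eq_inChartV {k : ℕ} (K : VForm n M k) {p q : M}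
    (hq : q ∈ (extChartAt (𝓡 n) p).source) : K q = (chartInv p q).compAlternatingMap
      ((inChartV K p (extChartAt (𝓡 n) p q)).toAlternatingMap.compLinearMap (chartDeriv p q)) := by
  rw [inChartV_apply K hq]
  ext v
  change _ = chartInv p q (chartDeriv p q (K q fun i => chartInv p q (chartDeriv p q (v i))))
  simp only [chartInv_chartDeriv hq]

theorem mdifferentiableAt_chart {p q : M} (hq : q ∈ (extChartAt (𝓡 n) p).source) :
    MDifferentiableAt (𝓡 n) (𝓡 n) (extChartAt (𝓡 n) p) q :=
  mdifferentiableAt_extChartAt (by rwa [extChartAt_source] at hq)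

theorem mdifferentiableAt_chart_symm {p : M} {y : EuclideanSpace ℝ (Fin n)}
    (hy : y ∈ (extChartAt (𝓡 n) p).target) :
    MDifferentiableAt (𝓡 n) (𝓡 n) (extChartAt (𝓡 n) p).symm y :=
  ((contMDiffOn_extChartAt_symm (n := ∞) p).contMDiffAt
    ((isOpen_extChartAt_target p).mem_nhds hy)).mdifferentiableAt (by simp)

theorem contDiffAt_transition {p q x : M} (hp : x ∈ (extChartAt (𝓡 n) p).source)
    (hq : x ∈ (extChartAt (𝓡 n) q).source) :
    ContDiffAt ℝ ∞ (transition p q) (extChartAt (𝓡 n) p x) := by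
  rw [← contMDiffAt_iff_contDiffAt]
  have h1 : ContMDiffAt (𝓡 n) (𝓡 n) ∞ (extChartAt (𝓡 n) p).symm (extChartAt (𝓡 n) p x) :=
    (contMDiffOn_extChartAt_symm (n := ∞) p).contMDiffAt
      ((isOpen_extChartAt_target p).mem_nhds ((extChartAt (𝓡 n) p).map_source hp))
  refine ContMDiffAt.comp _ ?_ h1
  rw [(extChartAt (𝓡 n) p).left_inv hp]
  exact contMDiffAt_extChartAt' (by rwa [extChartAt_source] at hq)

theorem fderiv_transition {p q : M} {y : EuclideanSpace ℝ (Fin n)}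
    (hy : y ∈ (extChartAt (𝓡 n) p).target)
    (hq : (extChartAt (𝓡 n) p).symm y ∈ (extChartAt (𝓡 n) q).source)
    (v : EuclideanSpace ℝ (Fin n)) :
    fderiv ℝ (transition p q) y v =
      chartDeriv q ((extChartAt (𝓡 n) p).symm y) (chartSymmDeriv p y v) := by
  rw [← mfderiv_eq_fderiv]
  have := mfderiv_comp y (mdifferentiableAt_chart hq) (mdifferentiableAt_chart_symm hy)
  exact congrArg (fun f => f v) this

theorem inChart_transition {k : ℕ} (η : Form n M k) {p q : M} {y : EuclideanSpace ℝ (Fin n)}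
    (hy : y ∈ (extChartAt (𝓡 n) p).target)
    (hq : (extChartAt (𝓡 n) p).symm y ∈ (extChartAt (𝓡 n) q).source) :
    inChart η p y =
      (inChart η q (transition p q y)).compContinuousLinearMap (fderiv ℝ (transition p q) y) := by
  rw [transition, inChart_apply η hq]
  refine ContinuousAlternatingMap.ext fun v => ?_
  change η _ (fun i => chartSymmDeriv p y (v i)) =
    η _ fun i => chartInv q _ (fderiv ℝ (transition p q) y (v i))
  congr 1
  funext i
  rw [fderiv_transition hy hq, chartInv_chartDeriv hq]

/-- The exterior derivative may be computed in any chart. -/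
theorem inChart_extD {k : ℕ} {η : Form n M k} (hη : SmoothForm η) {p x : M}
    (hp : x ∈ (extChartAt (𝓡 n) p).source) :
    inChart (extD η) p (extChartAt (𝓡 n) p x) =
      extDeriv (inChart η p) (extChartAt (𝓡 n) p x) := by
  have hx := mem_extChartAt_source (I := 𝓡 n) x
  have ht : transition p x (extChartAt (𝓡 n) p x) = extChartAt (𝓡 n) x x := by
    rw [transition, (extChartAt (𝓡 n) p).left_inv hp]
  have hev : inChart η p =ᶠ[nhds (extChartAt (𝓡 n) p x)] fun y =>
      (inChart η x (transition p x y)).compContinuousLinearMap (fderiv ℝ (transition p x) y) :=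
    (transition_eventually hp hx).mono fun y hy => inChart_transition η hy.1 hy.2
  have hd : DifferentiableAt ℝ (inChart η x) (transition p x (extChartAt (𝓡 n) p x)) := by
    rw [ht]
    exact differentiableAt_of_contDiffOn (isOpen_extChartAt_target x) (hη x)
      ((extChartAt (𝓡 n) x).map_source hx)
  -- `extD` at x is computed in the chart around x. Near x the form in the chart around p is the
  -- pullback of it under the transition map, and d commutes with pullback.
  rw [hev.extDeriv_eq, extDeriv_pullback hd (contDiffAt_transition hp hx)
    (by rw [minSmoothness_of_isRCLikeNormedField]; exact ENat.LEInfty.out), ht, inChart_apply _ hp]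
  refine ContinuousAlternatingMap.ext fun v => ?_
  change extDeriv (inChart η x) _ (fun i => chartDeriv x x (chartInv p x (v i))) =
    extDeriv (inChart η x) _ fun i => fderiv ℝ (transition p x) _ (v i)
  congr 1
  funext i
  have hy := (extChartAt (𝓡 n) p).map_source hp
  have h := fderiv_transition hy (by rwa [(extChartAt (𝓡 n) p).left_inv hp]) (v i)
  rw [h, chartSymmDeriv_eq hy, (extChartAt (𝓡 n) p).left_inv hp]

end Charts

/-! ### Pullback of contractions by linear maps -/

section Pullback

variable {V W : Type*} [AddCommGroup V] [Module ℝ V] [AddCommGroup W] [Module ℝ W]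

theorem toDegree_compLinearMap (A : W →ₗ[ℝ] V) {k m : ℕ} (η : Alt V k) :
    toDegree m (η.compLinearMap A) = (toDegree m η).compLinearMap A := by
  by_cases h : k = m
  · subst h
    rw [toDegree_self, toDegree_self]
  · rw [toDegree_of_ne h, toDegree_of_ne h]
    rfl

/-- B sends the values of K into W, and the pulled-back α applies A to them again; A ∘ B = id makes
the two cancel in every summand. -/
theorem contract_compLinearMap {A : W →ₗ[ℝ] V} {B : V →ₗ[ℝ] W} (h : ∀ x, A (B x) = x) {k l : ℕ}
    (K : V [⋀^Fin k]→ₗ[ℝ] V) (α : Alt V l) :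
    contract (B.compAlternatingMap (K.compLinearMap A)) (α.compLinearMap A) =
      (contract K α).compLinearMap A := by
  rcases l with _ | l
  · rfl
  ext v
  have hne : ((k.factorial : ℝ) * (l.factorial : ℝ)) ≠ 0 := by positivity
  refine smul_right_injective _ hne ?_
  have h1 := factorial_smul_wedgeWith
    (LinearMap.id : (W →ₗ[ℝ] ℝ) →ₗ[ℝ] (W →ₗ[ℝ] ℝ)).flip
    (B.compAlternatingMap (K.compLinearMap A)) (curryFirst (α.compLinearMap A)) v
  have h2 := factorial_smul_wedgeWith
    (LinearMap.id : (V →ₗ[ℝ] ℝ) →ₗ[ℝ] (V →ₗ[ℝ] ℝ)).flip K (curryFirst α) (fun i => A (v i))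
  refine h1.trans (Eq.trans ?_ h2.symm)
  refine Finset.sum_congr rfl fun σ _ => ?_
  congr 1
  change α (fun i => A _) = α _
  congr 1
  funext i
  refine Fin.cases ?_ (fun i => ?_) i
  · exact h _
  · rfl

theorem oneForm_compLinearMap (A : W →ₗ[ℝ] V) (φ : V →ₗ[ℝ] ℝ) :
    (oneForm φ).compLinearMap A = oneForm (φ ∘ₗ A) := by
  ext v
  rfl

theorem contractExt_oneForm (x : V) (φ : V →ₗ[ℝ] ℝ) :
    contractExt x (emb (oneForm φ)) = φ x • 1 := by
  have h : contractExt x (1 : Ext V) = 0 := by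
    have h1 : (1 : Ext V) = emb (AlternatingMap.constOfIsEmpty ℝ V (Fin 0) (1 : ℝ)) := rfl
    rw [h1, contractExt_emb]
    exact map_zero _
  have := contractExt_oneForm_mul x φ 1
  rwa [mul_one, h, mul_zero, sub_zero] at this

end Pullback

/-! ### The action on functions -/

section FlatFunctions

variable {n : ℕ}

theorem embC_contractC_oneForm {k : ℕ} (K : CVAlt n k) (φ : Eu n →ₗ[ℝ] ℝ) :
    embC (contractC n k 1 K (toCont (oneForm φ))) = embC (compC φ k K) := by
  rw [embC_contractC (stdB n), compC_eq_sum, map_sum]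
  refine Finset.sum_congr rfl fun i _ => ?_
  rw [embC_toCont, contractExt_oneForm, mul_smul_comm, mul_one, map_smul]

/-- Since ι_K f = 0, only ι_K df = df ∘ K remains. Hence functions with arbitrary differential at a
point detect K there. -/
theorem flatLie_function {k : ℕ} (K : Eu n → CVAlt n k) {β : Eu n → CAlt n 0} {y : Eu n}
    {φ : Eu n →ₗ[ℝ] ℝ} (h : extDeriv β y = toCont (oneForm φ)) :
    flatLie K β y = compC φ k (K y) := by
  apply embC_injective
  rw [embC_flatLie_eq, extDeriv_contractC_zero_degree, h, embC_contractC_oneForm]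
  simp

theorem ext_compC {k : ℕ} {K K' : CVAlt n k} (h : ∀ φ, compC φ k K = compC φ k K') : K = K' := by
  refine ContinuousAlternatingMap.ext fun v => (stdB n).ext_elem fun i => ?_
  exact congrArg (fun η => η v) (h ((stdB n).coord i))

theorem flatLie_congr {k l : ℕ} {K K' : Eu n → CVAlt n k} {α α' : Eu n → CAlt n l} {y : Eu n}
    (hK : K =ᶠ[nhds y] K') (hα : α =ᶠ[nhds y] α') : flatLie K α y = flatLie K' α' y := by
  have h : (fun z => contractC n k l (K z) (α z)) =ᶠ[nhds y]
      fun z => contractC n k l (K' z) (α' z) := by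
    filter_upwards [hK, hα] with z h1 h2
    rw [h1, h2]
  rw [flatLie, flatLie, h.extDeriv_eq, hα.extDeriv_eq, hK.eq_of_nhds]

end FlatFunctions

/-! ### Nijenhuis-Lie derivatives on the manifold -/

section Manifold

variable {n : ℕ} {M : Type*} [TopologicalSpace M] [ChartedSpace (EuclideanSpace ℝ (Fin n)) M]

theorem inChart_toDegree {k : ℕ} (m : ℕ) (η : Form n M k) (p : M) (y : Eu n) :
    inChart (fun q => toDegree m (η q)) p y = toDegreeC n m k (inChart η p y) :=
  congrArg toCont (toDegree_compLinearMap _ _).symm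

variable [IsManifold (𝓡 n) ∞ M]

attribute [local instance] isManifold_one

theorem inChart_iota {k l : ℕ} (K : VForm n M k) (α : Form n M l) {p x : M}
    (hp : x ∈ (extChartAt (𝓡 n) p).source) :
    inChart (iota K α) p (extChartAt (𝓡 n) p x) =
      contractC n k l (inChartV K p (extChartAt (𝓡 n) p x))
        (inChart α p (extChartAt (𝓡 n) p x)) := by
  rw [inChart_apply _ hp, inChart_apply _ hp, inChartV_apply _ hp]
  exact congrArg toCont (contract_compLinearMap (chartInv_chartDeriv hp) (K x) (α x)).symm

theorem SmoothForm.iota {k l : ℕ} {K : VForm n M k} {α : Form n M l} (hK : SmoothVForm K)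
    (hα : SmoothForm α) : SmoothForm (iota K α) := fun p =>
  (contDiffOn_bilin (contractC n k l) (hK p) (hα p)).congr
    (inChart_congr fun _ hx => inChart_iota K α hx)

theorem SmoothForm.extD {k : ℕ} {α : Form n M k} (hα : SmoothForm α) : SmoothForm (extD α) :=
  fun p => (contDiffOn_extDeriv (isOpen_extChartAt_target p) (hα p)).congr
    (inChart_congr fun _ hx => inChart_extD hα hx)

/-- The Nijenhuis-Lie derivative in a chart. -/
theorem inChart_nijLie {k l : ℕ} {K : VForm n M k} {α : Form n M l} (hK : SmoothVForm K)
    (hα : SmoothForm α) {p x : M} (hp : x ∈ (extChartAt (𝓡 n) p).source) :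
    inChart (nijLie K α) p (extChartAt (𝓡 n) p x) =
      flatLie (inChartV K p) (inChart α p) (extChartAt (𝓡 n) p x) := by
  have h : inChart (FN.iota K α) p =ᶠ[nhds (extChartAt (𝓡 n) p x)]
      fun z => contractC n k l (inChartV K p z) (inChart α p z) :=
    (inChart_congr fun _ hx => inChart_iota K α hx).eventuallyEq_of_mem
      ((isOpen_extChartAt_target p).mem_nhds ((extChartAt (𝓡 n) p).map_source hp))
  rw [flatLie, ← h.extDeriv_eq, ← inChart_extD hα hp, ← inChart_extD (hα.iota hK) hp,
    ← inChart_iota _ _ hp, ← inChart_toDegree, ← inChart_toDegree]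
  rfl

theorem SmoothForm.nijLie {k l : ℕ} {K : VForm n M k} {α : Form n M l} (hK : SmoothVForm K)
    (hα : SmoothForm α) : SmoothForm (nijLie K α) := fun p =>
  (contDiffOn_flatLie (isOpen_extChartAt_target p) (hK p) (hα p)).congr
    (inChart_congr fun _ hx => inChart_nijLie hK hα hx)

/-- The graded commutator of Nijenhuis-Lie derivatives. -/
noncomputable def lieComm {k₁ k₂ l : ℕ} (K₁ : VForm n M k₁) (K₂ : VForm n M k₂)
    (α : Form n M l) : Form n M (k₁ + k₂ + l) := fun p =>
  toDegree (k₁ + k₂ + l) (nijLie K₁ (nijLie K₂ α) p)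
    - (-1 : ℝ) ^ (k₁ * k₂) • toDegree (k₁ + k₂ + l) (nijLie K₂ (nijLie K₁ α) p)

/-- The Frölicher-Nijenhuis bracket computed in the chart around `p`. -/
noncomputable def chartBracket {k₁ k₂ : ℕ} (K₁ : VForm n M k₁) (K₂ : VForm n M k₂) (p : M) :
    Eu n → CVAlt n (k₁ + k₂) :=
  flatBracket (inChartV K₁ p) (inChartV K₂ p)

/-- The left side knows nothing of the chart, the right side is local. Comparing the two gives both
existence and uniqueness of the bracket. -/
theorem inChart_lieComm {k₁ k₂ l : ℕ} {K₁ : VForm n M k₁} {K₂ : VForm n M k₂} {α : Form n M l}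
    (hK₁ : SmoothVForm K₁) (hK₂ : SmoothVForm K₂) (hα : SmoothForm α) {p x : M}
    (hp : x ∈ (extChartAt (𝓡 n) p).source) :
    inChart (lieComm K₁ K₂ α) p (extChartAt (𝓡 n) p x) =
      flatLie (chartBracket K₁ K₂ p) (inChart α p) (extChartAt (𝓡 n) p x) := by
  have hU := isOpen_extChartAt_target (I := 𝓡 n) p
  have hy := (extChartAt (𝓡 n) p).map_source hp
  have hc : ∀ {r s : ℕ} {K : VForm n M r} {K' : VForm n M s}, SmoothVForm K → SmoothVForm K' →
      flatLie (inChartV K p) (flatLie (inChartV K' p) (inChart α p)) (extChartAt (𝓡 n) p x) =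
        inChart (nijLie K (nijLie K' α)) p (extChartAt (𝓡 n) p x) := fun hK hK' => by
    rw [inChart_nijLie hK (hα.nijLie hK') hp]
    exact flatLie_congr Filter.EventuallyEq.rfl
      ((inChart_congr fun _ hx => inChart_nijLie hK' hα hx).symm.eventuallyEq_of_mem
        (hU.mem_nhds hy))
  apply embC_injective
  rw [chartBracket, embC_flatLie_flatBracket hU (hK₁ p) (hK₂ p) (hα p) hy, hc hK₁ hK₂, hc hK₂ hK₁,
    ← embC_toDegreeC (m := k₁ + k₂ + l) (by omega) (inChart (nijLie K₁ _) p _),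
    ← embC_toDegreeC (m := k₁ + k₂ + l) (by omega) (inChart (nijLie K₂ _) p _),
    ← inChart_toDegree, ← inChart_toDegree, ← map_smul, ← map_sub]
  rfl

end Manifold

/-! ### Functions with prescribed differential -/

section Functions

variable {n : ℕ} {M : Type*} [TopologicalSpace M] [ChartedSpace (EuclideanSpace ℝ (Fin n)) M]

/-- A function on the model space as a form of degree zero. -/
noncomputable def constC (n : ℕ) : ℝ →L[ℝ] CAlt n 0 :=
  LinearMap.toContinuousLinearMap
    { toFun := fun c => toCont (AlternatingMap.constOfIsEmpty ℝ (Eu n) (Fin 0) c)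
      map_add' := fun _ _ => rfl
      map_smul' := fun _ _ => rfl }

theorem extDeriv_constC (L : Eu n →L[ℝ] ℝ) (y : Eu n) :
    extDeriv (fun z => constC n (L z)) y = toCont (oneForm L.toLinearMap) := by
  refine ContinuousAlternatingMap.ext fun v => ?_
  have hd : DifferentiableAt ℝ (fun z => constC n (L z)) y :=
    (constC n).differentiableAt.comp y L.differentiableAt
  rw [extDeriv_apply hd]
  simp only [Fin.sum_univ_succ, Finset.univ_eq_empty, Finset.sum_empty, add_zero]
  change (-1) ^ 0 • fderiv ℝ (fun z => L z) y (v 0) = L (v 0)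
  rw [pow_zero, one_smul]
  exact congrArg (fun f => f (v 0)) L.fderiv

/-- A function as a form of degree zero. -/
noncomputable def zeroForm (n : ℕ) {M : Type*} [TopologicalSpace M]
    [ChartedSpace (EuclideanSpace ℝ (Fin n)) M] (g : M → ℝ) : Form n M 0 := fun p =>
  AlternatingMap.constOfIsEmpty ℝ _ (Fin 0) (g p)

theorem inChart_zeroForm (g : M → ℝ) (p : M) (y : Eu n) :
    inChart (zeroForm n g) p y = constC n (g ((extChartAt (𝓡 n) p).symm y)) := rfl

variable [IsManifold (𝓡 n) ∞ M]

attribute [local instance] isManifold_one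

theorem smoothForm_zeroForm {g : M → ℝ} (hg : ContMDiff (𝓡 n) 𝓘(ℝ, ℝ) ∞ g) :
    SmoothForm (zeroForm n g) := fun p =>
  contDiffOn_lin (constC n) (contMDiffOn_iff_contDiffOn.mp
    (hg.comp_contMDiffOn (contMDiffOn_extChartAt_symm (n := ∞) p)))

theorem extDeriv_inChart_of_extD {f : Form n M 0} (hf : SmoothForm f) {p x : M}
    (hp : x ∈ (extChartAt (𝓡 n) p).source) {ψ : TangentSpace (𝓡 n) x →ₗ[ℝ] ℝ}
    (h : extD f x = oneForm ψ) :
    extDeriv (inChart f p) (extChartAt (𝓡 n) p x) = toCont (oneForm (ψ ∘ₗ chartInv p x)) := by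
  rw [← inChart_extD hf hp, inChart_apply _ hp, h, oneForm_compLinearMap]

/-- The value at `x` of the Frölicher-Nijenhuis bracket, computed in the chart around `p`. -/
noncomputable def bracketAt {k₁ k₂ : ℕ} (K₁ : VForm n M k₁) (K₂ : VForm n M k₂) (p x : M) :
    TangentSpace (𝓡 n) x [⋀^Fin (k₁ + k₂)]→ₗ[ℝ] TangentSpace (𝓡 n) x :=
  (chartInv p x).compAlternatingMap
    ((chartBracket K₁ K₂ p (extChartAt (𝓡 n) p x)).toAlternatingMap.compLinearMap (chartDeriv p x))

/-- The left side does not involve p, and ψ can be any covector, so this pins down the local bracket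
independently of the chart. -/
theorem lieComm_function {k₁ k₂ : ℕ} {K₁ : VForm n M k₁} {K₂ : VForm n M k₂}
    (hK₁ : SmoothVForm K₁) (hK₂ : SmoothVForm K₂) {f : Form n M 0} (hf : SmoothForm f) {p x : M}
    (hp : x ∈ (extChartAt (𝓡 n) p).source) {ψ : TangentSpace (𝓡 n) x →ₗ[ℝ] ℝ}
    (h : extD f x = oneForm ψ) : lieComm K₁ K₂ f x = comp ψ (bracketAt K₁ K₂ p x) := by
  rw [eq_inChart (lieComm K₁ K₂ f) hp, inChart_lieComm hK₁ hK₂ hf hp,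
    flatLie_function _ (extDeriv_inChart_of_extD hf hp h)]
  rfl

/-- Every covector is the differential of a smooth function. -/
theorem exists_extD_eq [T2Space M] (x : M) (ψ : TangentSpace (𝓡 n) x →ₗ[ℝ] ℝ) :
    ∃ f : Form n M 0, SmoothForm f ∧ extD f x = oneForm ψ := by
  -- The function is linear in the chart around x, cut off by a bump function; Hausdorffness makes
  -- the product globally smooth. The bump function is 1 near x, so the differential there is
  -- unaffected.
  obtain ⟨b⟩ : Nonempty (SmoothBumpFunction (𝓡 n) x) := inferInstance
  let L : Eu n →L[ℝ] ℝ := LinearMap.toContinuousLinearMap (ψ ∘ₗ chartInv x x)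
  have hL : ContMDiffOn (𝓡 n) 𝓘(ℝ, ℝ) ∞ (fun z : M => L (extChartAt (𝓡 n) x z))
      (chartAt (EuclideanSpace ℝ (Fin n)) x).source :=
    L.contDiff.contMDiff.comp_contMDiffOn (contMDiffOn_extChartAt (n := ∞))
  have hx := mem_extChartAt_source (I := 𝓡 n) x
  have hy := (extChartAt (𝓡 n) x).map_source hx
  refine ⟨zeroForm n fun z => b z • L (extChartAt (𝓡 n) x z),
    smoothForm_zeroForm (b.contMDiff_smul hL), ?_⟩
  have hev : inChart (zeroForm n fun z => b z • L (extChartAt (𝓡 n) x z)) x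
      =ᶠ[nhds (extChartAt (𝓡 n) x x)] fun y => constC n (L y) := by
    have hc : Filter.Tendsto (extChartAt (𝓡 n) x).symm (nhds (extChartAt (𝓡 n) x x)) (nhds x) := by
      have := continuousAt_extChartAt_symm (I := 𝓡 n) x
      rwa [ContinuousAt, (extChartAt (𝓡 n) x).left_inv hx] at this
    filter_upwards [hc.eventually b.eventuallyEq_one,
      (isOpen_extChartAt_target x).eventually_mem hy] with y h1 h2
    rw [inChart_zeroForm, (extChartAt (𝓡 n) x).right_inv h2, h1]
    simp
  rw [extD, hev.extDeriv_eq, extDeriv_constC]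
  ext v
  change ψ (chartInv x x (chartDeriv x x (v 0))) = ψ (v 0)
  rw [chartInv_chartDeriv hx]

end Functions

/-! ### Existence and uniqueness of the bracket -/

section Bracket

variable {n : ℕ} {M : Type*} [TopologicalSpace M] [T2Space M]
  [ChartedSpace (EuclideanSpace ℝ (Fin n)) M] [IsManifold (𝓡 n) ∞ M]

attribute [local instance] isManifold_one

/-- Both forms act in the same way on functions, and any covector φ in the chart occurs as a
differential at the given point; hence all components agree. -/
theorem IsFNBracket.inChartV_eq {k₁ k₂ : ℕ} {K₁ : VForm n M k₁} {K₂ : VForm n M k₂}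
    {K : VForm n M (k₁ + k₂)} (hK₁ : SmoothVForm K₁) (hK₂ : SmoothVForm K₂)
    (hK : IsFNBracket K₁ K₂ K) {p x : M} (hp : x ∈ (extChartAt (𝓡 n) p).source) :
    inChartV K p (extChartAt (𝓡 n) p x) = chartBracket K₁ K₂ p (extChartAt (𝓡 n) p x) := by
  refine ext_compC fun φ => ?_
  obtain ⟨f, hf, hfx⟩ := exists_extD_eq x (φ ∘ₗ chartDeriv p x)
  have hφ : (φ ∘ₗ chartDeriv p x) ∘ₗ chartInv p x = φ := by
    ext1 v
    exact congrArg φ (chartDeriv_chartInv hp v)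
  have he := extDeriv_inChart_of_extD hf hp hfx
  rw [hφ] at he
  have h : nijLie K f = lieComm K₁ K₂ f := funext fun q => hK.2 0 f hf q
  rw [← flatLie_function _ he, ← flatLie_function _ he, ← inChart_lieComm hK₁ hK₂ hf hp, ← h,
    inChart_nijLie hK.1 hf hp]

theorem IsFNBracket.unique {k₁ k₂ : ℕ} {K₁ : VForm n M k₁} {K₂ : VForm n M k₂}
    {K K' : VForm n M (k₁ + k₂)} (hK₁ : SmoothVForm K₁) (hK₂ : SmoothVForm K₂)
    (hK : IsFNBracket K₁ K₂ K) (hK' : IsFNBracket K₁ K₂ K') : K = K' := by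
  funext x
  have hx := mem_extChartAt_source (I := 𝓡 n) x
  rw [eq_inChartV K hx, eq_inChartV K' hx, hK.inChartV_eq hK₁ hK₂ hx, hK'.inChartV_eq hK₁ hK₂ hx]

/-- Every component of either side is the commutator applied to one and the same function, hence
independent of the chart. -/
theorem bracketAt_eq {k₁ k₂ : ℕ} {K₁ : VForm n M k₁} {K₂ : VForm n M k₂}
    (hK₁ : SmoothVForm K₁) (hK₂ : SmoothVForm K₂) {p q x : M}
    (hp : x ∈ (extChartAt (𝓡 n) p).source) (hq : x ∈ (extChartAt (𝓡 n) q).source) :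
    bracketAt K₁ K₂ p x = bracketAt K₁ K₂ q x := by
  ext v
  have h : ∀ i, (stdB n).coord i (chartDeriv p x (bracketAt K₁ K₂ p x v)) =
      (stdB n).coord i (chartDeriv p x (bracketAt K₁ K₂ q x v)) := fun i => by
    obtain ⟨f, hf, hfx⟩ := exists_extD_eq x ((stdB n).coord i ∘ₗ chartDeriv p x)
    have := (lieComm_function hK₁ hK₂ hf hp hfx).symm.trans (lieComm_function hK₁ hK₂ hf hq hfx)
    exact congrArg (fun η => η v) this
  have h2 := (stdB n).ext_elem h
  rw [← chartInv_chartDeriv hp (bracketAt K₁ K₂ p x v), h2, chartInv_chartDeriv hp]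

theorem inChartV_bracketAt {k₁ k₂ : ℕ} {K₁ : VForm n M k₁} {K₂ : VForm n M k₂}
    (hK₁ : SmoothVForm K₁) (hK₂ : SmoothVForm K₂) (p : M) :
    Set.EqOn (inChartV (fun x => bracketAt K₁ K₂ x x) p) (chartBracket K₁ K₂ p)
      (extChartAt (𝓡 n) p).target := by
  intro y hy
  have hs := (extChartAt (𝓡 n) p).map_target hy
  have h := inChartV_apply (fun x => bracketAt K₁ K₂ x x) hs
  rw [(extChartAt (𝓡 n) p).right_inv hy, bracketAt_eq hK₁ hK₂ (mem_extChartAt_source _) hs] at h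
  rw [h]
  refine ContinuousAlternatingMap.ext fun v => ?_
  change chartDeriv p _ (chartInv p _ (chartBracket K₁ K₂ p (extChartAt (𝓡 n) p _)
    fun i => chartDeriv p _ (chartInv p _ (v i)))) = _
  simp only [chartDeriv_chartInv hs]
  rw [(extChartAt (𝓡 n) p).right_inv hy]

/-- The value at each x is taken in the chart around x. By chart independence the field agrees with
the local bracket throughout any chart, so smoothness and the commutator identity are local
statements already proved. -/
theorem isFNBracket_bracketAt {k₁ k₂ : ℕ} {K₁ : VForm n M k₁} {K₂ : VForm n M k₂}
    (hK₁ : SmoothVForm K₁) (hK₂ : SmoothVForm K₂) :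
    IsFNBracket K₁ K₂ fun x => bracketAt K₁ K₂ x x := by
  have hs : SmoothVForm fun x => bracketAt K₁ K₂ x x := fun p =>
    (contDiffOn_flatBracket (isOpen_extChartAt_target p) (hK₁ p) (hK₂ p)).congr
      (inChartV_bracketAt hK₁ hK₂ p)
  refine ⟨hs, fun l α hα x => ?_⟩
  change _ = lieComm K₁ K₂ α x
  have hx := mem_extChartAt_source (I := 𝓡 n) x
  rw [eq_inChart (nijLie _ α) hx, eq_inChart (lieComm K₁ K₂ α) hx, inChart_nijLie hs hα hx,
    inChart_lieComm hK₁ hK₂ hα hx]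
  congr 2
  exact flatLie_congr ((inChartV_bracketAt hK₁ hK₂ x).eventuallyEq_of_mem
    ((isOpen_extChartAt_target x).mem_nhds ((extChartAt (𝓡 n) x).map_source hx)))
    Filter.EventuallyEq.rfl

theorem existsUnique_isFNBracket {k₁ k₂ : ℕ} {K₁ : VForm n M k₁} {K₂ : VForm n M k₂}
    (hK₁ : SmoothVForm K₁) (hK₂ : SmoothVForm K₂) : ∃! K, IsFNBracket K₁ K₂ K :=
  ⟨_, isFNBracket_bracketAt hK₁ hK₂, fun _ h => h.unique hK₁ hK₂ (isFNBracket_bracketAt hK₁ hK₂)⟩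

theorem inChartV_fnBracket {k₁ k₂ : ℕ} {K₁ : VForm n M k₁} {K₂ : VForm n M k₂}
    (hK₁ : SmoothVForm K₁) (hK₂ : SmoothVForm K₂) {p x : M}
    (hp : x ∈ (extChartAt (𝓡 n) p).source) :
    inChartV (fnBracket K₁ K₂) p (extChartAt (𝓡 n) p x) =
      chartBracket K₁ K₂ p (extChartAt (𝓡 n) p x) := by
  have h : ∃ K, IsFNBracket K₁ K₂ K := (existsUnique_isFNBracket hK₁ hK₂).exists
  rw [fnBracket, dif_pos h]
  exact h.choose_spec.inChartV_eq hK₁ hK₂ hp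

end Bracket

/-! ### Connection coefficients and torsion -/

section Connection

variable {n : ℕ} {M : Type*} [TopologicalSpace M] [ChartedSpace (EuclideanSpace ℝ (Fin n)) M]
  [IsManifold (𝓡 n) ∞ M]

attribute [local instance] isManifold_one

/-- On each fibre the tangent trivialization around p is the differential of the chart, so the
extension has constant components in the chart. Thus `connCoeff` consists of the Christoffel symbols
at p. -/
theorem extend_eq {p x : M} (hx : x ∈ (extChartAt (𝓡 n) p).source) (w : TangentSpace (𝓡 n) p) :
    (FiberBundle.extend (EuclideanSpace ℝ (Fin n)) w x : TangentSpace (𝓡 n) x) =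
      chartInv p x (chartDeriv p p w) := by
  set t := trivializationAt (EuclideanSpace ℝ (Fin n)) (TangentSpace (𝓡 n) : M → Type _) p
  have hb : ∀ {y : M}, y ∈ (extChartAt (𝓡 n) p).source → y ∈ t.baseSet := fun hy => by
    rwa [extChartAt_source] at hy
  have h1 : ∀ {y : M} (_ : y ∈ (extChartAt (𝓡 n) p).source) (v : TangentSpace (𝓡 n) y),
      chartDeriv p y v = (t ⟨y, v⟩).2 := fun {y} hy v => by
    have h := TangentBundle.continuousLinearMapAt_trivializationAt (I := 𝓡 n) (x₀ := p) (x := y)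
      (by rwa [extChartAt_source] at hy)
    have h2 := congrArg (fun f => f v) h
    refine Eq.trans h2.symm ?_
    exact congrFun (t.coe_linearMapAt_of_mem (R := ℝ) (hb hy)) v
  have hp := mem_extChartAt_source (I := 𝓡 n) p
  rw [← chartInv_chartDeriv hx (FiberBundle.extend _ w x), h1 hx, h1 hp]
  congr 1
  have h := congrArg Prod.snd (t.apply_mk_symm (hb hx) (t ⟨p, w⟩).2)
  exact h

theorem contMDiffOn_extend (p : M) (w : TangentSpace (𝓡 n) p) :
    ContMDiffOn (𝓡 n) ((𝓡 n).prod 𝓘(ℝ, EuclideanSpace ℝ (Fin n))) ∞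
      (fun x : M => (⟨x, FiberBundle.extend (EuclideanSpace ℝ (Fin n)) w x⟩ :
        TotalSpace (EuclideanSpace ℝ (Fin n)) (TangentSpace (𝓡 n) : M → Type _)))
      (extChartAt (𝓡 n) p).source := by
  set t := trivializationAt (EuclideanSpace ℝ (Fin n)) (TangentSpace (𝓡 n) : M → Type _) p
  intro x hx
  have hb : x ∈ t.baseSet := by rwa [extChartAt_source] at hx
  rw [t.contMDiffWithinAt_section _ hb]
  refine contMDiffWithinAt_const.congr_of_mem (f := fun _ => (t ⟨p, w⟩).2) (fun y hy => ?_) hx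
  have hb : y ∈ t.baseSet := by rwa [extChartAt_source] at hy
  have h := congrArg Prod.snd (t.apply_mk_symm hb (t ⟨p, w⟩).2)
  exact h

/-- In the chart both fields are constant near p, and constant fields commute. -/
theorem mlieBracket_extend (p : M) (v w : TangentSpace (𝓡 n) p) :
    VectorField.mlieBracket (𝓡 n)
      (FiberBundle.extend (EuclideanSpace ℝ (Fin n)) v : ∀ x : M, TangentSpace (𝓡 n) x)
      (FiberBundle.extend (EuclideanSpace ℝ (Fin n)) w : ∀ x : M, TangentSpace (𝓡 n) x) p = 0 := by
  have hp := mem_extChartAt_source (I := 𝓡 n) p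
  have h : ∀ u : TangentSpace (𝓡 n) p,
      VectorField.mpullbackWithin 𝓘(ℝ, EuclideanSpace ℝ (Fin n)) (𝓡 n) (extChartAt (𝓡 n) p).symm
        (FiberBundle.extend (EuclideanSpace ℝ (Fin n)) u : ∀ x : M, TangentSpace (𝓡 n) x)
        (Set.range (𝓡 n)) =ᶠ[nhds (extChartAt (𝓡 n) p p)] fun _ => chartDeriv p p u := fun u => by
    filter_upwards [(isOpen_extChartAt_target p).eventually_mem
      ((extChartAt (𝓡 n) p).map_source hp)] with y hy
    have hs := (extChartAt (𝓡 n) p).map_target hy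
    rw [VectorField.mpullbackWithin_apply, extend_eq hs, ← chartSymmDeriv_eq hy]
    have hi := isInvertible_mfderivWithin_extChartAt_symm (I := 𝓡 n) hy
    have := hi.inverse_apply_self (chartDeriv p p u)
    simp only [ModelWithCorners.range_eq_univ, mfderivWithin_univ] at this ⊢
    exact this
  rw [VectorField.mlieBracket, VectorField.mlieBracketWithin_apply]
  have h2 := Filter.EventuallyEq.lieBracket_vectorField_eq (𝕜 := ℝ) (h v) (h w)
  have h3 : VectorField.lieBracket ℝ (fun _ : Eu n => chartDeriv p p v)
      (fun _ : Eu n => chartDeriv p p w) (extChartAt (𝓡 n) p p) = 0 := by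
    simp [VectorField.lieBracket]
  have h4 : ∀ X Y : Eu n → Eu n, VectorField.lieBracketWithin ℝ X Y
      ((extChartAt (𝓡 n) p).symm ⁻¹' Set.univ ∩ Set.range (𝓡 n)) = VectorField.lieBracket ℝ X Y :=
    fun X Y => by
      rw [Set.preimage_univ, ModelWithCorners.range_eq_univ, Set.univ_inter,
        VectorField.lieBracketWithin_univ]
  exact (congrArg _ ((congrFun (h4 _ _) _).trans (h2.trans h3))).trans (map_zero _)

/-- The torsion is ∇_v W - ∇_w V minus the Lie bracket of the two extensions, and the bracket
vanishes. -/
theorem connCoeff_symm {D : CovariantDerivative (𝓡 n) (EuclideanSpace ℝ (Fin n))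
    (TangentSpace (𝓡 n) : M → Type _)} (hD : D.torsion = 0) (p : M)
    (v w : TangentSpace (𝓡 n) p) : connCoeff D p v w = connCoeff D p w v := by
  have h := D.torsion_apply_eq_extend v w
  rw [mlieBracket_extend, hD, FiberBundle.extend_apply_self, FiberBundle.extend_apply_self,
    sub_zero] at h
  exact sub_eq_zero.mp h.symm

end Connection

/-! ### The metric in a chart -/

section Metric

theorem hasFDerivAt_apply_apply {G X Y Z : Type*} [NormedAddCommGroup G] [NormedSpace ℝ G]
    [NormedAddCommGroup X] [NormedSpace ℝ X] [NormedAddCommGroup Y] [NormedSpace ℝ Y]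
    [NormedAddCommGroup Z] [NormedSpace ℝ Z] {f : G → X →L[ℝ] Y →L[ℝ] Z} {y : G}
    (hf : DifferentiableAt ℝ f y) (a : X) (b : Y) :
    HasFDerivAt (fun z => f z a b) (((fderiv ℝ f y).flip a).flip b) y := by
  have h1 := (hf.hasFDerivAt.clm_apply (hasFDerivAt_const a y)).clm_apply (hasFDerivAt_const b y)
  convert h1 using 1
  ext v
  simp

variable {n : ℕ} {M : Type*} [TopologicalSpace M] [ChartedSpace (EuclideanSpace ℝ (Fin n)) M]
  [RiemannianBundle (TangentSpace (𝓡 n) : M → Type _)]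

/-- The metric in the chart around `p`. -/
noncomputable def gram (p : M) (y : Eu n) : Eu n →L[ℝ] Eu n →L[ℝ] ℝ :=
  LinearMap.toContinuousBilinearMap ((innerₗ (TangentSpace (𝓡 n)
    ((extChartAt (𝓡 n) p).symm y))).compl₁₂ (chartInv p _) (chartInv p _))

theorem gram_apply {p x : M} (hx : x ∈ (extChartAt (𝓡 n) p).source) (a b : Eu n) :
    gram p (extChartAt (𝓡 n) p x) a b = inner ℝ (chartInv p x a) (chartInv p x b) := by
  change inner ℝ (chartInv p ((extChartAt (𝓡 n) p).symm _) a) (chartInv p _ b) = _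
  rw [(extChartAt (𝓡 n) p).left_inv hx]

variable [IsManifold (𝓡 n) ∞ M]

attribute [local instance] isManifold_one

variable [IsContMDiffRiemannianBundle (𝓡 n) ∞ (EuclideanSpace ℝ (Fin n))
    (TangentSpace (𝓡 n) : M → Type _)]

/-- The entries are inner products of fields with constant components, which are smooth on the chart
domain, so smoothness of the Riemannian bundle applies to them. -/
theorem contDiffOn_gram (p : M) : ContDiffOn ℝ ∞ (gram p) (extChartAt (𝓡 n) p).target := by
  refine contDiffOn_clm_apply.2 fun a => contDiffOn_clm_apply.2 fun b => ?_
  have hp := mem_extChartAt_source (I := 𝓡 n) p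
  have h := (contMDiffOn_extend p (chartInv p p a)).inner_bundle
    (contMDiffOn_extend p (chartInv p p b))
  have h2 := (h.comp (contMDiffOn_extChartAt_symm (n := ∞) p)
    fun y hy => (extChartAt (𝓡 n) p).map_target hy)
  refine (contMDiffOn_iff_contDiffOn.mp h2).congr fun y hy => ?_
  have hs := (extChartAt (𝓡 n) p).map_target hy
  change inner ℝ (chartInv p _ a) (chartInv p _ b) =
    inner ℝ (FiberBundle.extend _ (chartInv p p a) _ : TangentSpace (𝓡 n) _)
      (FiberBundle.extend _ (chartInv p p b) _)
  rw [extend_eq hs, extend_eq hs, chartDeriv_chartInv hp, chartDeriv_chartInv hp]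

/-- In a chart, a metric connection satisfies `∂_v g(a, b) = g(Γ_v a, b) + g(a, Γ_v b)`. -/
theorem fderiv_gram {D : CovariantDerivative (𝓡 n) (EuclideanSpace ℝ (Fin n))
    (TangentSpace (𝓡 n) : M → Type _)} (hD : D.IsMetricCompatible) (p : M)
    (v w w' : TangentSpace (𝓡 n) p) :
    fderiv ℝ (gram p) (extChartAt (𝓡 n) p p) (chartDeriv p p v) (chartDeriv p p w)
      (chartDeriv p p w') =
      inner ℝ (connCoeff D p v w) w' + inner ℝ w (connCoeff D p v w') := by
  have hp := mem_extChartAt_source (I := 𝓡 n) p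
  have hy := (extChartAt (𝓡 n) p).map_source hp
  have hw := FiberBundle.mdifferentiableAt_extend (𝓡 n) (EuclideanSpace ℝ (Fin n)) w
  have hw' := FiberBundle.mdifferentiableAt_extend (𝓡 n) (EuclideanSpace ℝ (Fin n)) w'
  have h := hD.mvfderiv_inner_eq
    (FiberBundle.extend (EuclideanSpace ℝ (Fin n)) v : ∀ x : M, TangentSpace (𝓡 n) x) hw hw'
  simp only [FiberBundle.extend_apply_self] at h
  refine Eq.trans ?_ h
  have hd := differentiableAt_of_contDiffOn (isOpen_extChartAt_target p) (contDiffOn_gram p) hy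
  set a := chartDeriv p p w
  set b := chartDeriv p p w'
  have hg := hasFDerivAt_apply_apply hd a b
  have hm : HasMFDerivAt (𝓡 n) 𝓘(ℝ, ℝ) (fun x : M => gram p (extChartAt (𝓡 n) p x) a b) p _ :=
    hg.hasMFDerivAt.comp p (mdifferentiableAt_chart hp).hasMFDerivAt
  -- Fields with constant components have inner product g(a, b) with a and b fixed, so metric
  -- compatibility for them is a formula for the derivative of the metric matrix.
  have hev : (fun x : M => inner ℝ
      (FiberBundle.extend (EuclideanSpace ℝ (Fin n)) w x : TangentSpace (𝓡 n) x)
      (FiberBundle.extend (EuclideanSpace ℝ (Fin n)) w' x : TangentSpace (𝓡 n) x)) =ᶠ[nhds p]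
      fun x : M => gram p (extChartAt (𝓡 n) p x) a b := by
    filter_upwards [(isOpen_extChartAt_source (I := 𝓡 n) p).eventually_mem hp] with x hx
    rw [gram_apply hx, extend_eq hx, extend_eq hx]
  have hm2 := hm.congr_of_eventuallyEq hev
  have h2 := congrArg (fun f => f v) hm2.mfderiv
  exact h2.symm

end Metric

/-! ### From partial to covariant derivatives in the bracket -/

section EndAction

variable {V : Type*} [AddCommGroup V] [Module ℝ V] {ι : Type*} [Fintype ι]

theorem interiorProd_endAction (A : V →ₗ[ℝ] V) {k : ℕ} (η : Alt V (k + 1)) (x : V) :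
    (interiorProd x (endAction A η) : Alt V k) =
      (interiorProd (A x) η : Alt V k) + endAction A (interiorProd x η : Alt V k) := by
  refine AlternatingMap.ext fun (v : Fin k → V) => ?_
  rw [interiorProd_apply, endAction_apply, Fin.sum_univ_succ, AlternatingMap.add_apply,
    interiorProd_apply, endAction_apply]
  congr 1
  · rw [Fin.update_cons_zero, Fin.cons_zero]
  · refine Finset.sum_congr rfl fun i _ => ?_
    rw [interiorProd_apply, Fin.cons_succ, Fin.cons_update]

/-- The derivation action of an endomorphism in a basis. -/
theorem emb_endAction (b : Module.Basis ι ℝ V) (A : V →ₗ[ℝ] V) {k : ℕ} (η : Alt V k) :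
    emb (endAction A η) = ∑ c, emb (oneForm (b.coord c ∘ₗ A)) * contractExt (b c) (emb η) := by
  induction k with
  | zero =>
    have h : endAction A η = 0 := by
      ext v
      rw [endAction_apply]
      simp
    simp only [h, contractExt_emb, interiorProd_zero_degree, map_zero, mul_zero,
      Finset.sum_const_zero]
  | succ k ih =>
    have hd : ∀ c, emb (oneForm (b.coord c ∘ₗ A)) * contractExt (b c) (emb η) =
        emb (wedgeTo (k + 1) (oneForm (b.coord c ∘ₗ A)) (interiorProd (b c) η)) := fun c => by
      rw [contractExt_emb, emb_wedgeTo (by omega)]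
    simp only [hd]
    rw [← map_sum]
    refine congrArg emb (ext_of_contractExt fun x => ?_)
    have h1 := congrArg (emb : Alt V k → Ext V) (interiorProd_endAction A η x)
    rw [map_add] at h1
    rw [contractExt_emb, map_sum, map_sum]
    refine Eq.trans h1 ?_
    have h2 := ih (interiorProd x η : Alt V k)
    refine (congrArg (fun z => _ + z) h2).trans ?_
    simp only [← hd, contractExt_oneForm_mul, Finset.sum_sub_distrib, LinearMap.comp_apply]
    have h3 : ∑ c, b.coord c (A x) • contractExt (b c) (emb η) = emb (interiorProd (A x) η) := by
      have := emb_apply_eq_sum b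
        { toFun := fun y => (interiorProd y η : Alt V k)
          map_add' := fun y z => interiorProd_add_vec y z η
          map_smul' := fun c y => interiorProd_smul_vec c y η } (A x)
      simp only [contractExt_emb]
      exact this
    rw [h3, sub_eq_add_neg, ← Finset.sum_neg_distrib]
    congr 1
    refine Finset.sum_congr rfl fun c _ => ?_
    rw [contractExt_contractExt x, mul_neg, neg_neg]
    exact congrArg (fun z => _ * contractExt _ z) (contractExt_emb x η).symm

theorem comp_eq_sum (b : Module.Basis ι ℝ V) (φ : V →ₗ[ℝ] ℝ) {k : ℕ} (K : V [⋀^Fin k]→ₗ[ℝ] V) :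
    comp φ K = ∑ a, φ (b a) • comp (b.coord a) K := by
  ext v
  rw [alternatingMap_sum_apply]
  change φ (K v) = ∑ a, φ (b a) * b.repr (K v) a
  conv_lhs => rw [← b.sum_repr (K v)]
  simp only [map_sum, map_smul, smul_eq_mul, mul_comm]

theorem oneForm_eq_sum (b : Module.Basis ι ℝ V) (φ : V →ₗ[ℝ] ℝ) :
    oneForm φ = ∑ a, φ (b a) • oneForm (b.coord a) := by
  ext v
  rw [alternatingMap_sum_apply]
  change φ (v 0) = ∑ a, φ (b a) * b.repr (v 0) a
  conv_lhs => rw [← b.sum_repr (v 0)]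
  simp only [map_sum, map_smul, smul_eq_mul, mul_comm]

/-- Half of the component along `φ` of the Frölicher-Nijenhuis bracket in the basis `b`, in terms of
the values and the first derivatives of the two vector-valued forms. -/
noncomputable def brHalf (b : Module.Basis ι ℝ V) {k₁ k₂ : ℕ} (K₁ : V [⋀^Fin k₁]→ₗ[ℝ] V)
    (dK₁ : ι → V [⋀^Fin k₁]→ₗ[ℝ] V) (K₂ : V [⋀^Fin k₂]→ₗ[ℝ] V) (dK₂ : ι → V [⋀^Fin k₂]→ₗ[ℝ] V)
    (φ : V →ₗ[ℝ] ℝ) : Ext V :=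
  lieExpr b k₁ (fun i => emb (comp (b.coord i) K₁))
    (fun i => ∑ c, emb (oneForm (b.coord c)) * emb (comp (b.coord i) (dK₁ c)))
    (emb (comp φ K₂)) (fun i => emb (comp φ (dK₂ i)))

/-- The component along `φ` of the Frölicher-Nijenhuis bracket in the basis `b`. -/
noncomputable def brExpr (b : Module.Basis ι ℝ V) {k₁ k₂ : ℕ} (K₁ : V [⋀^Fin k₁]→ₗ[ℝ] V)
    (dK₁ : ι → V [⋀^Fin k₁]→ₗ[ℝ] V) (K₂ : V [⋀^Fin k₂]→ₗ[ℝ] V) (dK₂ : ι → V [⋀^Fin k₂]→ₗ[ℝ] V)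
    (φ : V →ₗ[ℝ] ℝ) : Ext V :=
  brHalf b K₁ dK₁ K₂ dK₂ φ - (-1 : ℝ) ^ (k₁ * k₂) • brHalf b K₂ dK₂ K₁ dK₁ φ

/-- `N i` is the covariant derivative `∇_{b i} K` for the connection coefficients `Γ`, where `dK i`
is the partial derivative. -/
def IsCovDeriv (b : Module.Basis ι ℝ V) (Γ : V →ₗ[ℝ] V →ₗ[ℝ] V) {k : ℕ}
    (K : V [⋀^Fin k]→ₗ[ℝ] V) (dK N : ι → V [⋀^Fin k]→ₗ[ℝ] V) : Prop :=
  ∀ (φ : V →ₗ[ℝ] ℝ) (i : ι), comp φ (N i) =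
    comp φ (dK i) + comp (φ ∘ₗ Γ (b i)) K - endAction (Γ (b i)) (comp φ K)

/-- Symmetric coefficients against anticommuting one-forms: the sum is its own negative. -/
theorem sum_oneForm_mul_oneForm (b : Module.Basis ι ℝ V) {f : ι → ι → ℝ}
    (hf : ∀ i j, f i j = f j i) :
    ∑ c, ∑ a, f c a • (emb (oneForm (b.coord c)) * emb (oneForm (b.coord a))) = 0 := by
  have h : ∑ c, ∑ a, f c a • (emb (oneForm (b.coord c)) * emb (oneForm (b.coord a))) =
      -∑ c, ∑ a, f c a • (emb (oneForm (b.coord c)) * emb (oneForm (b.coord a))) := by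
    conv_lhs => rw [Finset.sum_comm]
    rw [← Finset.sum_neg_distrib]
    refine Finset.sum_congr rfl fun c _ => ?_
    rw [← Finset.sum_neg_distrib]
    refine Finset.sum_congr rfl fun a _ => ?_
    rw [emb_comm, hf a c]
    simp
  have h2 : (2 : ℝ) • ∑ c, ∑ a, f c a •
      (emb (oneForm (b.coord c)) * emb (oneForm (b.coord a))) = 0 := by
    rw [two_smul]
    nth_rewrite 1 [h]
    simp
  simpa using h2

/-- With θ_i^c = e^c ∘ Γ(e_i), the covariant exterior derivative of κ₁^i differs from dκ₁^i by Σ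
θ_a^i ∧ κ₁^a. This cancels the derivation terms Σ θ_i^c ∧ ι_c in ∇_i of the component of K₂. Only
the action of Γ on the value of K₂ survives. -/
theorem brHalf_of_isCovDeriv (b : Module.Basis ι ℝ V) {Γ : V →ₗ[ℝ] V →ₗ[ℝ] V}
    (hΓ : ∀ v w, Γ v w = Γ w v) {k₁ k₂ : ℕ} {K₁ : V [⋀^Fin k₁]→ₗ[ℝ] V}
    {dK₁ N₁ : ι → V [⋀^Fin k₁]→ₗ[ℝ] V} {K₂ : V [⋀^Fin k₂]→ₗ[ℝ] V}
    {dK₂ N₂ : ι → V [⋀^Fin k₂]→ₗ[ℝ] V} (h₁ : IsCovDeriv b Γ K₁ dK₁ N₁)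
    (h₂ : IsCovDeriv b Γ K₂ dK₂ N₂) (φ : V →ₗ[ℝ] ℝ) :
    brHalf b K₁ N₁ K₂ N₂ φ = brHalf b K₁ dK₁ K₂ dK₂ φ +
      ∑ i, ∑ a, φ (Γ (b i) (b a)) •
        (emb (comp (b.coord i) K₁) * emb (comp (b.coord a) K₂)) := by
  set e : ι → Ext V := fun c => emb (oneForm (b.coord c)) with he
  set θ : ι → ι → Ext V := fun i c => emb (oneForm (b.coord c ∘ₗ Γ (b i))) with hθ
  have hθe : ∀ i c, θ i c = ∑ a, b.coord c (Γ (b i) (b a)) • e a := fun i c => by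
    rw [hθ, he]
    simp only
    rw [oneForm_eq_sum b, map_sum]
    simp only [map_smul, LinearMap.comp_apply]
  have hN : ∀ {k : ℕ} {K : V [⋀^Fin k]→ₗ[ℝ] V} {dK N : ι → V [⋀^Fin k]→ₗ[ℝ] V},
      IsCovDeriv b Γ K dK N → ∀ (φ : V →ₗ[ℝ] ℝ) (i : ι), emb (comp φ (N i)) =
        emb (comp φ (dK i)) + ∑ a, φ (Γ (b i) (b a)) • emb (comp (b.coord a) K) -
          ∑ c, θ i c * contractExt (b c) (emb (comp φ K)) := fun h φ i => by
    rw [h φ i, map_sub, map_add, emb_endAction b, comp_eq_sum b (φ ∘ₗ Γ (b i)), map_sum]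
    simp only [map_smul, LinearMap.comp_apply]
    rfl
  have hd : ∀ i, ∑ c, emb (oneForm (b.coord c)) * emb (comp (b.coord i) (N₁ c)) =
      ∑ c, emb (oneForm (b.coord c)) * emb (comp (b.coord i) (dK₁ c)) +
        ∑ a, θ a i * emb (comp (b.coord a) K₁) := fun i => by
    change ∑ c, e c * _ = ∑ c, e c * _ + _
    have e1 : ∑ c, e c * ∑ a, b.coord i (Γ (b c) (b a)) • emb (comp (b.coord a) K₁) =
        ∑ a, θ a i * emb (comp (b.coord a) K₁) := by
      simp only [hθe, Finset.mul_sum, Finset.sum_mul]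
      rw [Finset.sum_comm]
      refine Finset.sum_congr rfl fun a _ => Finset.sum_congr rfl fun c _ => ?_
      rw [hΓ (b c), mul_smul_comm, smul_mul_assoc]
    -- The derivation part of ∇ drops out of the exterior derivative, as Σ e^c ∧ θ_c^d = 0 for
    -- symmetric Γ.
    have e2 : ∑ c, e c * ∑ d, θ c d * contractExt (b d) (emb (comp (b.coord i) K₁)) = 0 := by
      simp only [Finset.mul_sum, ← mul_assoc]
      rw [Finset.sum_comm]
      refine Finset.sum_eq_zero fun d _ => ?_
      rw [← Finset.sum_mul]
      convert zero_mul _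
      simp only [hθe, Finset.mul_sum, mul_smul_comm]
      exact sum_oneForm_mul_oneForm b fun i j => by rw [hΓ]
    simp only [hN h₁, mul_sub, mul_add, Finset.sum_sub_distrib, Finset.sum_add_distrib, e1, e2,
      sub_zero]
  -- The derivation terms of ∇K₂, with θ moved to the left of κ₁; they match the correction in `hd`,
  -- including the sign (-1)^{k₁}.
  have hc : ∑ i, emb (comp (b.coord i) K₁) * ∑ c, θ i c * contractExt (b c) (emb (comp φ K₂)) =
      (-1 : ℝ) ^ k₁ • ∑ i, (∑ a, θ a i * emb (comp (b.coord a) K₁)) *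
        contractExt (b i) (emb (comp φ K₂)) := by
    simp only [Finset.mul_sum, Finset.sum_mul, Finset.smul_sum]
    rw [Finset.sum_comm]
    refine Finset.sum_congr rfl fun i _ => Finset.sum_congr rfl fun a _ => ?_
    rw [← mul_assoc, emb_comm, mul_one, smul_mul_assoc]
  have hl : ∑ i, emb (comp (b.coord i) K₁) *
      ∑ a, φ (Γ (b i) (b a)) • emb (comp (b.coord a) K₂) = ∑ i, ∑ a, φ (Γ (b i) (b a)) •
        (emb (comp (b.coord i) K₁) * emb (comp (b.coord a) K₂)) := by
    simp only [Finset.mul_sum, mul_smul_comm]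
  simp only [brHalf, lieExpr, hd, hN h₂, mul_sub, mul_add, add_mul, Finset.sum_sub_distrib,
    Finset.sum_add_distrib, smul_add, hc, hl]
  abel

/-- The Frölicher-Nijenhuis bracket may be computed with any torsion-free connection. -/
theorem brExpr_of_isCovDeriv (b : Module.Basis ι ℝ V) {Γ : V →ₗ[ℝ] V →ₗ[ℝ] V}
    (hΓ : ∀ v w, Γ v w = Γ w v) {k₁ k₂ : ℕ} {K₁ : V [⋀^Fin k₁]→ₗ[ℝ] V}
    {dK₁ N₁ : ι → V [⋀^Fin k₁]→ₗ[ℝ] V} {K₂ : V [⋀^Fin k₂]→ₗ[ℝ] V}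
    {dK₂ N₂ : ι → V [⋀^Fin k₂]→ₗ[ℝ] V} (h₁ : IsCovDeriv b Γ K₁ dK₁ N₁)
    (h₂ : IsCovDeriv b Γ K₂ dK₂ N₂) (φ : V →ₗ[ℝ] ℝ) :
    brExpr b K₁ N₁ K₂ N₂ φ = brExpr b K₁ dK₁ K₂ dK₂ φ := by
  -- The surviving term is symmetric under exchange of K₁ and K₂ up to (-1)^{k₁k₂}, so it disappears
  -- from the difference.
  have h : (-1 : ℝ) ^ (k₁ * k₂) • ∑ i, ∑ a, φ (Γ (b i) (b a)) •
      (emb (comp (b.coord i) K₂) * emb (comp (b.coord a) K₁)) =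
      ∑ i, ∑ a, φ (Γ (b i) (b a)) • (emb (comp (b.coord i) K₁) * emb (comp (b.coord a) K₂)) := by
    rw [Finset.sum_comm, Finset.smul_sum]
    refine Finset.sum_congr rfl fun i _ => ?_
    rw [Finset.smul_sum]
    refine Finset.sum_congr rfl fun a _ => ?_
    rw [hΓ (b a), emb_comm (comp (b.coord i) K₁), smul_comm]
  rw [brExpr, brExpr, brHalf_of_isCovDeriv b hΓ h₁ h₂, brHalf_of_isCovDeriv b hΓ h₂ h₁, smul_add, h]
  abel

end EndAction

/-! ### Pullback on the graded algebra -/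

section PullExt

variable {V W : Type*} [AddCommGroup V] [Module ℝ V] [AddCommGroup W] [Module ℝ W]

theorem wedge_compLinearMap (A : W →ₗ[ℝ] V) {k l : ℕ} (α : Alt V k) (β : Alt V l) :
    wedge (α.compLinearMap A) (β.compLinearMap A) = (wedge α β).compLinearMap A := by
  ext v
  have hne : ((k.factorial : ℝ) * (l.factorial : ℝ)) ≠ 0 := by positivity
  refine smul_right_injective _ hne ?_
  exact (factorial_smul_wedgeWith (LinearMap.mul ℝ ℝ) (α.compLinearMap A) (β.compLinearMap A)
    v).trans (factorial_smul_wedgeWith (LinearMap.mul ℝ ℝ) α β (fun i => A (v i))).symm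

/-- The pullback by a linear map on the graded algebra of forms. -/
noncomputable def pullExt (A : W →ₗ[ℝ] V) : Ext V →ₗ[ℝ] Ext W :=
  DirectSum.toModule ℝ ℕ _ fun _ => emb ∘ₗ
    { toFun := fun η => η.compLinearMap A
      map_add' := fun _ _ => rfl
      map_smul' := fun _ _ => rfl }

theorem pullExt_emb (A : W →ₗ[ℝ] V) {k : ℕ} (η : Alt V k) :
    pullExt A (emb η) = emb (η.compLinearMap A) := by
  rw [pullExt, emb, DirectSum.toModule_lof]
  rfl

theorem pullExt_mul (A : W →ₗ[ℝ] V) (y z : Ext V) :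
    pullExt A (y * z) = pullExt A y * pullExt A z := by
  induction y using ext_induction with
  | h0 => simp
  | ha y y' h h' => rw [add_mul, map_add, h, h', map_add, add_mul]
  | he k α =>
    induction z using ext_induction with
    | h0 => simp
    | ha z z' h h' => rw [mul_add, map_add, h, h', map_add, mul_add]
    | he l β => rw [emb_mul, pullExt_emb, pullExt_emb, pullExt_emb, emb_mul, wedge_compLinearMap]

theorem pullExt_contractExt (A : W →ₗ[ℝ] V) (x : W) (z : Ext V) :
    pullExt A (contractExt (A x) z) = contractExt x (pullExt A z) := by
  induction z using ext_induction with
  | h0 => simp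
  | ha z z' h h' => simp only [map_add, h, h']
  | he k α =>
    rw [contractExt_emb, pullExt_emb, pullExt_emb, contractExt_emb]
    congr 1
    rcases k with _ | k
    · rfl
    · refine AlternatingMap.ext fun (v : Fin k → W) => ?_
      change α _ = α _
      congr 1
      funext i
      refine Fin.cases rfl (fun i => rfl) i

end PullExt

/-! ### Raising an index with a variable metric -/

section FlatMetric

variable {n : ℕ}

/-- `(κ, x) ↦ κ ⊗ x` as a continuous bilinear map. -/
noncomputable def tensorVecC (n k : ℕ) : CAlt n k →L[ℝ] Eu n →L[ℝ] CVAlt n k :=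
  LinearMap.toContinuousBilinearMap (LinearMap.mk₂ ℝ
    (fun κ x => toCont (tensorVec κ.toAlternatingMap x))
    (fun κ κ' x => ContinuousAlternatingMap.ext fun v => add_smul (κ v) (κ' v) x)
    (fun c κ x => ContinuousAlternatingMap.ext fun v => smul_assoc c (κ v) x)
    (fun κ x y => ContinuousAlternatingMap.ext fun v => smul_add (κ v) x y)
    (fun c κ x => ContinuousAlternatingMap.ext fun v => smul_comm (κ v) c x))

theorem tensorVecC_apply {k : ℕ} (κ : CAlt n k) (x : Eu n) (v : Fin k → Eu n) :
    tensorVecC n k κ x v = κ v • x := rfl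

/-- Evaluation of a continuous vector-valued form. -/
noncomputable def evalC {F : Type*} [NormedAddCommGroup F] [NormedSpace ℝ F]
    [FiniteDimensional ℝ F] {k : ℕ} (v : Fin k → Eu n) : (Eu n [⋀^Fin k]→L[ℝ] F) →L[ℝ] F :=
  LinearMap.toContinuousLinearMap
    { toFun := fun η => η v
      map_add' := fun _ _ => rfl
      map_smul' := fun _ _ => rfl }

theorem hasFDerivAt_evalC {F G : Type*} [NormedAddCommGroup F] [NormedSpace ℝ F]
    [FiniteDimensional ℝ F] [NormedAddCommGroup G] [NormedSpace ℝ G] {k : ℕ} (v : Fin k → Eu n)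
    {f : G → Eu n [⋀^Fin k]→L[ℝ] F} {y : G} (hf : DifferentiableAt ℝ f y) :
    HasFDerivAt (fun z => f z v) ((evalC v).comp (fderiv ℝ f y)) y := by
  have h := (evalC (F := F) v).hasFDerivAt.comp y hf.hasFDerivAt
  exact h

theorem exists_equiv_of_injective {g : Eu n →L[ℝ] Eu n →L[ℝ] ℝ} (hg : Function.Injective g) :
    ∃ e : Eu n ≃L[ℝ] (Eu n →L[ℝ] ℝ), (e : Eu n →L[ℝ] Eu n →L[ℝ] ℝ) = g := by
  have hr : Module.finrank ℝ (Eu n) = Module.finrank ℝ (Eu n →L[ℝ] ℝ) := by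
    rw [← (LinearMap.toContinuousLinearMap (𝕜 := ℝ) (E := Eu n) (F' := ℝ)).finrank_eq]
    exact Subspace.dual_finrank_eq.symm
  refine ⟨(LinearEquiv.ofBijective g.toLinearMap ⟨hg,
    (LinearMap.injective_iff_surjective_of_finrank_eq_finrank hr).1 hg⟩).toContinuousLinearEquiv, ?_⟩
  ext v
  rfl

/-- A vector-valued form that is metrically dual to a smooth form is smooth. -/
theorem contDiffOn_of_metric {U : Set (Eu n)} {G : Eu n → Eu n →L[ℝ] Eu n →L[ℝ] ℝ} {k : ℕ}
    {A : Eu n → CAlt n (k + 1)} {K : Eu n → CVAlt n k} (hG : ContDiffOn ℝ ∞ G U)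
    (hA : ContDiffOn ℝ ∞ A U) (hi : ∀ y ∈ U, Function.Injective (G y))
    (hK : ∀ y ∈ U, ∀ b v, G y (K y v) b = A y (Fin.cons b v)) : ContDiffOn ℝ ∞ K U := by
  let c : Fin n → Eu n →L[ℝ] ℝ := fun i => LinearMap.toContinuousLinearMap ((stdB n).coord i)
  -- Inversion of continuous linear maps is smooth at an equivalence, and an injective G y is one
  -- because a space and its dual have equal dimension.
  have hinv : ContDiffOn ℝ ∞ (fun y => ContinuousLinearMap.inverse (G y)) U := fun y hy => by
    obtain ⟨e, he⟩ := exists_equiv_of_injective (hi y hy)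
    have h := contDiffAt_map_inverse (n := ∞) e
    rw [he] at h
    exact h.comp_contDiffWithinAt y (hG y hy)
  -- An explicit smooth candidate, Σ (ι_{e_i} A) ⊗ G⁻¹(e^i). It has the same pairing with G as K, so
  -- injectivity of G identifies the two.
  have hS : ContDiffOn ℝ ∞ (fun y => ∑ i, tensorVecC n k (interiorC (stdB n i) (k + 1) (A y))
      (ContinuousLinearMap.inverse (G y) (c i))) U :=
    ContDiffOn.sum fun i _ => contDiffOn_bilin (tensorVecC n k)
      (contDiffOn_lin (interiorC (stdB n i) (k + 1)) hA) (hinv.clm_apply contDiffOn_const)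
  refine hS.congr fun y hy => ContinuousAlternatingMap.ext fun v => hi y hy ?_
  obtain ⟨e, he⟩ := exists_equiv_of_injective (hi y hy)
  have h1 : ∀ i, G y (ContinuousLinearMap.inverse (G y) (c i)) = c i := fun i => by
    rw [← he, ContinuousLinearMap.inverse_equiv]
    exact e.apply_symm_apply _
  ext b
  rw [hK y hy, ContinuousAlternatingMap.sum_apply, map_sum, sum_apply]
  simp only [tensorVecC_apply, map_smul, h1]
  have h2 : ∀ i, (interiorC (stdB n i) (k + 1) (A y)) v = A y (Fin.cons (stdB n i) v) :=
    fun i => rfl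
  have h3 : A y (Fin.cons b v) = ∑ i, (stdB n).repr b i * A y (Fin.cons (stdB n i) v) := by
    let L : Eu n →ₗ[ℝ] ℝ := curryFirst (A y).toAlternatingMap v
    have := congrArg L ((stdB n).sum_repr b)
    rw [map_sum] at this
    simp only [map_smul, smul_eq_mul] at this
    exact this.symm
  rw [h3]
  refine Finset.sum_congr rfl fun i _ => ?_
  exact mul_comm _ _

theorem fderiv_of_metric {U : Set (Eu n)} (hU : IsOpen U)
    {G : Eu n → Eu n →L[ℝ] Eu n →L[ℝ] ℝ} {k : ℕ}
    {A : Eu n → CAlt n (k + 1)} {K : Eu n → CVAlt n k} {y : Eu n} (hy : y ∈ U)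
    (hG : DifferentiableAt ℝ G y) (hA : DifferentiableAt ℝ A y) (hK : DifferentiableAt ℝ K y)
    (h : ∀ y ∈ U, ∀ b v, G y (K y v) b = A y (Fin.cons b v)) (x b : Eu n) (v : Fin k → Eu n) :
    fderiv ℝ G y x (K y v) b + G y (fderiv ℝ K y x v) b = fderiv ℝ A y x (Fin.cons b v) := by
  have h1 := hasFDerivAt_evalC v hK
  have h2 := hasFDerivAt_evalC (Fin.cons b v) hA
  have h3 := (hG.hasFDerivAt.clm_apply h1).clm_apply (hasFDerivAt_const b y)
  have h4 : (fun z => A z (Fin.cons b v)) =ᶠ[nhds y] fun z => G z (K z v) b := by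
    filter_upwards [hU.mem_nhds hy] with z hz using (h z hz b v).symm
  have h5 := congrArg (fun f => f x) (h3.unique (h2.congr_of_eventuallyEq h4.symm))
  simp only [add_apply, ContinuousLinearMap.comp_apply,
    ContinuousLinearMap.flip_apply, zero_apply, map_zero, zero_add] at h5
  rw [add_comm]
  exact h5

end FlatMetric

/-! ### The bracket at a point in an arbitrary basis -/

section Partial

variable {n : ℕ} {M : Type*} [TopologicalSpace M] [ChartedSpace (EuclideanSpace ℝ (Fin n)) M]

/-- The partial derivative at `p` of a `TM`-valued form in the chart around `p`. -/
noncomputable def partialV {k : ℕ} (K : VForm n M k) (p : M) (v : TangentSpace (𝓡 n) p) :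
    TangentSpace (𝓡 n) p [⋀^Fin k]→ₗ[ℝ] TangentSpace (𝓡 n) p :=
  (chartInv p p).compAlternatingMap ((fderiv ℝ (inChartV K p) (extChartAt (𝓡 n) p p)
    (chartDeriv p p v)).toAlternatingMap.compLinearMap (chartDeriv p p))

theorem pullExt_lieExpr {V W ι : Type*} [AddCommGroup V] [Module ℝ V] [AddCommGroup W] [Module ℝ W]
    [Fintype ι] (A : W →ₗ[ℝ] V) (b : ι → V) (e : ι → W) (h : ∀ i, b i = A (e i)) (k : ℕ)
    (κ dκ : ι → Ext V) (a : Ext V) (da : ι → Ext V) :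
    pullExt A (lieExpr b k κ dκ a da) = lieExpr e k (fun i => pullExt A (κ i))
      (fun i => pullExt A (dκ i)) (pullExt A a) (fun i => pullExt A (da i)) := by
  simp only [lieExpr, map_add, map_smul, map_sum, pullExt_mul, h, pullExt_contractExt]

variable [IsManifold (𝓡 n) ∞ M]

attribute [local instance] isManifold_one

/-- The differential at `p` of the chart around `p` as an equivalence. -/
noncomputable def chartEquiv (p : M) : TangentSpace (𝓡 n) p ≃ₗ[ℝ] Eu n :=
  LinearEquiv.ofLinearMap (chartDeriv p p) (chartInv p p)
    (LinearMap.ext fun v => chartDeriv_chartInv (mem_extChartAt_source p) v)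
    (LinearMap.ext fun v => chartInv_chartDeriv (mem_extChartAt_source p) v)

/-- The basis e is carried to the model space by the differential of the chart. The component
formula holds there in any constant basis, and pullback respects products and contractions. -/
theorem pullExt_embC_flatLie {k₁ k₂ : ℕ} {K₁ : VForm n M k₁} {K₂ : VForm n M k₂}
    (hK₁ : SmoothVForm K₁) (hK₂ : SmoothVForm K₂) (p : M) {ι : Type*} [Fintype ι]
    (e : Module.Basis ι ℝ (TangentSpace (𝓡 n) p)) (φ : TangentSpace (𝓡 n) p →ₗ[ℝ] ℝ) :
    pullExt (chartDeriv p p) (embC (flatLie (inChartV K₁ p)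
        (fun z => compC (φ ∘ₗ chartInv p p) k₂ (inChartV K₂ p z)) (extChartAt (𝓡 n) p p))) =
      brHalf e (K₁ p) (fun i => partialV K₁ p (e i)) (K₂ p) (fun i => partialV K₂ p (e i)) φ := by
  have hp := mem_extChartAt_source (I := 𝓡 n) p
  have hd : ∀ {k : ℕ} {K : VForm n M k}, SmoothVForm K →
      DifferentiableAt ℝ (inChartV K p) (extChartAt (𝓡 n) p p) := fun hK =>
    differentiableAt_of_contDiffOn (isOpen_extChartAt_target p) (hK p)
      ((extChartAt (𝓡 n) p).map_source hp)
  have hcomp : ∀ {k : ℕ} (K : VForm n M k) (ψ : TangentSpace (𝓡 n) p →ₗ[ℝ] ℝ),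
      pullExt (chartDeriv p p) (embC (compC (ψ ∘ₗ chartInv p p) k
        (inChartV K p (extChartAt (𝓡 n) p p)))) = emb (comp ψ (K p)) := fun K ψ => by
    rw [eq_inChartV K hp, embC_eq, pullExt_emb]
    rfl
  have hpart : ∀ {k : ℕ} {K : VForm n M k} (_ : SmoothVForm K)
      (ψ : TangentSpace (𝓡 n) p →ₗ[ℝ] ℝ) (v : TangentSpace (𝓡 n) p),
      pullExt (chartDeriv p p) (embC (fderiv ℝ (fun z => compC (ψ ∘ₗ chartInv p p) k
        (inChartV K p z)) (extChartAt (𝓡 n) p p) (chartDeriv p p v))) =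
        emb (comp ψ (partialV K p v)) := fun hK ψ v => by
    rw [fderiv_lin _ (hd hK), embC_eq, pullExt_emb]
    rfl
  have hb : ∀ i, (e.map (chartEquiv p)) i = chartDeriv p p (e i) := fun i => rfl
  have hbc : ∀ i, (e.map (chartEquiv p)).coord i = e.coord i ∘ₗ chartInv p p := fun i => rfl
  have hone : ∀ i, pullExt (chartDeriv p p) (emb (oneForm (e.coord i ∘ₗ chartInv p p))) =
      emb (oneForm (e.coord i)) := fun i => by
    rw [pullExt_emb, oneForm_compLinearMap]
    congr 2
    ext1 v
    exact congrArg (e.coord i) (chartInv_chartDeriv hp v)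
  have hc : DifferentiableAt ℝ (fun z => compC (φ ∘ₗ chartInv p p) k₂ (inChartV K₂ p z))
      (extChartAt (𝓡 n) p p) := (compC (φ ∘ₗ chartInv p p) k₂).differentiableAt.comp _ (hd hK₂)
  rw [embC_flatLie (e.map (chartEquiv p)) (hd hK₁) hc, pullExt_lieExpr _ _ e hb, brHalf]
  simp only [embC_extDeriv (e.map (chartEquiv p)), map_sum, pullExt_mul, hb, hbc, hpart hK₁,
    hpart hK₂, hcomp, hone]

/-- The Frölicher-Nijenhuis bracket in terms of partial derivatives. -/
theorem emb_comp_fnBracket [T2Space M] {k₁ k₂ : ℕ} {K₁ : VForm n M k₁} {K₂ : VForm n M k₂}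
    (hK₁ : SmoothVForm K₁) (hK₂ : SmoothVForm K₂) (p : M) {ι : Type*} [Fintype ι]
    (e : Module.Basis ι ℝ (TangentSpace (𝓡 n) p)) (φ : TangentSpace (𝓡 n) p →ₗ[ℝ] ℝ) :
    emb (comp φ (fnBracket K₁ K₂ p)) =
      brExpr e (K₁ p) (fun i => partialV K₁ p (e i)) (K₂ p) (fun i => partialV K₂ p (e i)) φ := by
  have hp := mem_extChartAt_source (I := 𝓡 n) p
  have hd : ∀ {k : ℕ} {K : VForm n M k}, SmoothVForm K →
      DifferentiableAt ℝ (inChartV K p) (extChartAt (𝓡 n) p p) := fun hK =>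
    differentiableAt_of_contDiffOn (isOpen_extChartAt_target p) (hK p)
      ((extChartAt (𝓡 n) p).map_source hp)
  have h1 : emb (comp φ (fnBracket K₁ K₂ p)) = pullExt (chartDeriv p p)
      (embC (compC (φ ∘ₗ chartInv p p) (k₁ + k₂)
        (chartBracket K₁ K₂ p (extChartAt (𝓡 n) p p)))) := by
    rw [eq_inChartV (fnBracket K₁ K₂) hp, inChartV_fnBracket hK₁ hK₂ hp, embC_eq, pullExt_emb]
    rfl
  -- Transported to the chart, φ is an arbitrary covector and not a coordinate, hence the general
  -- component formula `compC_flatBracket`.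
  rw [h1, chartBracket, compC_flatBracket (hd hK₁) (hd hK₂), flatBracketComp, map_add, map_smul,
    embC_toDegreeC (Nat.add_comm k₂ k₁), map_add, map_smul, pullExt_embC_flatLie hK₁ hK₂ p e,
    pullExt_embC_flatLie hK₂ hK₁ p e, brExpr, neg_smul, sub_eq_add_neg]

end Partial

/-! ### Covariant derivatives of metric contractions -/

section Riemannian

variable {n : ℕ} {M : Type*} [TopologicalSpace M] [ChartedSpace (EuclideanSpace ℝ (Fin n)) M]
  [RiemannianBundle (TangentSpace (𝓡 n) : M → Type _)]

theorem inner_delta {k : ℕ} (Ψ : Form n M (k + 1)) (p : M) (v : Fin k → TangentSpace (𝓡 n) p)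
    (b : TangentSpace (𝓡 n) p) : inner ℝ (delta Ψ p v) b = Ψ p (Fin.cons b v) :=
  inner_sharp (V := TangentSpace (𝓡 n) p) (curryFirst (Ψ p) v) b

variable [IsManifold (𝓡 n) ∞ M]

attribute [local instance] isManifold_one

theorem gram_delta {k : ℕ} (Ψ : Form n M (k + 1)) (p : M) (y : Eu n)
    (hy : y ∈ (extChartAt (𝓡 n) p).target) (b : Eu n) (v : Fin k → Eu n) :
    gram p y (inChartV (delta Ψ) p y v) b = inChart Ψ p y (Fin.cons b v) := by
  obtain ⟨x, hx, rfl⟩ : ∃ x ∈ (extChartAt (𝓡 n) p).source, extChartAt (𝓡 n) p x = y :=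
    ⟨_, (extChartAt (𝓡 n) p).map_target hy, (extChartAt (𝓡 n) p).right_inv hy⟩
  rw [inChartV_apply _ hx, inChart_apply _ hx, gram_apply hx]
  change inner ℝ (chartInv p x (chartDeriv p x (delta Ψ x fun i => chartInv p x (v i))))
    (chartInv p x b) = Ψ x fun i => chartInv p x (Fin.cons (α := fun _ => Eu n) b v i)
  rw [chartInv_chartDeriv hx, inner_delta]
  congr 1
  funext i
  exact Fin.cases rfl (fun i => rfl) i

theorem gram_injective (p : M) (y : Eu n) (hy : y ∈ (extChartAt (𝓡 n) p).target) :
    Function.Injective (gram p y) := by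
  obtain ⟨x, hx, rfl⟩ : ∃ x ∈ (extChartAt (𝓡 n) p).source, extChartAt (𝓡 n) p x = y :=
    ⟨_, (extChartAt (𝓡 n) p).map_target hy, (extChartAt (𝓡 n) p).right_inv hy⟩
  intro a b h
  have h2 : chartInv p x a = chartInv p x b := by
    refine ext_inner_right (𝕜 := ℝ) (E := TangentSpace (𝓡 n) x) fun w => ?_
    rw [← chartInv_chartDeriv hx w, ← gram_apply hx, ← gram_apply hx, h]
  rw [← chartDeriv_chartInv hx a, h2, chartDeriv_chartInv hx]

variable [IsContMDiffRiemannianBundle (𝓡 n) ∞ (EuclideanSpace ℝ (Fin n))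
    (TangentSpace (𝓡 n) : M → Type _)]

theorem SmoothForm.delta {k : ℕ} {Ψ : Form n M (k + 1)} (hΨ : SmoothForm Ψ) :
    SmoothVForm (delta Ψ) := fun p =>
  contDiffOn_of_metric (contDiffOn_gram p) (hΨ p) (gram_injective p) (gram_delta Ψ p)

/-- The connection coefficients as a bilinear map. -/
noncomputable def connCoeffₗ (D : CovariantDerivative (𝓡 n) (EuclideanSpace ℝ (Fin n))
    (TangentSpace (𝓡 n) : M → Type _)) (p : M) :
    TangentSpace (𝓡 n) p →ₗ[ℝ] TangentSpace (𝓡 n) p →ₗ[ℝ] TangentSpace (𝓡 n) p where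
  toFun := connCoeff D p
  map_add' v v' := LinearMap.ext fun w => map_add (D (FiberBundle.extend _ w) p) v v'
  map_smul' c v := LinearMap.ext fun w => map_smul (D (FiberBundle.extend _ w) p) c v

/-- Differentiate g(δ_g(Ψ)(v), b) = Ψ(b, v) in the chart. The derivative of g yields two terms with
Γ; the one with Γ on b equals Ψ(Γ b, v) and is moved to the right. -/
theorem inner_partialV {D : CovariantDerivative (𝓡 n) (EuclideanSpace ℝ (Fin n))
    (TangentSpace (𝓡 n) : M → Type _)} (hD : D.IsMetricCompatible) {k : ℕ}
    {Ψ : Form n M (k + 1)} (hΨ : SmoothForm Ψ) (p : M) (x b : TangentSpace (𝓡 n) p)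
    (v : Fin k → TangentSpace (𝓡 n) p) :
    inner ℝ (connCoeff D p x (delta Ψ p v)) b + inner ℝ (partialV (delta Ψ) p x v) b =
      fderiv ℝ (inChart Ψ p) (extChartAt (𝓡 n) p p) (chartDeriv p p x)
        (Fin.cons (chartDeriv p p b) fun i => chartDeriv p p (v i))
      - Ψ p (Fin.cons (connCoeff D p x b) v) := by
  have hp := mem_extChartAt_source (I := 𝓡 n) p
  have hy := (extChartAt (𝓡 n) p).map_source hp
  have hU := isOpen_extChartAt_target (I := 𝓡 n) p
  have h := fderiv_of_metric hU hy (differentiableAt_of_contDiffOn hU (contDiffOn_gram p) hy)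
    (differentiableAt_of_contDiffOn hU (hΨ p) hy)
    (differentiableAt_of_contDiffOn hU (hΨ.delta p) hy) (gram_delta Ψ p) (chartDeriv p p x)
    (chartDeriv p p b) (fun i => chartDeriv p p (v i))
  have h1 : inChartV (FN.delta Ψ) p (extChartAt (𝓡 n) p p) (fun i => chartDeriv p p (v i)) =
      chartDeriv p p (FN.delta Ψ p v) := by
    rw [inChartV_apply _ hp]
    change chartDeriv p p (FN.delta Ψ p fun i => chartInv p p (chartDeriv p p (v i))) = _
    simp only [chartInv_chartDeriv hp]
  rw [h1, fderiv_gram hD, gram_apply hp, chartInv_chartDeriv hp, inner_delta] at h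
  rw [← h, add_right_comm, add_sub_cancel_right]
  rfl

/-- A metric connection commutes with raising an index. Tested against b, the term Ψ(Γ b, v) from
the derivative of the metric is the first-slot term of the derivation action on Ψ; the other slots
give the derivation action on δ_g(Ψ). -/
theorem isCovDeriv_delta {D : CovariantDerivative (𝓡 n) (EuclideanSpace ℝ (Fin n))
    (TangentSpace (𝓡 n) : M → Type _)} (hD : D.IsMetricCompatible) {k : ℕ}
    {Ψ : Form n M (k + 1)} (hΨ : SmoothForm Ψ) (p : M) {ι : Type*} [Fintype ι]
    (e : Module.Basis ι ℝ (TangentSpace (𝓡 n) p)) :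
    IsCovDeriv e (connCoeffₗ D p) (delta Ψ p) (fun i => partialV (delta Ψ) p (e i))
      (fun i => metricContraction (covDerivForm D Ψ p (e i))) := by
  intro φ i
  refine AlternatingMap.ext fun v => ?_
  set Γ := connCoeff D p (e i) with hΓ
  have key : metricContraction (covDerivForm D Ψ p (e i)) v =
      partialV (delta Ψ) p (e i) v + Γ (delta Ψ p v) -
        ∑ a, delta Ψ p (Function.update v a (Γ (v a))) := by
    refine ext_inner_right (𝕜 := ℝ) (E := TangentSpace (𝓡 n) p) fun b => ?_
    have h1 : inner ℝ (metricContraction (covDerivForm D Ψ p (e i)) v) b =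
        covDerivForm D Ψ p (e i) (Fin.cons b v) :=
      inner_sharp (V := TangentSpace (𝓡 n) p) (curryFirst (covDerivForm D Ψ p (e i)) v) b
    have h2 := inner_partialV hD hΨ p (e i) b v
    rw [h1, inner_sub_left, inner_add_left, sum_inner]
    simp only [inner_delta]
    rw [add_comm (inner ℝ _ b), h2, covDerivForm, AlternatingMap.sub_apply, endAction_apply,
      Fin.sum_univ_succ, sub_sub]
    congr 1
    · change fderiv ℝ (inChart Ψ p) _ _ (fun a => chartDeriv p p _) = _
      congr 1
      funext a
      exact Fin.cases rfl (fun a => rfl) a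
    · congr 1
      · rw [Fin.update_cons_zero, Fin.cons_zero]
      · refine Finset.sum_congr rfl fun a _ => ?_
        rw [Fin.cons_succ, Fin.cons_update]
  rw [AlternatingMap.sub_apply, AlternatingMap.add_apply, endAction_apply]
  change φ (metricContraction (covDerivForm D Ψ p (e i)) v) = _
  rw [key, map_sub, map_add, map_sum]
  rfl

/-- The Frölicher-Nijenhuis bracket of `δ_g(Ψ₁)` and `δ_g(Ψ₂)` in terms of covariant derivatives. -/
theorem emb_comp_fnBracket_delta [T2Space M] {D : CovariantDerivative (𝓡 n) (EuclideanSpace ℝ (Fin n))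
    (TangentSpace (𝓡 n) : M → Type _)} (hD : IsLeviCivita D) {k₁ k₂ : ℕ}
    {Ψ₁ : Form n M (k₁ + 1)} {Ψ₂ : Form n M (k₂ + 1)} (h₁ : SmoothForm Ψ₁) (h₂ : SmoothForm Ψ₂)
    (p : M) {ι : Type*} [Fintype ι] (e : Module.Basis ι ℝ (TangentSpace (𝓡 n) p))
    (φ : TangentSpace (𝓡 n) p →ₗ[ℝ] ℝ) :
    emb (comp φ (fnBracket (delta Ψ₁) (delta Ψ₂) p)) =
      brExpr e (delta Ψ₁ p) (fun i => metricContraction (covDerivForm D Ψ₁ p (e i)))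
        (delta Ψ₂ p) (fun i => metricContraction (covDerivForm D Ψ₂ p (e i))) φ := by
  rw [emb_comp_fnBracket h₁.delta h₂.delta p e]
  exact (brExpr_of_isCovDeriv e (Γ := connCoeffₗ D p) (fun v w => connCoeff_symm hD.2 p v w)
    (isCovDeriv_delta hD.1 h₁ p e) (isCovDeriv_delta hD.1 h₂ p e) φ).symm

end Riemannian

/-! ### Metric duality and dual bases -/

section Sharp

variable {V : Type*} [NormedAddCommGroup V] [InnerProductSpace ℝ V] [FiniteDimensional ℝ V]
  {ι : Type*} [Fintype ι]

theorem comp_innerₗ_metricContraction {k : ℕ} (Ψ : Alt V (k + 1)) (x : V) :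
    comp (innerₗ V x) (metricContraction Ψ) = interiorProd x Ψ := by
  ext v
  change inner ℝ x (sharp (curryFirst Ψ v)) = curryFirst Ψ v x
  rw [real_inner_comm, inner_sharp]

theorem comp_metricContraction {k : ℕ} (Ψ : Alt V (k + 1)) (φ : V →ₗ[ℝ] ℝ) :
    comp φ (metricContraction Ψ) = interiorProd (sharp φ) Ψ := by
  ext v
  change φ (sharp (curryFirst Ψ v)) = curryFirst Ψ v (sharp φ)
  rw [← inner_sharp φ, real_inner_comm, inner_sharp]

/-- The vectors (e^j)^♯ form the basis dual to (e_j) under the inner product. The coefficient of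
(e^j)^♯ is therefore the component along ⟨e_j, ·⟩, which is why the final formula reads off those
components. -/
theorem sum_inner_smul_sharp (e : Module.Basis ι ℝ V) (w : V) :
    ∑ j, inner ℝ (e j) w • sharp (e.coord j) = w := by
  refine ext_inner_right ℝ fun y => ?_
  rw [sum_inner]
  simp only [real_inner_smul_left, inner_sharp]
  conv_rhs => rw [← e.sum_repr y, inner_sum]
  refine Finset.sum_congr rfl fun j _ => ?_
  rw [real_inner_smul_right, real_inner_comm, mul_comm]
  rfl

theorem sum_tensorVec_comp_innerₗ (e : Module.Basis ι ℝ V) {k : ℕ} (X : V [⋀^Fin k]→ₗ[ℝ] V) :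
    ∑ j, tensorVec (comp (innerₗ V (e j)) X) (sharp (e.coord j)) = X := by
  ext v
  rw [alternatingMap_sum_apply]
  exact sum_inner_smul_sharp e (X v)

/-- Both sums are Σ g^{ij} H(e_i, e_j) with g^{ij} the inverse Gram matrix, which is symmetric. -/
theorem sum_sharp_swap {N : Type*} [AddCommGroup N] [Module ℝ N] (e : Module.Basis ι ℝ V)
    (H : V →ₗ[ℝ] V →ₗ[ℝ] N) :
    ∑ i, H (e i) (sharp (e.coord i)) = ∑ i, H (sharp (e.coord i)) (e i) := by
  have h : ∀ i, sharp (e.coord i) = ∑ j, e.coord j (sharp (e.coord i)) • e j := fun i =>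
    (e.sum_repr _).symm
  have hs : ∀ i j, e.coord j (sharp (e.coord i)) = e.coord i (sharp (e.coord j)) := fun i j => by
    rw [← inner_sharp (e.coord j), ← inner_sharp (e.coord i), real_inner_comm]
  have h1 : ∀ i, H (e i) (sharp (e.coord i)) =
      ∑ j, e.coord j (sharp (e.coord i)) • H (e i) (e j) := fun i => by
    conv_lhs => rw [h i, map_sum]
    simp only [map_smul]
  have h2 : ∀ i, H (sharp (e.coord i)) (e i) =
      ∑ j, e.coord j (sharp (e.coord i)) • H (e j) (e i) := fun i => by
    conv_lhs => rw [h i, map_sum, LinearMap.sum_apply]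
    simp only [map_smul, LinearMap.smul_apply]
  simp only [h1, h2]
  rw [Finset.sum_comm]
  exact Finset.sum_congr rfl fun i _ => Finset.sum_congr rfl fun j _ => by rw [hs]

theorem sharp_coord_of_orthonormal {e : Module.Basis ι ℝ V} (he : Orthonormal ℝ e) (i : ι) :
    sharp (e.coord i) = e i := by
  refine ext_inner_right ℝ fun w => ?_
  rw [inner_sharp]
  exact (he.inner_right_fintype (e.repr w) i).symm.trans (by rw [e.sum_repr])

end Sharp

/-! ### Reordering contracted factors -/

section Formula

variable {V : Type*} [AddCommGroup V] [Module ℝ V]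

theorem emb_toDegree_wedge {k l m : ℕ} {α : Alt V k} {β : Alt V l}
    (h : k + l = m ∨ α = 0 ∨ β = 0) : emb (toDegree m (wedge α β)) = emb α * emb β := by
  by_cases hk : k + l = m
  · rw [emb_toDegree hk, emb_mul]
  · rw [toDegree_of_ne hk, map_zero]
    rcases h with h | rfl | rfl
    · exact absurd h hk
    · rw [map_zero, zero_mul]
    · rw [map_zero, mul_zero]

theorem emb_interiorProd (x : V) {k : ℕ} (α : Alt V k) :
    emb (interiorProd x α) = contractExt x (emb α) := (contractExt_emb x α).symm

theorem contract_comm {k l : ℕ} (α : Alt V (k + 1)) (β : Alt V (l + 1)) (x y : V) :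
    contractExt x (emb α) * contractExt y (emb β) =
      (-1 : ℝ) ^ (k * l) • (contractExt y (emb β) * contractExt x (emb α)) := by
  rw [contractExt_emb, contractExt_emb]
  exact emb_comm (interiorProd x α : Alt V k) (interiorProd y β : Alt V l)

/-- A double contraction of α has degree k - 1, so passing β costs (-1)^{(k-1)(l+1)}, and exchanging
the contractions costs another -1. For k = 0 both sides vanish. -/
theorem contract_contract_comm {k l : ℕ} (α : Alt V (k + 1)) (β : Alt V (l + 1)) (x y : V) :
    (-1 : ℝ) ^ k • (contractExt x (contractExt y (emb α)) * emb β) =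
      ((-1 : ℝ) ^ (k * l) * (-1 : ℝ) ^ l) •
        (emb β * contractExt y (contractExt x (emb α))) := by
  rcases k with _ | k
  · have h : ∀ u v : V, contractExt u (contractExt v (emb α)) = 0 := fun u v => by
      rw [contractExt_emb, contractExt_emb]
      exact map_zero _
    rw [h, h, zero_mul, mul_zero, smul_zero, smul_zero]
  · have h : contractExt y (contractExt x (emb α)) * emb β =
        (-1 : ℝ) ^ (k * (l + 1)) • (emb β * contractExt y (contractExt x (emb α))) := by
      rw [contractExt_emb, contractExt_emb]
      exact emb_comm (interiorProd y (interiorProd x α : Alt V (k + 1)) : Alt V k) β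
    rw [contractExt_contractExt x, neg_mul, h, smul_neg, smul_smul, ← neg_smul]
    congr 1
    have hk := neg_one_pow_mul_self k
    have hl := neg_one_pow_mul_self l
    have e1 : (-1 : ℝ) ^ (k * (l + 1)) = (-1 : ℝ) ^ (k * l) * (-1 : ℝ) ^ k := by
      rw [← pow_add]; ring_nf
    have e2 : (-1 : ℝ) ^ ((k + 1) * l) = (-1 : ℝ) ^ (k * l) * (-1 : ℝ) ^ l := by
      rw [← pow_add]; ring_nf
    rw [e1, e2, pow_succ]
    linear_combination (-1 : ℝ) ^ (k * l) * (hk - hl)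

variable {ι : Type*} [Fintype ι]

/-- `e^c ∧ ι_x N_c`, summed over `c`. -/
noncomputable def dualWedge (e : Module.Basis ι ℝ V) {k : ℕ} (N : V →ₗ[ℝ] Alt V (k + 1)) (x : V) :
    Ext V :=
  ∑ c, emb (oneForm (e.coord c)) * contractExt x (emb (N (e c)))

theorem exists_emb_eq_dualWedge (e : Module.Basis ι ℝ V) {k : ℕ} (N : V →ₗ[ℝ] Alt V (k + 1))
    (x : V) : ∃ β : Alt V (k + 1), emb β = dualWedge e N x := by
  refine ⟨∑ c, wedgeTo (k + 1) (oneForm (e.coord c)) (interiorProd x (N (e c)) : Alt V k), ?_⟩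
  rw [map_sum, dualWedge]
  refine Finset.sum_congr rfl fun c _ => ?_
  rw [emb_wedgeTo (Nat.add_comm 1 k), contractExt_emb]

end Formula

/-! ### The four terms of the bracket -/

section MetricFormula

variable {V : Type*} [NormedAddCommGroup V] [InnerProductSpace ℝ V] [FiniteDimensional ℝ V]
  {ι : Type*} [Fintype ι]

theorem emb_comp_innerₗ_metricContraction {k : ℕ} (Ψ : Alt V (k + 1)) (x : V) :
    emb (comp (innerₗ V x) (metricContraction Ψ)) = contractExt x (emb Ψ) := by
  rw [comp_innerₗ_metricContraction, contractExt_emb]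

theorem emb_comp_metricContraction {k : ℕ} (Ψ : Alt V (k + 1)) (φ : V →ₗ[ℝ] ℝ) :
    emb (comp φ (metricContraction Ψ)) = contractExt (sharp φ) (emb Ψ) := by
  rw [comp_metricContraction, contractExt_emb]

theorem sum_contract_swap (e : Module.Basis ι ℝ V) {k l : ℕ} (α : Alt V k) (N : V →ₗ[ℝ] Alt V l)
    (x : V) :
    ∑ i, contractExt (e i) (emb α) * contractExt x (emb (N (sharp (e.coord i)))) =
      ∑ i, contractExt (sharp (e.coord i)) (emb α) * contractExt x (emb (N (e i))) :=
  sum_sharp_swap e (LinearMap.mk₂ ℝ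
    (fun u v => contractExt u (emb α) * contractExt x (emb (N v)))
    (fun u u' v => by rw [contractExt_add_vec, add_mul])
    (fun c u v => by rw [contractExt_smul_vec, smul_mul_assoc])
    (fun u v v' => by rw [map_add, map_add, map_add, mul_add])
    (fun c u v => by rw [map_smul, map_smul, map_smul, mul_smul_comm]))

theorem sum_dualWedge_swap (e : Module.Basis ι ℝ V) {k l : ℕ} (α : Alt V k)
    (N : V →ₗ[ℝ] Alt V (l + 1)) (x : V) :
    ∑ i, dualWedge e N (e i) * contractExt x (contractExt (sharp (e.coord i)) (emb α)) =
      ∑ i, dualWedge e N (sharp (e.coord i)) * contractExt x (contractExt (e i) (emb α)) :=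
  sum_sharp_swap e (LinearMap.mk₂ ℝ
    (fun u v => dualWedge e N u * contractExt x (contractExt v (emb α)))
    (fun u u' v => by
      simp only [dualWedge, contractExt_add_vec, mul_add, Finset.sum_add_distrib, add_mul])
    (fun c u v => by
      simp only [dualWedge, contractExt_smul_vec, mul_smul_comm, ← Finset.smul_sum, smul_mul_assoc])
    (fun u v v' => by rw [contractExt_add_vec, map_add, mul_add])
    (fun c u v => by rw [contractExt_smul_vec, map_smul, mul_smul_comm]))

/-- The component along `e j` of the bracket of two forms that are contracted with the metric. -/
theorem brExpr_metricContraction (e : Module.Basis ι ℝ V) {k₁ k₂ : ℕ} (Ψ₁ : Alt V (k₁ + 1))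
    (N₁ : V →ₗ[ℝ] Alt V (k₁ + 1)) (Ψ₂ : Alt V (k₂ + 1)) (N₂ : V →ₗ[ℝ] Alt V (k₂ + 1)) (x : V) :
    brExpr e (metricContraction Ψ₁) (fun i => metricContraction (N₁ (e i)))
        (metricContraction Ψ₂) (fun i => metricContraction (N₂ (e i))) (innerₗ V x) =
      ∑ i, contractExt (e i) (emb Ψ₁) * contractExt x (emb (N₂ (sharp (e.coord i))))
      - (-1 : ℝ) ^ k₁ • ∑ i, contractExt x (contractExt (e i) (emb Ψ₁)) *
          dualWedge e N₂ (sharp (e.coord i))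
      - ∑ i, contractExt x (emb (N₁ (e i))) * contractExt (sharp (e.coord i)) (emb Ψ₂)
      - (-1 : ℝ) ^ k₁ • ∑ i, dualWedge e N₁ (e i) *
          contractExt x (contractExt (sharp (e.coord i)) (emb Ψ₂)) := by
  -- The component of δ(Ψ) along e^i is the contraction with (e^i)^♯, and along ⟨x, ·⟩ it is ι_x.
  -- Each half of the bracket thus has two terms.
  have hh : ∀ {k l : ℕ} (Ψ : Alt V (k + 1)) (N : V →ₗ[ℝ] Alt V (k + 1)) (Φ : Alt V (l + 1))
      (P : V →ₗ[ℝ] Alt V (l + 1)),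
      brHalf e (metricContraction Ψ) (fun i => metricContraction (N (e i)))
        (metricContraction Φ) (fun i => metricContraction (P (e i))) (innerₗ V x) =
      ∑ i, contractExt (sharp (e.coord i)) (emb Ψ) * contractExt x (emb (P (e i))) +
        (-1 : ℝ) ^ k • ∑ i, dualWedge e N (sharp (e.coord i)) *
          contractExt (e i) (contractExt x (emb Φ)) := fun Ψ N Φ P => by
    simp only [brHalf, lieExpr, emb_comp_innerₗ_metricContraction]
    simp only [emb_comp_metricContraction, dualWedge]
  -- `t2` and `t3` bring the second half of the bracket into the order Ψ₁ before Ψ₂, which absorbs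
  -- (-1)^{k₁k₂}; `t4` exchanges two contractions in the first half.
  have t2 : (-1 : ℝ) ^ k₁ • ∑ i, contractExt x (contractExt (e i) (emb Ψ₁)) *
      dualWedge e N₂ (sharp (e.coord i)) = ((-1 : ℝ) ^ (k₁ * k₂) * (-1 : ℝ) ^ k₂) •
        ∑ i, dualWedge e N₂ (sharp (e.coord i)) * contractExt (e i) (contractExt x (emb Ψ₁)) := by
    rw [Finset.smul_sum, Finset.smul_sum]
    refine Finset.sum_congr rfl fun i _ => ?_
    obtain ⟨β, hβ⟩ := exists_emb_eq_dualWedge e N₂ (sharp (e.coord i))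
    rw [← hβ, contract_contract_comm]
  have t3 : ∑ i, contractExt x (emb (N₁ (e i))) * contractExt (sharp (e.coord i)) (emb Ψ₂) =
      (-1 : ℝ) ^ (k₁ * k₂) •
        ∑ i, contractExt (sharp (e.coord i)) (emb Ψ₂) * contractExt x (emb (N₁ (e i))) := by
    rw [Finset.smul_sum]
    exact Finset.sum_congr rfl fun i _ => contract_comm _ _ _ _
  have t4 : ∑ i, dualWedge e N₁ (sharp (e.coord i)) * contractExt (e i) (contractExt x (emb Ψ₂)) =
      -∑ i, dualWedge e N₁ (sharp (e.coord i)) * contractExt x (contractExt (e i) (emb Ψ₂)) := by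
    rw [← Finset.sum_neg_distrib]
    refine Finset.sum_congr rfl fun i _ => ?_
    rw [contractExt_contractExt, mul_neg]
  rw [brExpr, hh, hh, sum_contract_swap, sum_dualWedge_swap, t2, t3, t4, smul_add, smul_neg,
    smul_smul]
  abel

/-- For odd degree and equal arguments, the four terms of the bracket agree in pairs. -/
theorem sum_contract_of_odd (e : Module.Basis ι ℝ V) {k : ℕ} (hk : Odd k) (Ψ : Alt V (k + 1))
    (N : V →ₗ[ℝ] Alt V (k + 1)) (x : V) :
    ∑ i, contractExt (e i) (emb Ψ) * contractExt x (emb (N (sharp (e.coord i))))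
      - (-1 : ℝ) ^ k • ∑ i, contractExt x (contractExt (e i) (emb Ψ)) *
          dualWedge e N (sharp (e.coord i))
      - ∑ i, contractExt x (emb (N (e i))) * contractExt (sharp (e.coord i)) (emb Ψ)
      - (-1 : ℝ) ^ k • ∑ i, dualWedge e N (e i) *
          contractExt x (contractExt (sharp (e.coord i)) (emb Ψ)) =
    (2 : ℝ) • (∑ i, contractExt (e i) (emb Ψ) * contractExt x (emb (N (sharp (e.coord i))))
      + ∑ i, contractExt x (contractExt (e i) (emb Ψ)) * dualWedge e N (sharp (e.coord i))) := by
  -- For odd k the product k·k is odd, so the third term becomes a second copy of the first; `t4`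
  -- makes the fourth a second copy of the second.
  have t3 : ∑ i, contractExt x (emb (N (e i))) * contractExt (sharp (e.coord i)) (emb Ψ) =
      -∑ i, contractExt (sharp (e.coord i)) (emb Ψ) * contractExt x (emb (N (e i))) := by
    rw [← Finset.sum_neg_distrib]
    refine Finset.sum_congr rfl fun i _ => ?_
    rw [contract_comm, (hk.mul hk).neg_one_pow, neg_one_smul]
  have t4 : ∑ i, dualWedge e N (sharp (e.coord i)) * contractExt x (contractExt (e i) (emb Ψ)) =
      ∑ i, contractExt x (contractExt (e i) (emb Ψ)) * dualWedge e N (sharp (e.coord i)) := by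
    refine Finset.sum_congr rfl fun i _ => ?_
    obtain ⟨β, hβ⟩ := exists_emb_eq_dualWedge e N (sharp (e.coord i))
    have h := contract_contract_comm Ψ β x (e i)
    rw [hk.neg_one_pow, (hk.mul hk).neg_one_pow, contractExt_contractExt (e i) x] at h
    simp only [neg_smul, one_smul, mul_neg, mul_one, neg_neg] at h
    rw [← hβ]
    exact (neg_injective h).symm
  rw [sum_dualWedge_swap, t3, t4, sum_contract_swap, hk.neg_one_pow, two_smul]
  simp only [neg_smul, one_smul]
  abel

end MetricFormula

/-! ### Degree bookkeeping for the summands -/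

section Degrees

variable {V : Type*} [AddCommGroup V] [Module ℝ V] {k l : ℕ} (α : Alt V (k + 1))
  (β : Alt V (l + 1)) (x y z : V) (φ : V →ₗ[ℝ] ℝ)

theorem emb_wedge_interiorProd :
    emb (toDegree (k + l) (wedge (interiorProd x α) (interiorProd y β))) =
      contractExt x (emb α) * contractExt y (emb β) := by
  rw [contractExt_emb, contractExt_emb]
  exact emb_toDegree_wedge (Or.inl rfl)

/-- For k = 0 truncated subtraction breaks the degree count, and `toDegree` returns 0; this is
correct, as a double contraction of a 1-form vanishes. -/
theorem emb_wedge_interiorProd_interiorProd_left :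
    emb (toDegree (k + l) (wedge (interiorProd x (interiorProd y α))
        (wedge (oneForm φ) (interiorProd z β)))) =
      contractExt x (contractExt y (emb α)) *
        (emb (oneForm φ) * contractExt z (emb β)) := by
  rw [emb_toDegree_wedge, ← emb_mul, emb_interiorProd, emb_interiorProd, emb_interiorProd]
  rcases k with _ | k
  · exact Or.inr (Or.inl rfl)
  · exact Or.inl (by omega)

theorem emb_wedge_interiorProd_interiorProd_right :
    emb (toDegree (k + l) (wedge (wedge (oneForm φ) (interiorProd z α))
        (interiorProd x (interiorProd y β)))) =
      (emb (oneForm φ) * contractExt z (emb α)) * contractExt x (contractExt y (emb β)) := by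
  rw [emb_toDegree_wedge, ← emb_mul, emb_interiorProd, emb_interiorProd, emb_interiorProd]
  rcases l with _ | l
  · exact Or.inr (Or.inr rfl)
  · exact Or.inl (by omega)

end Degrees

/-! ### From components to the vector-valued formula -/

section Final

variable {V : Type*} [NormedAddCommGroup V] [InnerProductSpace ℝ V] [FiniteDimensional ℝ V]
  {ι : Type*} [Fintype ι]

/-- A vector-valued form whose components are those of the bracket is given by the formula for the
Frölicher-Nijenhuis bracket. -/
theorem eq_sum_tensorVec_of_brExpr (e : Module.Basis ι ℝ V) {k₁ k₂ : ℕ} (Ψ₁ : Alt V (k₁ + 1))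
    (N₁ : V →ₗ[ℝ] Alt V (k₁ + 1)) (Ψ₂ : Alt V (k₂ + 1)) (N₂ : V →ₗ[ℝ] Alt V (k₂ + 1))
    {X : V [⋀^Fin (k₁ + k₂)]→ₗ[ℝ] V} (hX : ∀ φ, emb (comp φ X) =
      brExpr e (metricContraction Ψ₁) (fun i => metricContraction (N₁ (e i)))
        (metricContraction Ψ₂) (fun i => metricContraction (N₂ (e i))) φ) :
    X = ∑ j, tensorVec
      ((∑ i, toDegree (k₁ + k₂) (wedge (interiorProd (e i) Ψ₁)
          (interiorProd (e j) (N₂ (sharp (e.coord i))))))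
        - (-1 : ℝ) ^ k₁ • (∑ i, ∑ k, toDegree (k₁ + k₂)
          (wedge (interiorProd (e j) (interiorProd (e i) Ψ₁))
            (wedge (oneForm (e.coord k)) (interiorProd (sharp (e.coord i)) (N₂ (e k))))))
        - (∑ i, toDegree (k₁ + k₂) (wedge (interiorProd (e j) (N₁ (e i)))
            (interiorProd (sharp (e.coord i)) Ψ₂)))
        - (-1 : ℝ) ^ k₁ • (∑ i, ∑ k, toDegree (k₁ + k₂)
          (wedge (wedge (oneForm (e.coord k)) (interiorProd (e i) (N₁ (e k))))
            (interiorProd (e j) (interiorProd (sharp (e.coord i)) Ψ₂)))))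
      (sharp (e.coord j)) := by
  -- Expanding in the vectors (e^j)^♯ makes the coefficient the component along ⟨e_j, ·⟩, to which
  -- the four-term formula applies with x = e_j.
  conv_lhs => rw [← sum_tensorVec_comp_innerₗ e X]
  refine Finset.sum_congr rfl fun j _ => congrArg (fun κ => tensorVec κ _) (emb_injective ?_)
  rw [hX, brExpr_metricContraction]
  simp only [map_sub, map_smul, map_sum, emb_wedge_interiorProd,
    emb_wedge_interiorProd_interiorProd_left, emb_wedge_interiorProd_interiorProd_right, dualWedge,
    Finset.mul_sum, Finset.sum_mul]

theorem eq_smul_sum_tensorVec_of_brExpr (e : Module.Basis ι ℝ V) {k : ℕ} (hk : Odd k)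
    (Ψ : Alt V (k + 1)) (N : V →ₗ[ℝ] Alt V (k + 1)) {X : V [⋀^Fin (k + k)]→ₗ[ℝ] V}
    (hX : ∀ φ, emb (comp φ X) =
      brExpr e (metricContraction Ψ) (fun i => metricContraction (N (e i)))
        (metricContraction Ψ) (fun i => metricContraction (N (e i))) φ) :
    X = (2 : ℝ) • ∑ j, tensorVec
      ((∑ i, toDegree (k + k) (wedge (interiorProd (e i) Ψ)
          (interiorProd (e j) (N (sharp (e.coord i))))))
        + (∑ i, ∑ m, toDegree (k + k)
          (wedge (interiorProd (e j) (interiorProd (e i) Ψ))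
            (wedge (oneForm (e.coord m)) (interiorProd (sharp (e.coord i)) (N (e m)))))))
      (sharp (e.coord j)) := by
  conv_lhs => rw [← sum_tensorVec_comp_innerₗ e X]
  rw [Finset.smul_sum]
  refine Finset.sum_congr rfl fun j _ => ?_
  refine Eq.trans ?_ (map_smul (tensorVecₗ (sharp (e.coord j)) (k + k)) (2 : ℝ) _)
  refine congrArg (fun κ => tensorVec κ (sharp (e.coord j))) (emb_injective ?_)
  rw [hX, brExpr_metricContraction, sum_contract_of_odd e hk]
  simp only [map_add, map_smul, map_sum, emb_wedge_interiorProd,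
    emb_wedge_interiorProd_interiorProd_left, dualWedge, Finset.mul_sum]

end Final

/-! ### Linearity of the covariant derivative in its direction -/

section CovDeriv

variable {n : ℕ} {M : Type*} [TopologicalSpace M] [ChartedSpace (EuclideanSpace ℝ (Fin n)) M]
  [IsManifold (𝓡 n) ∞ M]

theorem endAction_add {V : Type*} [AddCommGroup V] [Module ℝ V] (A B : V →ₗ[ℝ] V) {k : ℕ}
    (η : Alt V k) : endAction (A + B) η = endAction A η + endAction B η := by
  ext v
  rw [AlternatingMap.add_apply, endAction_apply, endAction_apply, endAction_apply,
    ← Finset.sum_add_distrib]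
  exact Finset.sum_congr rfl fun i _ => η.map_update_add v i _ _

theorem endAction_smul {V : Type*} [AddCommGroup V] [Module ℝ V] (c : ℝ) (A : V →ₗ[ℝ] V) {k : ℕ}
    (η : Alt V k) : endAction (c • A) η = c • endAction A η := by
  ext v
  rw [AlternatingMap.smul_apply, endAction_apply, endAction_apply, Finset.smul_sum]
  exact Finset.sum_congr rfl fun i _ => η.map_update_smul v i _ _

/-- The covariant derivative of a form at a point as a linear map. -/
noncomputable def covDerivFormₗ (D : CovariantDerivative (𝓡 n) (EuclideanSpace ℝ (Fin n))
    (TangentSpace (𝓡 n) : M → Type _)) {k : ℕ} (Ψ : Form n M k) (p : M) :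
    TangentSpace (𝓡 n) p →ₗ[ℝ] Alt (TangentSpace (𝓡 n) p) k where
  toFun := covDerivForm D Ψ p
  map_add' v w := by
    rw [covDerivForm, covDerivForm, covDerivForm, map_add, map_add]
    have h : connCoeff D p (v + w) = connCoeff D p v + connCoeff D p w :=
      LinearMap.ext fun u => map_add (D (FiberBundle.extend _ u) p) v w
    rw [h, endAction_add]
    ext u
    simp only [AlternatingMap.sub_apply, AlternatingMap.add_apply]
    exact add_sub_add_comm (_ : ℝ) _ _ _
  map_smul' c v := by
    rw [covDerivForm, covDerivForm, map_smul, map_smul]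
    have h : connCoeff D p (c • v) = c • connCoeff D p v :=
      LinearMap.ext fun u => map_smul (D (FiberBundle.extend _ u) p) c v
    rw [h, endAction_smul, RingHom.id_apply]
    ext u
    simp only [AlternatingMap.sub_apply, AlternatingMap.smul_apply]
    exact (smul_sub c (_ : ℝ) _).symm

end CovDeriv

end FN

theorem proposition2p2 {n : ℕ} {M : Type*} [TopologicalSpace M] [T2Space M]
    [ChartedSpace (EuclideanSpace ℝ (Fin n)) M] [IsManifold (𝓡 n) ∞ M]
    [RiemannianBundle (TangentSpace (𝓡 n) : M → Type _)]
    [IsContMDiffRiemannianBundle (𝓡 n) ∞ (EuclideanSpace ℝ (Fin n))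
      (TangentSpace (𝓡 n) : M → Type _)]
    (D : CovariantDerivative (𝓡 n) (EuclideanSpace ℝ (Fin n)) (TangentSpace (𝓡 n) : M → Type _))
    (hD : IsLeviCivita D) :
    (∀ (k₁ k₂ : ℕ) (Ψ₁ : Form n M (k₁ + 1)) (Ψ₂ : Form n M (k₂ + 1)),
      SmoothForm Ψ₁ → SmoothForm Ψ₂ →
      (∃! K, IsFNBracket (delta Ψ₁) (delta Ψ₂) K) ∧
      (∀ (p : M) (e : Module.Basis (Fin n) ℝ (TangentSpace (𝓡 n) p)),
        fnBracket (delta Ψ₁) (delta Ψ₂) p =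
          ∑ j, tensorVec
            ((∑ i, toDegree (k₁ + k₂) (wedge (interiorProd (e i) (Ψ₁ p))
                (interiorProd (e j) (covDerivForm D Ψ₂ p (sharp (e.coord i))))))
              - (-1 : ℝ) ^ k₁ • (∑ i, ∑ k, toDegree (k₁ + k₂)
                (wedge (interiorProd (e j) (interiorProd (e i) (Ψ₁ p)))
                  (wedge (oneForm (e.coord k))
                    (interiorProd (sharp (e.coord i)) (covDerivForm D Ψ₂ p (e k))))))
              - (∑ i, toDegree (k₁ + k₂)
                (wedge (interiorProd (e j) (covDerivForm D Ψ₁ p (e i)))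
                  (interiorProd (sharp (e.coord i)) (Ψ₂ p))))
              - (-1 : ℝ) ^ k₁ • (∑ i, ∑ k, toDegree (k₁ + k₂)
                (wedge (wedge (oneForm (e.coord k)) (interiorProd (e i) (covDerivForm D Ψ₁ p (e k))))
                  (interiorProd (e j) (interiorProd (sharp (e.coord i)) (Ψ₂ p))))))
            (sharp (e.coord j))) ∧
      (∀ (p : M) (e : Module.Basis (Fin n) ℝ (TangentSpace (𝓡 n) p)), Orthonormal ℝ e →
        fnBracket (delta Ψ₁) (delta Ψ₂) p =
          ∑ j, tensorVec
            ((∑ i, toDegree (k₁ + k₂) (wedge (interiorProd (e i) (Ψ₁ p))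
                (interiorProd (e j) (covDerivForm D Ψ₂ p (e i)))))
              - (-1 : ℝ) ^ k₁ • (∑ i, ∑ k, toDegree (k₁ + k₂)
                (wedge (interiorProd (e j) (interiorProd (e i) (Ψ₁ p)))
                  (wedge (oneForm (e.coord k)) (interiorProd (e i) (covDerivForm D Ψ₂ p (e k))))))
              - (∑ i, toDegree (k₁ + k₂)
                (wedge (interiorProd (e j) (covDerivForm D Ψ₁ p (e i))) (interiorProd (e i) (Ψ₂ p))))
              - (-1 : ℝ) ^ k₁ • (∑ i, ∑ k, toDegree (k₁ + k₂)
                (wedge (wedge (oneForm (e.coord k)) (interiorProd (e i) (covDerivForm D Ψ₁ p (e k))))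
                  (interiorProd (e j) (interiorProd (e i) (Ψ₂ p))))))
            (sharp (e.coord j)))) ∧
    (∀ (k : ℕ) (Ψ : Form n M (k + 1)), Odd k → SmoothForm Ψ →
      (∀ (p : M) (e : Module.Basis (Fin n) ℝ (TangentSpace (𝓡 n) p)),
        fnBracket (delta Ψ) (delta Ψ) p =
          (2 : ℝ) • ∑ j, tensorVec
            ((∑ i, toDegree (k + k) (wedge (interiorProd (e i) (Ψ p))
                (interiorProd (e j) (covDerivForm D Ψ p (sharp (e.coord i))))))
              + (∑ i, ∑ m, toDegree (k + k)
                (wedge (interiorProd (e j) (interiorProd (e i) (Ψ p)))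
                  (wedge (oneForm (e.coord m))
                    (interiorProd (sharp (e.coord i)) (covDerivForm D Ψ p (e m)))))))
            (sharp (e.coord j))) ∧
      (∀ (p : M) (e : Module.Basis (Fin n) ℝ (TangentSpace (𝓡 n) p)), Orthonormal ℝ e →
        fnBracket (delta Ψ) (delta Ψ) p =
          (2 : ℝ) • ∑ j, tensorVec
            ((∑ i, toDegree (k + k) (wedge (interiorProd (e i) (Ψ p))
                (interiorProd (e j) (covDerivForm D Ψ p (e i)))))
              + (∑ i, ∑ m, toDegree (k + k)
                (wedge (interiorProd (e j) (interiorProd (e i) (Ψ p)))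
                  (wedge (oneForm (e.coord m)) (interiorProd (e i) (covDerivForm D Ψ p (e m)))))))
            (sharp (e.coord j)))) := by
  -- The algebraic formulas need ∇Ψ as a linear map of the direction, because it is evaluated at
  -- (e^i)^♯ as well as at e_i.
  have key : ∀ {k₁ k₂ : ℕ} {Ψ₁ : Form n M (k₁ + 1)} {Ψ₂ : Form n M (k₂ + 1)}, SmoothForm Ψ₁ →
      SmoothForm Ψ₂ → ∀ (p : M) (e : Module.Basis (Fin n) ℝ (TangentSpace (𝓡 n) p)) φ,
      emb (comp φ (fnBracket (delta Ψ₁) (delta Ψ₂) p)) =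
        brExpr e (metricContraction (Ψ₁ p))
          (fun i => metricContraction (covDerivFormₗ D Ψ₁ p (e i))) (metricContraction (Ψ₂ p))
          (fun i => metricContraction (covDerivFormₗ D Ψ₂ p (e i))) φ :=
    fun h₁ h₂ p e φ => emb_comp_fnBracket_delta hD h₁ h₂ p e φ
  have h1 := fun {k₁ k₂ : ℕ} {Ψ₁ : Form n M (k₁ + 1)} {Ψ₂ : Form n M (k₂ + 1)}
      (h₁ : SmoothForm Ψ₁) (h₂ : SmoothForm Ψ₂) (p : M)
      (e : Module.Basis (Fin n) ℝ (TangentSpace (𝓡 n) p)) =>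
    eq_sum_tensorVec_of_brExpr e (Ψ₁ p) (covDerivFormₗ D Ψ₁ p) (Ψ₂ p) (covDerivFormₗ D Ψ₂ p)
      (key h₁ h₂ p e)
  have h2 := fun {k : ℕ} {Ψ : Form n M (k + 1)} (hk : Odd k) (h : SmoothForm Ψ) (p : M)
      (e : Module.Basis (Fin n) ℝ (TangentSpace (𝓡 n) p)) =>
    eq_smul_sum_tensorVec_of_brExpr e hk (Ψ p) (covDerivFormₗ D Ψ p) (key h h p e)
  refine ⟨fun k₁ k₂ Ψ₁ Ψ₂ h₁ h₂ => ⟨existsUnique_isFNBracket h₁.delta h₂.delta, h1 h₁ h₂,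
    fun p e he => ?_⟩, fun k Ψ hk h => ⟨h2 hk h, fun p e he => ?_⟩⟩
  -- For an orthonormal basis (e^i)^♯ = e_i, and the general formula specializes.
  · have h3 := h1 h₁ h₂ p e
    simp only [sharp_coord_of_orthonormal he] at h3 ⊢
    exact h3
  · have h3 := h2 hk h p e
    simp only [sharp_coord_of_orthonormal he] at h3 ⊢
    exact h3
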